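/- **Conventions.** Let $R$ be a commutative ring in which $2$ is invertible, $I\subsetneq R$ an ideal, and let $G(n,-)$ be one of: $\mathrm{GL}_n$ with $n\ge 3$; $\mathrm{Sp}_{n}$ with $n=2m$, $m\ge 2$; $\mathrm{O}_{n}$ with $n=2m$, $m\ge 3$. Here $\mathrm{Sp}_{2m}(R)$ and $\mathrm{O}_{2m}(R)$ are the groups of invertible $\alpha$ with $\alpha^t\psi\alpha=\psi$, where $\psi=\sum_{i=1}^m (e_{2i-1,2i}-e_{2i,2i-1})$ in the symplectic case and $\psi=\sum_{i=1}^m (e_{2i-1,2i}+e_{2i,2i-1})$ in the orthogonal case. Let $\sigma$ be the permutation interchanging $2i-1$ and $2i$. The elementary generators $ge_{ij}(z)$ are: $\mathrm I_n+ze_{ij}$ ($i\ne j$) in the linear case; $\mathrm I_n+ze_{ij}$ ($i=\sigma(j)$) and $\mathrm I_n+ze_{ij}-(-1)^{i+j}ze_{\sigma(j)\sigma(i)}$ ($i\neq\sigma(j)$, $i<j$) in the symplectic case; $\mathrm I_n+ze_{ij}-ze_{\sigma(j)\sigma(i)}$ ($i\ne\sigma(j)$, $i<j$) in the orthogonal case.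 For a commutative ring $A$ and an ideal $J$ of $A$: $E(n,A)$ is the group generated by all $ge_{ij}(x)$, $x\in A$; $E(n,J)$ is the group generated by all $ge_{ij}(x)$, $x\in J$; $E(n,A,J)$ is the normal closure of $E(n,J)$ in $E(n,A)$; $G(n,A,J)$ is the group of all $\alpha\in G(n,A)$ with $\alpha\equiv \mathrm I_n$ modulo $J$; and $\mathrm{Um}_n(A,J)$ is the set of unimodular vectors congruent to $e_1=(1,0,\dots,0)^t$ modulo $J$. For $v,w\in R^n$ put $M(v,w)=vw^t$, $\langle v,w\rangle=v^tw$ in the linear case; otherwise, with $\widetilde v=v^t\psi$, put $\langle v,w\rangle=\widetilde v\,w$ and $M(v,w)=v\widetilde w+w\widetilde v$ (symplectic), $M(v,w)=v\widetilde w-w\widetilde v$ (orthogonal). In the orthogonal case the vectors $v$ and $w$ below are moreover required to be isotropic: $\langle v,v\rangle=\langle w,w\rangle=0$. $I[X]$, $I_{\mathfrak m}[X]$, $I_s[X]$ are the extensions of $I$ to $R[X]$, $R_{\mathfrak m}[X]$, $R_s[X]$, and $\alpha_{\mathfrak m}(X)$, $\alpha_s(X)$ are the images of $\alpha(X)$ over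 the last two rings. **Theorem.** The following seven statements are equivalent, and all of them hold. 1. (Normality) $E(n,R,I)$ is a normal subgroup of $G(n,R)$. 2. $\mathrm I_n+M(v,w)\in E(n,R,I)$ whenever $v\in \mathrm{Um}_n(R,I)$, $w\in I^n$ and $\langle v,w\rangle=0$. 3. (Local-global principle) If $\alpha(X)\in G(n,R[X],I[X])$, $\alpha(0)=\mathrm I_n$, and $\alpha_{\mathfrak m}(X)\in E(n,R_{\mathfrak m}[X],I_{\mathfrak m}[X])$ for every maximal ideal $\mathfrak m$ of $R$, then $\alpha(X)\in E(n,R[X],I[X])$. 4. (Dilation principle) If $\alpha(X)\in G(n,R[X],I[X])$, $\alpha(0)=\mathrm I_n$, and $\alpha_s(X)\in E(n,R_s[X],I_s[X])$ for some non-nilpotent $s\in R$, then there is $l_0$ such that $\alpha(bX)\in E(n,R[X],I[X])$ for all $l\ge l_0$ and all $b\in (s^l)$. 5. If $v\in E(n,R,I)e_1$, $w\in I^n$ and $\langle v,w\rangle=0$, then there is $d_0$ such that for all $d\ge d_0$ the matrix $\mathrm I_n+X^dM(v,w)$ lies in $E(n,R[X],I[X])$ and is a finite product of matrices $ge_{ij}(Xh(X))$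 with $h(X)\in I[X]$. 6. $\mathrm I_n+M(v,w)\in E(n,R,I)$ whenever $v\in E(n,R,I)e_1$, $w\in I^n$ and $\langle v,w\rangle=0$. 7. $\mathrm I_n+M(v,w)\in E(n,R,I)$ whenever $v\in G(n,R,I)e_1$, $w\in I^n$ and $\langle v,w\rangle=0$. -/

import Mathlib

open Polynomial Matrix

namespace ClassicalRel

/-- The three families of classical groups. -/
inductive GroupType
  | linear
  | symplectic
  | orthogonal

/-- The sizes that are considered: `n ≥ 3` for the linear groups, `n = 2m` with `m ≥ 2` for the
symplectic groups, `n = 2m` with `m ≥ 3` for the orthogonal groups. -/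
def GroupType.Admissible : GroupType → ℕ → Prop
  | .linear, n => 3 ≤ n
  | .symplectic, n => ∃ m : ℕ, 2 ≤ m ∧ n = 2 * m
  | .orthogonal, n => ∃ m : ℕ, 3 ≤ m ∧ n = 2 * m

/-- The permutation `σ` exchanging the two members of each pair of consecutive indices.
Indices start at `0` here, so the pairs are `(0,1), (2,3), …`. It is only used for even `n`
(for odd `n` the last index, which has no partner, is fixed). -/
def sigma {n : ℕ} (i : Fin n) : Fin n :=
  if i.val % 2 = 0 then
    if h : i.val + 1 < n then ⟨i.val + 1, h⟩ else i
  else ⟨i.val - 1, by omega⟩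

section Basic

variable {R : Type*} [CommRing R]

/-- The alternating matrix of the standard symplectic form: `1` at the places
`(0,1), (2,3), …`, and `-1` at the places `(1,0), (3,2), …`. -/
def psi (n : ℕ) (R : Type*) [CommRing R] : Matrix (Fin n) (Fin n) R :=
  Matrix.of fun i j => if j = sigma i then (-1) ^ i.val else 0

/-- The symmetric matrix of the standard hyperbolic form: `1` at the places
`(0,1), (1,0), (2,3), (3,2), …`. -/
def psiTilde (n : ℕ) (R : Type*) [CommRing R] : Matrix (Fin n) (Fin n) R :=
  Matrix.of fun i j => if j = sigma i then 1 else 0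

/-- The group of all invertible `α` with `αᵀ B α = B`. -/
def isometryGroup {n : ℕ} (B : Matrix (Fin n) (Fin n) R) : Subgroup (GL (Fin n) R) where
  carrier := {α | (α : Matrix (Fin n) (Fin n) R)ᵀ * B * (α : Matrix (Fin n) (Fin n) R) = B}
  one_mem' := by simp
  mul_mem' := by
    intro a b ha hb
    simp only [Set.mem_ofPred_eq, Units.val_mul, Matrix.transpose_mul] at *
    calc (b.val)ᵀ * (a.val)ᵀ * B * (a.val * b.val)
        = (b.val)ᵀ * ((a.val)ᵀ * B * a.val) * b.val := by simp only [Matrix.mul_assoc]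
      _ = B := by rw [ha, hb]
  inv_mem' := by
    intro a ha
    simp only [Set.mem_ofPred_eq] at *
    have h1 : a.val * (a⁻¹).val = 1 := by simp
    have h2 : ((a⁻¹).val)ᵀ * (a.val)ᵀ = 1 := by
      rw [← Matrix.transpose_mul, h1, Matrix.transpose_one]
    calc ((a⁻¹).val)ᵀ * B * (a⁻¹).val
        = ((a⁻¹).val)ᵀ * ((a.val)ᵀ * B * a.val) * (a⁻¹).val := by rw [ha]
      _ = (((a⁻¹).val)ᵀ * (a.val)ᵀ) * B * (a.val * (a⁻¹).val) := by
          simp only [Matrix.mul_assoc]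
      _ = B := by rw [h1, h2]; simp

/-- The classical group `G(n, R)`: `GL_n(R)`, `Sp_n(R)` or `O_n(R)`. -/
def G (k : GroupType) (n : ℕ) (R : Type*) [CommRing R] : Subgroup (GL (Fin n) R) :=
  match k with
  | .linear => ⊤
  | .symplectic => isometryGroup (psi n R)
  | .orthogonal => isometryGroup (psiTilde n R)

/-- The relative group `G(n, R, I)` of all `α ∈ G(n, R)` congruent to the identity modulo `I`. -/
def relG (k : GroupType) (n : ℕ) (I : Ideal R) : Subgroup (GL (Fin n) R) :=
  G k n R ⊓ (Matrix.GeneralLinearGroup.map (Ideal.Quotient.mk I)).ker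

/-- The pairs of indices `(i, j)` for which there is an elementary generator `ge_ij`. -/
def IsGenIndex {n : ℕ} (k : GroupType) (i j : Fin n) : Prop :=
  match k with
  | .linear => i ≠ j
  | .symplectic => i ≠ j ∧ (i = sigma j ∨ i < j)
  | .orthogonal => i ≠ sigma j ∧ i < j

/-- The elementary generator `ge_ij(z)`, as a matrix. -/
def ge {n : ℕ} (k : GroupType) (i j : Fin n) (z : R) : Matrix (Fin n) (Fin n) R :=
  match k with
  | .linear => 1 + Matrix.single i j z
  | .symplectic =>
      if i = sigma j then 1 + Matrix.single i j z
      else 1 + Matrix.single i j z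
        - Matrix.single (sigma j) (sigma i) ((-1) ^ (i.val + j.val) * z)
  | .orthogonal => 1 + Matrix.single i j z - Matrix.single (sigma j) (sigma i) z

/-- `E(n, I)`: the group generated by all `ge_ij(x)` with `x ∈ I`. -/
def elemIdeal (k : GroupType) (n : ℕ) (I : Ideal R) : Subgroup (GL (Fin n) R) :=
  Subgroup.closure {g | ∃ i j : Fin n, IsGenIndex k i j ∧
    ∃ x ∈ I, (g : Matrix (Fin n) (Fin n) R) = ge k i j x}

/-- The elementary group `E(n, R)`. -/
def elem (k : GroupType) (n : ℕ) (R : Type*) [CommRing R] : Subgroup (GL (Fin n) R) :=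
  elemIdeal k n (⊤ : Ideal R)

/-- The relative elementary group `E(n, R, I)`: the normal closure of `E(n, I)` in `E(n, R)`. -/
def relE (k : GroupType) (n : ℕ) (I : Ideal R) : Subgroup (GL (Fin n) R) :=
  (Subgroup.normalClosure
    ((elemIdeal k n I).subgroupOf (elem k n R) : Set (elem k n R))).map (elem k n R).subtype

/-- The first standard basis vector. -/
def e1 (n : ℕ) (R : Type*) [CommRing R] : Fin n → R := fun i => if i.val = 0 then 1 else 0

/-- The row `ṽ = vᵀ ψ` (symplectic case), `ṽ = vᵀ ψ̃` (orthogonal case); in the linear case it is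
`vᵀ`, and is not used. -/
def tilde {n : ℕ} (k : GroupType) (v : Fin n → R) : Fin n → R :=
  match k with
  | .linear => v
  | .symplectic => v ᵥ* psi n R
  | .orthogonal => v ᵥ* psiTilde n R

/-- The matrix `M(v, w)`. -/
def M {n : ℕ} (k : GroupType) (v w : Fin n → R) : Matrix (Fin n) (Fin n) R :=
  match k with
  | .linear => vecMulVec v w
  | .symplectic => vecMulVec v (tilde .symplectic w) + vecMulVec w (tilde .symplectic v)
  | .orthogonal => vecMulVec v (tilde .orthogonal w) - vecMulVec w (tilde .orthogonal v)

/-- The inner product `⟨v, w⟩`. -/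
def pairing {n : ℕ} (k : GroupType) (v w : Fin n → R) : R :=
  match k with
  | .linear => v ⬝ᵥ w
  | .symplectic => tilde .symplectic v ⬝ᵥ w
  | .orthogonal => tilde .orthogonal v ⬝ᵥ w

/-- In the orthogonal case only vectors orthogonal to themselves are considered; in the other
cases there is no restriction. -/
def VectorOK {n : ℕ} (k : GroupType) (v : Fin n → R) : Prop :=
  match k with
  | .linear => True
  | .symplectic => True
  | .orthogonal => pairing .orthogonal v v = 0

/-- `Um_n(R, I)`: the unimodular vectors congruent to `e₁` modulo `I`. -/
def Um (n : ℕ) (I : Ideal R) : Set (Fin n → R) :=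
  {v | (∃ u : Fin n → R, u ⬝ᵥ v = 1) ∧ ∀ i, v i - e1 n R i ∈ I}

/-- The set `H e₁` of all first columns of members of `H`. -/
def orbitE1 {n : ℕ} (H : Subgroup (GL (Fin n) R)) : Set (Fin n → R) :=
  {v | ∃ g ∈ H, v = (g : Matrix (Fin n) (Fin n) R) *ᵥ e1 n R}

/-- The pairs of vectors `v`, `w ∈ Iⁿ` with `⟨v, w⟩ = 0` (both isotropic in the orthogonal
case). -/
def GoodPair {n : ℕ} (k : GroupType) (I : Ideal R) (v w : Fin n → R) : Prop :=
  (∀ i, w i ∈ I) ∧ pairing k v w = 0 ∧ VectorOK k v ∧ VectorOK k w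

/-- The matrix `A` is a member of the group `H` of invertible matrices. -/
def MatMem {n : ℕ} (A : Matrix (Fin n) (Fin n) R) (H : Subgroup (GL (Fin n) R)) : Prop :=
  ∃ g ∈ H, (g : Matrix (Fin n) (Fin n) R) = A

/-- The extension `I[X]` of `I` to `R[X]`. -/
noncomputable def polyIdeal (I : Ideal R) : Ideal R[X] := I.map (C : R →+* R[X])

/-- The extension of `I[X]` to `S[X]`, for an `R`-algebra `S`. -/
noncomputable def polyIdealExt (I : Ideal R) (S : Type*) [CommRing S] [Algebra R S] : Ideal S[X] :=
  (polyIdeal I).map (Polynomial.mapRingHom (algebraMap R S))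

/-- The image of `α(X)` over `S[X]`, for an `R`-algebra `S`. -/
noncomputable def baseChange {n : ℕ} (S : Type*) [CommRing S] [Algebra R S]
    (α : GL (Fin n) R[X]) : GL (Fin n) S[X] :=
  Matrix.GeneralLinearGroup.map (Polynomial.mapRingHom (algebraMap R S)) α

/-- `α(0)`. -/
noncomputable def evalZero {n : ℕ} (α : GL (Fin n) R[X]) : GL (Fin n) R :=
  Matrix.GeneralLinearGroup.map (Polynomial.evalRingHom (0 : R)) α

/-- `α(bX)`. -/
noncomputable def dilate {n : ℕ} (b : R) (α : GL (Fin n) R[X]) : GL (Fin n) R[X] :=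
  Matrix.GeneralLinearGroup.map (Polynomial.compRingHom (C b * X)) α

end Basic

section Statements

variable {R : Type*} [CommRing R]

/-- Normality: `E(n, R, I)` is a normal subgroup of `G(n, R)`. -/
def Normality (k : GroupType) (n : ℕ) (I : Ideal R) : Prop :=
  relE k n I ≤ G k n R ∧ ((relE k n I).subgroupOf (G k n R)).Normal

/-- `I_n + M(v, w) ∈ E(n, R, I)` for all `v ∈ V` and all `w ∈ Iⁿ` with `⟨v, w⟩ = 0`. -/
def TransvectionsElementary (k : GroupType) (n : ℕ) (I : Ideal R) (V : Set (Fin n → R)) : Prop :=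
  ∀ v w : Fin n → R, v ∈ V → GoodPair k I v w → MatMem (1 + M k v w) (relE k n I)

/-- The relative local-global principle. -/
def LocalGlobal (k : GroupType) (n : ℕ) (I : Ideal R) : Prop :=
  ∀ α : GL (Fin n) R[X], α ∈ relG k n (polyIdeal I) → evalZero α = 1 →
    (∀ (𝔪 : Ideal R) [𝔪.IsMaximal],
      baseChange (Localization.AtPrime 𝔪) α ∈
        relE k n (polyIdealExt I (Localization.AtPrime 𝔪))) →
    α ∈ relE k n (polyIdeal I)

/-- The relative dilation principle. -/
def Dilation (k : GroupType) (n : ℕ) (I : Ideal R) : Prop :=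
  ∀ α : GL (Fin n) R[X], α ∈ relG k n (polyIdeal I) → evalZero α = 1 →
    ∀ s : R, ¬ IsNilpotent s →
      baseChange (Localization.Away s) α ∈ relE k n (polyIdealExt I (Localization.Away s)) →
      ∃ l₀ : ℕ, ∀ l ≥ l₀, ∀ b ∈ Ideal.span {s ^ l}, dilate b α ∈ relE k n (polyIdeal I)

/-- The decomposition statement for `I_n + X ^ d M(v, w)`, with `v ∈ E(n, R, I) e₁`: for all large
`d` this matrix lies in `E(n, R[X], I[X])`, and is a product of matrices `ge_ij(X h(X))` with
`h(X) ∈ I[X]`. -/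
def PolynomialDecomposition (k : GroupType) (n : ℕ) (I : Ideal R) : Prop :=
  ∀ v w : Fin n → R, v ∈ orbitE1 (relE k n I) → GoodPair k I v w →
    ∃ d₀ : ℕ, ∀ d ≥ d₀,
      MatMem (1 + (X : R[X]) ^ d • (M k v w).map C) (relE k n (polyIdeal I)) ∧
      ∃ L : List (Fin n × Fin n × R[X]),
        (∀ t ∈ L, IsGenIndex k t.1 t.2.1 ∧ t.2.2 ∈ polyIdeal I) ∧
        1 + (X : R[X]) ^ d • (M k v w).map C = (L.map fun t => ge k t.1 t.2.1 (X * t.2.2)).prod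

end Statements

end ClassicalRel

/-! All seven statements are proved outright, so their equivalence is immediate. The engine is
Quillen's and Suslin's patching, run in three rounds.

The combinatorial input is the Chevalley commutator formula in the weak form `commutator_root_mem`:
the commutator of two root elements with parameters `r`, `c` lies in E(n, K) as soon as `r * c ∈ K`,
unless the roots are opposite. Opposite roots are handled by writing one root element as a
commutator of others (`root_eq_commutator`); this uses the bounds on `n` and, for the long
symplectic roots, the invertibility of 2. The outcome is `exists_conj_mem`: conjugation by a fixed
element of E(n, I) carries E(n, y^N I) into E(n, yI) for some exponent N independent of `y`.

Transvections: if `v` is unimodular and congruent to `e₁` modulo `I`, then over a local ring `v = g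
(u e₁)` with `g ∈ E(n, I)`. So 1 + X^d Y M(v, w) is a conjugate by `g` of some 1 + X^d Y M(e₁, w'),
which is visibly elementary, and for large `d` the conjugation is absorbed by `exists_conj_mem`.
Clearing denominators (`exists_dilate_mem`) gives such a result over R with a coefficient `s`
outside any given maximal ideal. The admissible coefficients form an ideal, hence 1 is admissible.
This is `exists_transv_mem`; setting X = 1 gives `transv_mem_elemIdeal`. Statements 2, 5, 6 and 7
follow, with E(n, I) in place of the larger E(n, R, I).

Normality: a conjugate of a root element by `g ∈ G(n, R)` is a transvection whose vector `g e_i` is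
unimodular but need not be congruent to `e₁` modulo `I`. The double of R along I, that is, the ring
of pairs congruent modulo I, reduces this to the absolute case: E(n, R, I) is the image under the
second projection of the elementary matrices over the double that the first projection sends to 1
(`map_mul_inv_mem_relE`, `exists_elem_of_mem_relE`).

Dilation is likewise proved first for the absolute group, by the substitution X ↦ Z^N X with Z a new
variable, and then transferred through the double (`exists_dilate_mem_relE`). The local-global
principle applies dilation to α(X + T) α(T)⁻¹ and patches once more. -/

open scoped commutatorElement

namespace ClassicalRel

/-! ### The involution pairing the indices. -/

section Sigma

variable {n : ℕ}

theorem sigma_val (hn : Even n) (i : Fin n) :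
    (sigma i).val = if i.val % 2 = 0 then i.val + 1 else i.val - 1 := by
  obtain ⟨m, rfl⟩ := hn
  have := i.isLt
  unfold sigma
  split_ifs <;> simp_all
  omega

theorem sigma_sigma (hn : Even n) (i : Fin n) : sigma (sigma i) = i := by
  ext
  rw [sigma_val hn, sigma_val hn]
  split_ifs <;> omega

theorem sigma_ne (hn : Even n) (i : Fin n) : sigma i ≠ i := by
  intro h
  have := congrArg Fin.val h
  rw [sigma_val hn] at this
  split_ifs at this <;> omega

theorem sigma_eq_iff (hn : Even n) (i j : Fin n) : sigma i = j ↔ i = sigma j := by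
  constructor
  · rintro rfl; exact (sigma_sigma hn i).symm
  · rintro rfl; exact sigma_sigma hn j

theorem sigma_inj (hn : Even n) (i j : Fin n) : sigma i = sigma j ↔ i = j := by
  rw [sigma_eq_iff hn, sigma_sigma hn]

theorem sigma_lt_sigma (hn : Even n) {i j : Fin n} (h : i ≠ sigma j) (hij : i < j) :
    sigma i < sigma j := by
  have h' : i.val ≠ (sigma j).val := fun e => h (Fin.ext e)
  rw [sigma_val hn] at h'
  rw [Fin.lt_def] at hij ⊢
  rw [sigma_val hn, sigma_val hn]
  split_ifs at * <;> omega

end Sigma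

theorem GroupType.Admissible.even {k : GroupType} {n : ℕ} (h : k.Admissible n)
    (hk : k ≠ .linear) : Even n := by
  cases k with
  | linear => exact absurd rfl hk
  | symplectic => obtain ⟨m, _, rfl⟩ := h; exact even_two_mul m
  | orthogonal => obtain ⟨m, _, rfl⟩ := h; exact even_two_mul m

/-! ### Root elements and the elementary groups, uniformly in the three types. -/

section Roots

variable {R : Type*} [CommRing R] {S : Type*} [CommRing S] {n : ℕ}

/-- The sign `κ` with `⟨v, w⟩ = κ ⟨w, v⟩`. -/
def kappa (k : GroupType) (R : Type*) [CommRing R] : R :=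
  match k with
  | .symplectic => -1
  | _ => 1

/-- The signs attached to the indices. -/
def sgn (k : GroupType) (R : Type*) [CommRing R] (i : Fin n) : R :=
  match k with
  | .symplectic => (-1) ^ i.val
  | _ => 1

theorem sgn_cases (k : GroupType) (i : Fin n) : sgn k R i = 1 ∨ sgn k R i = -1 := by
  cases k <;> simp [sgn, neg_one_pow_eq_or]

theorem sgn_mul_self (k : GroupType) (i : Fin n) : sgn k R i * sgn k R i = 1 := by
  rcases sgn_cases (R := R) k i with h | h <;> simp [h]

theorem kappa_mul_self (k : GroupType) : kappa k R * kappa k R = 1 := by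
  cases k <;> simp [kappa]

theorem sgn_sigma (hn : Even n) (k : GroupType) (i : Fin n) :
    sgn k R (sigma i) = kappa k R * sgn k R i := by
  cases k with
  | linear => simp [sgn, kappa]
  | orthogonal => simp [sgn, kappa]
  | symplectic =>
    simp only [sgn, kappa]
    rw [sigma_val hn]
    split_ifs with h
    · ring
    · obtain ⟨m, hm⟩ := Nat.exists_eq_succ_of_ne_zero (n := i.val) (by omega)
      rw [hm]; simp [pow_succ]

/-- All ordered pairs of indices which have a root element. -/
def IsRoot (k : GroupType) (i j : Fin n) : Prop :=
  match k with
  | .orthogonal => i ≠ j ∧ i ≠ sigma j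
  | _ => i ≠ j

theorem IsRoot.ne {k : GroupType} {i j : Fin n} (h : IsRoot k i j) : i ≠ j := by
  cases k
  · exact h
  · exact h
  · exact h.1

theorem isRoot_of {k : GroupType} {i j : Fin n} (h : i ≠ j) (h' : i ≠ sigma j) :
    IsRoot k i j := by
  cases k
  · exact h
  · exact h
  · exact ⟨h, h'⟩

theorem IsGenIndex.isRoot {k : GroupType} {i j : Fin n} (h : IsGenIndex k i j) :
    IsRoot k i j := by
  cases k
  · exact h
  · exact h.1
  · exact ⟨h.2.ne, h.1⟩

/-- The matrix unit. -/
abbrev eu (i j : Fin n) : Matrix (Fin n) (Fin n) R := Matrix.single i j 1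

theorem eu_mul_eu (i j a b : Fin n) :
    (eu i j * eu a b : Matrix (Fin n) (Fin n) R) = if j = a then eu i b else 0 := by
  split_ifs with h
  · subst h; simp [eu]
  · exact Matrix.single_mul_single_of_ne _ _ _ _ h _

theorem single_eq_smul_eu (i j : Fin n) (z : R) : Matrix.single i j z = z • eu i j := by
  simp [eu]

theorem ge_linear (i j : Fin n) (z : R) : ge .linear i j z = 1 + z • eu i j := by
  rw [← single_eq_smul_eu]; rfl

theorem ge_long (hn : Even n) (i : Fin n) (z : R) :
    ge .symplectic i (sigma i) z = 1 + z • eu i (sigma i) := by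
  rw [← single_eq_smul_eu]; simp [ge, sigma_sigma hn]

theorem ge_short {k : GroupType} (hk : k ≠ .linear) {i j : Fin n} (h : i ≠ sigma j) (z : R) :
    ge k i j z = 1 + z • eu i j - (sgn k R i * sgn k R j * z) • eu (sigma j) (sigma i) := by
  rw [← single_eq_smul_eu, ← single_eq_smul_eu]
  cases k with
  | linear => exact absurd rfl hk
  | symplectic => simp [ge, sgn, h, pow_add]
  | orthogonal => simp [ge, sgn]

/-- The case split used throughout: linear roots, short roots (two different pairs of indices are
involved), and long roots, which occur only in the symplectic group. -/
theorem IsRoot.cases {k : GroupType} {n : ℕ} (hk : k.Admissible n) {i j : Fin n}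
    (h : IsRoot k i j) :
    k = .linear ∨ (k ≠ .linear ∧ i ≠ sigma j) ∨ (k = .symplectic ∧ j = sigma i) := by
  cases k with
  | linear => exact Or.inl rfl
  | symplectic =>
    by_cases hij : i = sigma j
    · refine Or.inr (Or.inr ⟨rfl, ?_⟩)
      rw [hij, sigma_sigma (hk.even (by simp))]
    · exact Or.inr (Or.inl ⟨by simp, hij⟩)
  | orthogonal => exact Or.inr (Or.inl ⟨by simp, h.2⟩)

theorem ge_zero (k : GroupType) (i j : Fin n) : ge k i j (0 : R) = 1 := by
  cases k <;> simp [ge]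

theorem ge_mul_ge {k : GroupType} (hk : k.Admissible n) {i j : Fin n} (h : IsRoot k i j)
    (a b : R) : ge k i j a * ge k i j b = ge k i j (a + b) := by
  have hij := h.ne
  rcases h.cases hk with rfl | ⟨hl, hs⟩ | ⟨rfl, rfl⟩
  · simp only [ge_linear, mul_add, add_mul, one_mul, mul_one, smul_mul_smul_comm, eu_mul_eu,
      if_neg hij.symm]
    module
  · have hn := hk.even hl
    have h1 : sigma i ≠ i := sigma_ne hn i
    have h2 : j ≠ sigma j := (sigma_ne hn j).symm
    have h3 : sigma i ≠ sigma j := by rwa [Ne, sigma_inj hn]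
    simp only [ge_short hl hs, mul_add, add_mul, mul_sub, sub_mul, one_mul, mul_one,
      smul_mul_smul_comm, eu_mul_eu, if_neg hij.symm, if_neg h1, if_neg h2, if_neg h3]
    module
  · have hn := hk.even (by simp)
    simp only [ge_long hn, mul_add, add_mul, one_mul, mul_one, smul_mul_smul_comm, eu_mul_eu,
      if_neg hij.symm]
    module

/-- The elementary root elements, as invertible matrices. -/
noncomputable def root (k : GroupType) (i j : Fin n) (z : R) : GL (Fin n) R :=
  open Classical in
  -- For a root the test succeeds by additivity (see `coe_root`); the value 1 is only a default that
  -- makes the function total.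
  if h : ge k i j z * ge k i j (-z) = 1 then ⟨ge k i j z, ge k i j (-z), h, mul_eq_one_comm.mp h⟩
  else 1

theorem coe_root {k : GroupType} (hk : k.Admissible n) {i j : Fin n} (h : IsRoot k i j) (z : R) :
    (root k i j z : Matrix (Fin n) (Fin n) R) = ge k i j z := by
  have : ge k i j z * ge k i j (-z) = 1 := by rw [ge_mul_ge hk h, add_neg_cancel, ge_zero]
  simp [root, this]

theorem root_mul_root {k : GroupType} (hk : k.Admissible n) {i j : Fin n} (h : IsRoot k i j)
    (a b : R) : root k i j a * root k i j b = root k i j (a + b) := by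
  apply Units.ext
  rw [Units.val_mul, coe_root hk h, coe_root hk h, coe_root hk h, ge_mul_ge hk h]

theorem root_zero (k : GroupType) (i j : Fin n) : root k i j (0 : R) = 1 := by
  apply Units.ext
  simp [root, ge_zero]

theorem root_inv {k : GroupType} (hk : k.Admissible n) {i j : Fin n} (h : IsRoot k i j)
    (a : R) : (root k i j a)⁻¹ = root k i j (-a) := by
  rw [inv_eq_iff_mul_eq_one, root_mul_root hk h, add_neg_cancel, root_zero]

/-- A short root matrix has two off-diagonal entries, interchanged by the form, and either one may
be used to name it. This removes the restriction `i < j` on the generators. -/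
theorem root_swap {k : GroupType} (hk : k.Admissible n) (hl : k ≠ .linear) {i j : Fin n}
    (hij : i ≠ j) (h : i ≠ sigma j) (z : R) :
    root k i j z = root k (sigma j) (sigma i) (-(sgn k R i * sgn k R j * z)) := by
  have hn := hk.even hl
  have h1 : sigma j ≠ sigma i := by rw [Ne, sigma_inj hn]; exact hij.symm
  have h2 : sigma j ≠ sigma (sigma i) := by rw [sigma_sigma hn]; exact h.symm
  apply Units.ext
  rw [coe_root hk (isRoot_of hij h), coe_root hk (isRoot_of h1 h2), ge_short hl h, ge_short hl h2,
    sgn_sigma hn, sgn_sigma hn, sigma_sigma hn, sigma_sigma hn]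
  have e : kappa k R * sgn k R j * (kappa k R * sgn k R i) * -(sgn k R i * sgn k R j * z) = -z := by
    linear_combination (-z * (sgn k R j * sgn k R j) * (sgn k R i * sgn k R i)) *
      kappa_mul_self (R := R) k - z * (sgn k R i * sgn k R i) * sgn_mul_self (R := R) k j
      - z * sgn_mul_self (R := R) k i
  rw [e]
  module

theorem map_ge (f : R →+* S) (k : GroupType) (i j : Fin n) (z : R) :
    (ge k i j z).map f = ge k i j (f z) := by
  have h (a b : Fin n) (x : R) : (Matrix.single a b x).map f = Matrix.single a b (f x) :=
    Matrix.map_single _ _ _ f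
  cases k with
  | linear => simp [ge, Matrix.map_add f (map_add f), h]
  | symplectic =>
    simp only [ge]
    split_ifs <;>
    simp [Matrix.map_add f (map_add f), Matrix.map_sub f (map_sub f), h]
  | orthogonal => simp [ge, Matrix.map_add f (map_add f), Matrix.map_sub f (map_sub f), h]

theorem coe_map (f : R →+* S) (g : GL (Fin n) R) :
    (Matrix.GeneralLinearGroup.map f g : Matrix (Fin n) (Fin n) S) =
      (g : Matrix (Fin n) (Fin n) R).map f := rfl

theorem map_root {k : GroupType} (hk : k.Admissible n) {i j : Fin n} (h : IsRoot k i j)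
    (f : R →+* S) (z : R) :
    Matrix.GeneralLinearGroup.map f (root k i j z) = root k i j (f z) := by
  apply Units.ext
  rw [coe_map, coe_root hk h, coe_root hk h, map_ge]

theorem root_mem {k : GroupType} (hk : k.Admissible n) {i j : Fin n} (h : IsRoot k i j)
    {K : Ideal R} {z : R} (hz : z ∈ K) : root k i j z ∈ elemIdeal k n K := by
  have key {a b : Fin n} {x : R} (ha : IsGenIndex k a b) (hx : x ∈ K) :
      root k a b x ∈ elemIdeal k n K :=
    Subgroup.subset_closure ⟨a, b, ha, x, hx, coe_root hk ha.isRoot x⟩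
  have hij := h.ne
  rcases h.cases hk with rfl | ⟨hl, hs⟩ | ⟨rfl, rfl⟩
  · exact key hij hz
  · have hn := hk.even hl
    rcases lt_or_gt_of_ne hij with hlt | hlt
    · refine key ?_ hz
      cases k with
      | linear => exact hij
      | symplectic => exact ⟨hij, Or.inr hlt⟩
      | orthogonal => exact ⟨hs, hlt⟩
    · rw [root_swap hk hl hij hs]
      have hs' : j ≠ sigma i := fun e => hs ((sigma_eq_iff hn i j).mp e.symm)
      have hlt' := sigma_lt_sigma hn hs' hlt
      refine key ?_ (K.neg_mem (K.mul_mem_left _ hz))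
      cases k with
      | linear => exact absurd rfl hl
      | symplectic => exact ⟨hlt'.ne, Or.inr hlt'⟩
      | orthogonal => exact ⟨by rw [sigma_sigma hn]; exact hs.symm, hlt'⟩
  · exact key ⟨hij, Or.inl (sigma_sigma (hk.even (by simp)) i).symm⟩ hz

theorem elemIdeal_le_of_root {k : GroupType} (hk : k.Admissible n) {K : Ideal R}
    {H : Subgroup (GL (Fin n) R)}
    (h : ∀ i j : Fin n, IsRoot k i j → ∀ z ∈ K, root k i j z ∈ H) : elemIdeal k n K ≤ H := by
  refine (Subgroup.closure_le _).mpr ?_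
  rintro g ⟨i, j, hij, x, hx, hg⟩
  have : g = root k i j x := Units.ext (hg.trans (coe_root hk hij.isRoot x).symm)
  rw [this]
  exact h i j hij.isRoot x hx

/-- No hypothesis on inverses is needed because the inverse of a generator is a generator. The
version with `IsGenIndex` is what the explicit factorization in `exists_list_of_mem` requires. -/
theorem elemIdeal_induction_gen {k : GroupType} (hk : k.Admissible n) {K : Ideal R}
    {P : GL (Fin n) R → Prop} (one : P 1) (mul : ∀ a b, P a → P b → P (a * b))
    (root_mem : ∀ i j : Fin n, IsGenIndex k i j → ∀ z ∈ K, P (root k i j z)) {g : GL (Fin n) R}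
    (hg : g ∈ elemIdeal k n K) : P g := by
  have hle : elemIdeal k n K ≤ Subgroup.closure {g | P g ∧ P g⁻¹} := by
    refine Subgroup.closure_mono ?_
    rintro g ⟨i, j, hij, x, hx, hg⟩
    obtain rfl : g = root k i j x := Units.ext (hg.trans (coe_root hk hij.isRoot x).symm)
    refine ⟨root_mem i j hij x hx, ?_⟩
    rw [root_inv hk hij.isRoot]
    exact root_mem i j hij _ (K.neg_mem hx)
  replace hg := hle hg
  suffices P g ∧ P g⁻¹ from this.1
  clear hle
  induction hg using Subgroup.closure_induction with
  | mem x hx => exact hx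
  | one => rw [inv_one]; exact ⟨one, one⟩
  | mul x y _ _ hx hy =>
    rw [_root_.mul_inv_rev]
    exact ⟨mul _ _ hx.1 hy.1, mul _ _ hy.2 hx.2⟩
  | inv x _ hx =>
    rw [inv_inv]
    exact hx.symm

theorem elemIdeal_induction {k : GroupType} (hk : k.Admissible n) {K : Ideal R}
    {P : GL (Fin n) R → Prop} (one : P 1) (mul : ∀ a b, P a → P b → P (a * b))
    (root_mem : ∀ i j : Fin n, IsRoot k i j → ∀ z ∈ K, P (root k i j z)) {g : GL (Fin n) R}
    (hg : g ∈ elemIdeal k n K) : P g :=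
  elemIdeal_induction_gen hk one mul (fun i j h => root_mem i j h.isRoot) hg

theorem eq_one_of_mem_elemIdeal_bot {k : GroupType} (hk : k.Admissible n) {g : GL (Fin n) R}
    (hg : g ∈ elemIdeal k n (⊥ : Ideal R)) : g = 1 := by
  refine elemIdeal_induction hk (P := fun g => g = 1) rfl ?_ ?_ hg
  · rintro a b rfl rfl
    exact mul_one 1
  · intro i j _ z hz
    rw [(Submodule.mem_bot R).mp hz, root_zero]

theorem elemIdeal_mono (k : GroupType) {K K' : Ideal R} (h : K ≤ K') :
    elemIdeal k n K ≤ elemIdeal k n K' :=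
  Subgroup.closure_mono fun _ ⟨i, j, hij, x, hx, hg⟩ => ⟨i, j, hij, x, h hx, hg⟩

theorem map_mem_elemIdeal {k : GroupType} (f : R →+* S) {K : Ideal R}
    {K' : Ideal S} (h : ∀ x ∈ K, f x ∈ K') {g : GL (Fin n) R} (hg : g ∈ elemIdeal k n K) :
    Matrix.GeneralLinearGroup.map f g ∈ elemIdeal k n K' := by
  have : elemIdeal k n K ≤ (elemIdeal k n K').comap (Matrix.GeneralLinearGroup.map f) := by
    refine (Subgroup.closure_le _).mpr ?_
    rintro g ⟨i, j, hij, x, hx, hg⟩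
    refine Subgroup.subset_closure ⟨i, j, hij, f x, h x hx, ?_⟩
    rw [coe_map, hg, map_ge]
  exact this hg

theorem map_mem_elem {k : GroupType} (f : R →+* S) {g : GL (Fin n) R} (hg : g ∈ elem k n R) :
    Matrix.GeneralLinearGroup.map f g ∈ elem k n S :=
  map_mem_elemIdeal f (fun _ _ => Submodule.mem_top) hg

theorem elemIdeal_le_elem (k : GroupType) (K : Ideal R) : elemIdeal k n K ≤ elem k n R :=
  elemIdeal_mono k le_top

theorem elemIdeal_le_relE (k : GroupType) (K : Ideal R) : elemIdeal k n K ≤ relE k n K := by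
  intro g hg
  exact ⟨⟨g, elemIdeal_le_elem k K hg⟩, Subgroup.subset_normalClosure hg, rfl⟩

theorem conj_mem_relE {k : GroupType} {K : Ideal R} {g h : GL (Fin n) R} (hg : g ∈ elem k n R)
    (hh : h ∈ relE k n K) : g * h * g⁻¹ ∈ relE k n K := by
  obtain ⟨x, hx, rfl⟩ := hh
  have := Subgroup.mem_map_of_mem (elem k n R).subtype
    (Subgroup.normalClosure_normal.conj_mem _ hx ⟨g, hg⟩)
  unfold relE
  simpa only [map_mul, map_inv, Subgroup.subtype_apply] using this

/-- The normal closure is generated by conjugates, so `H` itself need not be normalized by anything.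
-/
theorem relE_le {k : GroupType} {K : Ideal R} {H : Subgroup (GL (Fin n) R)}
    (h : ∀ g ∈ elem k n R, ∀ x ∈ elemIdeal k n K, g * x * g⁻¹ ∈ H) : relE k n K ≤ H := by
  refine Subgroup.map_le_iff_le_comap.mpr ?_
  rw [Subgroup.normalClosure, Subgroup.closure_le]
  intro y hy
  obtain ⟨x, hx, hxy⟩ := Group.mem_conjugatesOfSet_iff.mp hy
  obtain ⟨c, rfl⟩ := isConj_iff.mp hxy
  exact h c c.2 x hx

theorem map_mem_relE {k : GroupType} (f : R →+* S) {K : Ideal R}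
    {K' : Ideal S} (h : ∀ x ∈ K, f x ∈ K') {g : GL (Fin n) R} (hg : g ∈ relE k n K) :
    Matrix.GeneralLinearGroup.map f g ∈ relE k n K' := by
  have : relE k n K ≤ (relE k n K').comap (Matrix.GeneralLinearGroup.map f) := by
    refine relE_le fun c hc x hx => ?_
    simp only [Subgroup.mem_comap, map_mul, map_inv]
    exact conj_mem_relE (map_mem_elem f hc) (elemIdeal_le_relE k K' (map_mem_elemIdeal f h hx))
  exact this hg

end Roots

/-! ### Commutator relations and conjugation of congruence levels. -/

section Relations

variable {R : Type*} [CommRing R] {n : ℕ}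

theorem commutator_eq_of_coe {a b z : GL (Fin n) R}
    (h : (a : Matrix (Fin n) (Fin n) R) * b = z * (b * a)) : ⁅a, b⁆ = z := by
  have : a * b = z * (b * a) := Units.ext h
  rw [commutatorElement_def, this]
  group

theorem commutator_root_linear (hk : GroupType.linear.Admissible n) {p i j : Fin n} (hpi : p ≠ i)
    (hij : i ≠ j) (hpj : p ≠ j) (r c : R) :
    ⁅root .linear p i r, root .linear i j c⁆ = root .linear p j (r * c) := by
  apply commutator_eq_of_coe
  rw [coe_root hk hpi, coe_root hk hij, coe_root hk hpj]
  simp only [ge_linear, mul_add, add_mul, one_mul, mul_one, smul_mul_smul_comm, eu_mul_eu,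
    if_neg hij.symm, if_neg hpj.symm, if_true, smul_zero, mul_zero]
  module

/-- The indices `i` and `j` lie in different pairs. -/
def Apart (i j : Fin n) : Prop := i ≠ j ∧ i ≠ sigma j

theorem Apart.isRoot {k : GroupType} {i j : Fin n} (h : Apart i j) : IsRoot k i j :=
  isRoot_of h.1 h.2

theorem Apart.symm (hn : Even n) {i j : Fin n} (h : Apart i j) : Apart j i :=
  ⟨h.1.symm, fun e => h.2 ((sigma_eq_iff hn i j).mp e.symm)⟩

theorem Apart.sigma_right (hn : Even n) {i j : Fin n} (h : Apart i j) : Apart i (sigma j) :=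
  ⟨h.2, by rw [sigma_sigma hn]; exact h.1⟩

theorem Apart.sigma_left (hn : Even n) {i j : Fin n} (h : Apart i j) : Apart (sigma i) j :=
  ((h.symm hn).sigma_right hn).symm hn

theorem Apart.sigma_sigma (hn : Even n) {i j : Fin n} (h : Apart i j) :
    Apart (sigma i) (sigma j) :=
  (h.sigma_left hn).sigma_right hn

theorem commutator_root_short {k : GroupType} (hk : k.Admissible n) (hl : k ≠ .linear)
    {p i j : Fin n} (hpi : Apart p i) (hij : Apart i j) (hpj : Apart p j) (r c : R) :
    ⁅root k p i r, root k i j c⁆ = root k p j (r * c) := by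
  have hn := hk.even hl
  have hpi' := hpi.symm hn
  have hij' := hij.symm hn
  have hpj' := hpj.symm hn
  have e1 := (hpi.sigma_sigma hn).1
  have e2 := (hij.sigma_sigma hn).1
  have e3 := (hpj.sigma_sigma hn).1
  have e1' := (hpi'.sigma_sigma hn).1
  have e2' := (hij'.sigma_sigma hn).1
  have e3' := (hpj'.sigma_sigma hn).1
  have d1 := (hpi.sigma_left hn).1
  have d2 := (hij.sigma_left hn).1
  have d3 := (hpj.sigma_left hn).1
  have d1' := (hpi'.sigma_left hn).1
  have d2' := (hij'.sigma_left hn).1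
  have d3' := (hpj'.sigma_left hn).1
  have c1 := sigma_ne hn p
  have c2 := sigma_ne hn i
  have c3 := sigma_ne hn j
  apply commutator_eq_of_coe
  rw [coe_root hk hpi.isRoot, coe_root hk hij.isRoot, coe_root hk hpj.isRoot]
  simp only [ge_short hl hpi.2, ge_short hl hij.2, ge_short hl hpj.2, mul_add, add_mul, mul_sub,
    sub_mul, one_mul, mul_one, smul_mul_smul_comm, eu_mul_eu, hij.2,
    hij'.1, hij'.2, hpj'.1, e1, e3, d1,
    d1', c1, c3.symm, if_true, if_false, smul_zero,
    mul_zero]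
  linear_combination (norm := module) (-(sgn k R p * sgn k R j * r * c) *
    sgn_mul_self (R := R) k i) • (eu (sigma j) (sigma p) : Matrix (Fin n) (Fin n) R)

/-- Two short roots whose sum points to the place `(p, σ p)`. The two contributions to that place
combine with coefficient `1 - κ`: they add up to a long root element with factor 2 in the symplectic
group and cancel in the orthogonal group. -/
theorem commutator_root_short_coe {k : GroupType} (hk : k.Admissible n) (hl : k ≠ .linear)
    {p i : Fin n} (hpi : Apart p i) (r c : R) :
    (root k p i r : Matrix (Fin n) (Fin n) R) *
      (root k i (sigma p) c : Matrix (Fin n) (Fin n) R) =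
      (1 + ((1 - kappa k R) * r * c) • (eu p (sigma p) : Matrix (Fin n) (Fin n) R)) *
        ((root k i (sigma p) c : Matrix (Fin n) (Fin n) R) * root k p i r) := by
  have hn := hk.even hl
  have hpi' := hpi.symm hn
  have hip := hpi'.sigma_right hn
  have e1 := (hpi.sigma_sigma hn).1
  have e1' := (hpi'.sigma_sigma hn).1
  have d1 := (hpi.sigma_left hn).1
  have d1' := (hpi'.sigma_left hn).1
  have c1 := sigma_ne hn p
  have c2 := sigma_ne hn i
  rw [coe_root hk hpi.isRoot, coe_root hk hip.isRoot]
  simp only [ge_short hl hpi.2, ge_short hl hip.2, mul_add, add_mul, mul_sub,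
    sub_mul, one_mul, mul_one, smul_mul_smul_comm, eu_mul_eu,
    hpi'.1, e1, d1, sigma_sigma hn,
    d1', c1, if_true, if_false, smul_zero,
    mul_zero, sgn_sigma hn]
  linear_combination (norm := module) ((-kappa k R * r * c * sgn k R p * sgn k R p) *
    sgn_mul_self (R := R) k i - (kappa k R * r * c) * sgn_mul_self (R := R) k p) •
      (eu p (sigma p) : Matrix (Fin n) (Fin n) R)

theorem commutator_root_short_symplectic (hk : GroupType.symplectic.Admissible n)
    {p i : Fin n} (hpi : Apart p i) (r c : R) :
    ⁅root .symplectic p i r, root .symplectic i (sigma p) c⁆ =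
      root .symplectic p (sigma p) (2 * (r * c)) := by
  have hn := hk.even (by simp)
  apply commutator_eq_of_coe
  rw [commutator_root_short_coe hk (by simp) hpi, coe_root hk (sigma_ne hn p).symm, ge_long hn]
  congr 3
  simp only [kappa]
  ring

theorem commutator_root_short_orthogonal (hk : GroupType.orthogonal.Admissible n)
    {p i : Fin n} (hpi : Apart p i) (r c : R) :
    ⁅root .orthogonal p i r, root .orthogonal i (sigma p) c⁆ = 1 := by
  apply commutator_eq_of_coe
  rw [commutator_root_short_coe hk (by simp) hpi]
  simp [kappa]

theorem commutator_root_short_long (hk : GroupType.symplectic.Admissible n)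
    {p i : Fin n} (hpi : Apart p i) (r c : R) :
    ⁅root .symplectic p i r, root .symplectic i (sigma i) c⁆ =
      root .symplectic p (sigma i) (r * c) *
        root .symplectic p (sigma p) (sgn .symplectic R p * sgn .symplectic R i * (r * r * c)) := by
  have hl : GroupType.symplectic ≠ .linear := by simp
  have hn := hk.even hl
  have hpi' := hpi.symm hn
  have hpi'' := hpi.sigma_right hn
  have e1 := (hpi.sigma_sigma hn).1
  have e1' := (hpi'.sigma_sigma hn).1
  have d1 := (hpi.sigma_left hn).1
  have d1' := (hpi'.sigma_left hn).1
  have c1 := sigma_ne hn p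
  have c2 := sigma_ne hn i
  apply commutator_eq_of_coe
  rw [Units.val_mul, coe_root hk hpi.isRoot, coe_root hk (sigma_ne hn p).symm,
    coe_root hk (sigma_ne hn i).symm, coe_root hk hpi''.isRoot]
  simp only [ge_short hl hpi.2, ge_short hl hpi''.2, ge_long hn, mul_add, add_mul, mul_sub,
    sub_mul, one_mul, mul_one, smul_mul_smul_comm, eu_mul_eu,
    e1, d1, sigma_sigma hn,
    d1', c1, c2, if_true, if_false, smul_zero, zero_mul,
    mul_zero, sgn_sigma hn]
  simp only [kappa]
  module

/-- The root elements of the two pairs of indices are opposite to each other. -/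
def Opposite (k : GroupType) (p q i j : Fin n) : Prop :=
  (p = j ∧ q = i) ∨ (k ≠ .linear ∧ p = sigma i ∧ q = sigma j)

theorem commute_root_linear (hk : GroupType.linear.Admissible n) {p q i j : Fin n} (hpq : p ≠ q)
    (hij : i ≠ j) (hqi : q ≠ i) (hpj : p ≠ j) (r c : R) :
    ⁅root .linear p q r, root .linear i j c⁆ = 1 := by
  apply commutator_eq_of_coe
  rw [coe_root hk hpq, coe_root hk hij, Units.val_one, one_mul]
  simp only [ge_linear, mul_add, add_mul, one_mul, mul_one, smul_mul_smul_comm, eu_mul_eu,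
    if_neg hqi, if_neg hpj.symm, smul_zero]
  module

theorem commute_root_short {k : GroupType} (hk : k.Admissible n) (hl : k ≠ .linear)
    {p q i j : Fin n} (hpq : Apart p q) (hij : Apart i j) (hqi : q ≠ i) (hpj : p ≠ j)
    (hqj : q ≠ sigma j) (hpi : p ≠ sigma i) (r c : R) :
    ⁅root k p q r, root k i j c⁆ = 1 := by
  have hn := hk.even hl
  have h1 : sigma p ≠ i := fun h => hpi ((sigma_eq_iff hn _ _).mp h)
  have h2 : sigma p ≠ sigma j := fun h => hpj ((sigma_inj hn _ _).mp h)
  have h3 : sigma i ≠ sigma q := fun h => hqi ((sigma_inj hn _ _).mp h).symm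
  have h4 : j ≠ sigma q := fun h => hqj ((sigma_eq_iff hn _ _).mp h.symm)
  apply commutator_eq_of_coe
  rw [coe_root hk hpq.isRoot, coe_root hk hij.isRoot, Units.val_one, one_mul]
  simp only [ge_short hl hpq.2, ge_short hl hij.2, mul_add, add_mul, mul_sub, sub_mul, one_mul,
    mul_one, smul_mul_smul_comm, eu_mul_eu, hqi, hpj.symm, hqj, hpi.symm, h1, h2, h3, h4,
    if_false, smul_zero]
  module

theorem commute_root_short_long (hk : GroupType.symplectic.Admissible n)
    {p q i : Fin n} (hpq : Apart p q) (hqi : q ≠ i) (hpi : p ≠ sigma i) (r c : R) :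
    ⁅root .symplectic p q r, root .symplectic i (sigma i) c⁆ = 1 := by
  have hl : GroupType.symplectic ≠ .linear := by simp
  have hn := hk.even hl
  have h1 : sigma p ≠ i := fun h => hpi ((sigma_eq_iff hn _ _).mp h)
  have h3 : sigma i ≠ sigma q := fun h => hqi ((sigma_inj hn _ _).mp h).symm
  apply commutator_eq_of_coe
  rw [coe_root hk hpq.isRoot, coe_root hk (sigma_ne hn i).symm, Units.val_one, one_mul]
  simp only [ge_short hl hpq.2, ge_long hn, mul_add, add_mul, mul_sub, sub_mul, one_mul,
    mul_one, smul_mul_smul_comm, eu_mul_eu, hqi, hpi.symm, h1, h3, if_false, smul_zero]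
  module

theorem commute_root_long (hk : GroupType.symplectic.Admissible n)
    {p i : Fin n} (hpi : p ≠ sigma i) (r c : R) :
    ⁅root .symplectic p (sigma p) r, root .symplectic i (sigma i) c⁆ = 1 := by
  have hl : GroupType.symplectic ≠ .linear := by simp
  have hn := hk.even hl
  have h1 : sigma p ≠ i := fun h => hpi ((sigma_eq_iff hn _ _).mp h)
  apply commutator_eq_of_coe
  rw [coe_root hk (sigma_ne hn p).symm, coe_root hk (sigma_ne hn i).symm, Units.val_one, one_mul]
  simp only [ge_long hn, mul_add, add_mul, one_mul,
    mul_one, smul_mul_smul_comm, eu_mul_eu, hpi.symm, h1, if_false, smul_zero]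
  module

theorem commutator_mem_comm {H : Subgroup (GL (Fin n) R)} {a b : GL (Fin n) R} (h : ⁅a, b⁆ ∈ H) :
    ⁅b, a⁆ ∈ H := by
  rw [← commutatorElement_inv]
  exact H.inv_mem h

theorem commutator_root_short_mem_aux {k : GroupType} (hk : k.Admissible n) (hl : k ≠ .linear)
    {p i j : Fin n} (hpi : Apart p i) (hij : Apart i j) (hpj : p ≠ j) {K : Ideal R} {r c : R}
    (h : r * c ∈ K) : ⁅root k p i r, root k i j c⁆ ∈ elemIdeal k n K := by
  have hn := hk.even hl
  by_cases hs : p = sigma j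
  · obtain rfl : j = sigma p := by rw [hs, sigma_sigma hn]
    cases k with
    | linear => exact absurd rfl hl
    | symplectic =>
      rw [commutator_root_short_symplectic hk hpi]
      exact root_mem hk (sigma_ne hn p).symm (K.mul_mem_left _ h)
    | orthogonal =>
      rw [commutator_root_short_orthogonal hk hpi]
      exact one_mem _
  · rw [commutator_root_short hk hl hpi hij ⟨hpj, hs⟩]
    exact root_mem hk (isRoot_of hpj hs) h

theorem commutator_root_short_mem {k : GroupType} (hk : k.Admissible n) (hl : k ≠ .linear)
    {p q i j : Fin n} (hpq : Apart p q) (hij : Apart i j) (ho : ¬ Opposite k p q i j)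
    {K : Ideal R} {r c : R} (h : r * c ∈ K) :
    ⁅root k p q r, root k i j c⁆ ∈ elemIdeal k n K := by
  have hn := hk.even hl
  have h' : c * r ∈ K := by rwa [mul_comm]
  by_cases hqi : q = i
  · subst hqi
    exact commutator_root_short_mem_aux hk hl hpq hij (fun e => ho (Or.inl ⟨e, rfl⟩)) h
  by_cases hpj : p = j
  · subst hpj
    exact commutator_mem_comm (commutator_root_short_mem_aux hk hl hij hpq (Ne.symm hqi) h')
  by_cases hqj : q = sigma j
  · subst hqj
    rw [root_swap hk hl hij.1 hij.2]
    refine commutator_root_short_mem_aux hk hl hpq ((hij.symm hn).sigma_sigma hn)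
      (fun e => ho (Or.inr ⟨hl, e, rfl⟩)) ?_
    rw [show r * -(sgn k R i * sgn k R j * c) = -(sgn k R i * sgn k R j) * (r * c) by ring]
    exact K.mul_mem_left _ h
  by_cases hpi : p = sigma i
  · subst hpi
    rw [root_swap hk hl hij.1 hij.2]
    refine commutator_mem_comm (commutator_root_short_mem_aux hk hl
      ((hij.symm hn).sigma_sigma hn) hpq (Ne.symm hqj) ?_)
    rw [show -(sgn k R i * sgn k R j * c) * r = -(sgn k R i * sgn k R j) * (r * c) by ring]
    exact K.mul_mem_left _ h
  rw [commute_root_short hk hl hpq hij hqi hpj hqj hpi]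
  exact one_mem _

theorem commutator_root_short_long_mem (hk : GroupType.symplectic.Admissible n)
    {p q i : Fin n} (hpq : Apart p q) {K : Ideal R} {r c : R} (h : r * c ∈ K) :
    ⁅root .symplectic p q r, root .symplectic i (sigma i) c⁆ ∈ elemIdeal .symplectic n K := by
  have hl : GroupType.symplectic ≠ .linear := by simp
  have hn := hk.even hl
  have key {p q : Fin n} (hpq : Apart p q) {r : R} (h : r * c ∈ K) :
      ⁅root .symplectic p q r, root .symplectic q (sigma q) c⁆ ∈ elemIdeal .symplectic n K := by
    rw [commutator_root_short_long hk hpq]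
    refine mul_mem (root_mem hk (hpq.sigma_right hn).1 h) (root_mem hk (sigma_ne hn p).symm ?_)
    rw [show r * r * c = r * (r * c) by ring]
    exact K.mul_mem_left _ (K.mul_mem_left _ h)
  by_cases hqi : q = i
  · subst hqi
    exact key hpq h
  by_cases hpi : p = sigma i
  · subst hpi
    rw [root_swap hk hl hpq.1 hpq.2]
    have := hpq.symm hn |>.sigma_sigma hn
    rw [sigma_sigma hn] at this ⊢
    refine key this ?_
    rw [neg_mul, mul_assoc]
    exact K.neg_mem (K.mul_mem_left _ h)
  rw [commute_root_short_long hk hpq hqi hpi]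
  exact one_mem _

/-- By the explicit formulas, every parameter occurring in the commutator of two non-opposite root
elements is a multiple of `r * c`. -/
theorem commutator_root_mem {k : GroupType} (hk : k.Admissible n) {p q i j : Fin n}
    (hpq : IsRoot k p q) (hij : IsRoot k i j) (ho : ¬ Opposite k p q i j)
    {K : Ideal R} {r c : R} (h : r * c ∈ K) :
    ⁅root k p q r, root k i j c⁆ ∈ elemIdeal k n K := by
  have h' : c * r ∈ K := by rwa [mul_comm]
  rcases hij.cases hk with rfl | ⟨hl, hs⟩ | ⟨rfl, rfl⟩
  · by_cases hqi : q = i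
    · subst hqi
      have hpj : p ≠ j := fun e => ho (Or.inl ⟨e, rfl⟩)
      rw [commutator_root_linear hk hpq hij hpj]
      exact root_mem hk hpj h
    by_cases hpj : p = j
    · subst hpj
      apply commutator_mem_comm
      rw [commutator_root_linear hk hij hpq (Ne.symm hqi)]
      exact root_mem hk (Ne.symm hqi) h'
    rw [commute_root_linear hk hpq hij hqi hpj]
    exact one_mem _
  · rcases hpq.cases hk with rfl | ⟨_, hs'⟩ | ⟨rfl, rfl⟩
    · exact absurd rfl hl
    · exact commutator_root_short_mem hk hl ⟨hpq.ne, hs'⟩ ⟨hij.ne, hs⟩ ho h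
    · exact commutator_mem_comm (commutator_root_short_long_mem hk ⟨hij.ne, hs⟩ h')
  · rcases hpq.cases hk with e | ⟨_, hs'⟩ | ⟨_, rfl⟩
    · cases e
    · exact commutator_root_short_long_mem hk ⟨hpq.ne, hs'⟩ h
    · have hn := hk.even (by simp)
      have hpi : p ≠ sigma i := by
        rintro rfl
        exact ho (Or.inl ⟨rfl, sigma_sigma hn i⟩)
      rw [commute_root_long hk hpi]
      exact one_mem _

theorem exists_notMem {s : Finset (Fin n)} (h : s.card < n) : ∃ i, i ∉ s := by
  by_contra! hc
  have : s = Finset.univ := Finset.eq_univ_of_forall hc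
  simp [this] at h

/-- Every root element is, up to a factor, a commutator of root elements none of which is
proportional to it. -/
theorem root_eq_commutator (h2 : IsUnit (2 : R)) {k : GroupType} (hk : k.Admissible n)
    {i j : Fin n} (hij : IsRoot k i j) (u v : R) :
    ∃ a b c d e f : Fin n, IsRoot k a b ∧ IsRoot k c d ∧ IsRoot k e f ∧
      ¬ Opposite k j i a b ∧ ¬ Opposite k j i c d ∧ ¬ Opposite k j i e f ∧ ¬ Opposite k a b c d ∧
      ∃ v' ∈ Ideal.span {v}, ∃ w ∈ Ideal.span {u * v},
        root k i j (u * v) = ⁅root k a b u, root k c d v'⁆ * root k e f w := by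
  rcases hij.cases hk with rfl | ⟨hl, hs⟩ | ⟨rfl, rfl⟩
  -- The intermediate index `m` exists because `n ≥ 3`; the correcting third factor is trivial.
  · obtain ⟨m, hm⟩ := exists_notMem (s := {i, j}) (n := n)
      (Finset.card_le_two.trans_lt hk)
    simp only [Finset.mem_insert, Finset.mem_singleton, not_or] at hm
    have him : i ≠ m := Ne.symm hm.1
    refine ⟨i, m, m, j, i, m, him, hm.2, him, ?_, ?_, ?_, ?_, v, Ideal.mem_span_singleton_self v,
      0, zero_mem _, ?_⟩
    iterate 4
      simp only [Opposite, ne_eq, not_true_eq_false, false_and, or_false]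
      tauto
    rw [commutator_root_linear hk him hm.2 hij, root_zero, mul_one]
  · have hn := hk.even hl
    have hA : Apart i j := ⟨hij.ne, hs⟩
    have c1 := sigma_ne hn i
    have c2 := sigma_ne hn j
    have hA' := hA.symm hn
    have hB := hA.sigma_sigma hn
    have hB' := hA'.sigma_sigma hn
    have d1 := (hA.sigma_left hn).1
    have d2 := (hA'.sigma_left hn).1
    cases k with
    | linear => exact absurd rfl hl
    | symplectic =>
      -- For `n = 4` there is no index outside the pairs of `i` and `j`, so the detour goes through
      -- the long root at `σ j`. The third factor cancels the long root element that this commutator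
      -- produces in addition.
      refine ⟨i, sigma j, sigma j, j, i, sigma i, (hA.sigma_right hn).1, c2, c1.symm, ?_, ?_, ?_,
        ?_, v, Ideal.mem_span_singleton_self v,
        -(sgn .symplectic R i * sgn .symplectic R (sigma j) * (u * u * v)), ?_, ?_⟩
      · rintro (⟨h, _⟩ | ⟨_, h, _⟩)
        · exact c2 h.symm
        · exact d1 h.symm
      · rintro (⟨_, h⟩ | ⟨_, _, h⟩)
        · exact hA.2 h
        · exact hA.2 h
      · rintro (⟨h, _⟩ | ⟨_, h, _⟩) <;> exact d1 h.symm
      · rintro (⟨h, _⟩ | ⟨_, h, _⟩)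
        · exact hA.1 h
        · exact hA.1 (by rw [h, sigma_sigma hn])
      · rw [show -(sgn .symplectic R i * sgn .symplectic R (sigma j) * (u * u * v)) =
          -(sgn .symplectic R i * sgn .symplectic R (sigma j) * u) * (u * v) by ring]
        exact Ideal.mul_mem_left _ _ (Ideal.mem_span_singleton_self _)
      · have := commutator_root_short_long hk (hA.sigma_right hn) u v
        rw [sigma_sigma hn] at this
        rw [this, mul_assoc, root_mul_root hk c1.symm, add_neg_cancel, root_zero, mul_one]
    | orthogonal =>
      -- Here a third pair of indices is needed, which is available since `n ≥ 6`.
      obtain ⟨m, hm⟩ := exists_notMem (s := {i, j, sigma i, sigma j}) (n := n) (by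
        obtain ⟨m, hm, rfl⟩ := hk
        exact Finset.card_le_four.trans_lt (by omega))
      simp only [Finset.mem_insert, Finset.mem_singleton, not_or] at hm
      obtain ⟨m1, m2, m3, m4⟩ := hm
      have him : Apart i m := Apart.symm hn ⟨m1, m3⟩
      have hmj : Apart m j := ⟨m2, m4⟩
      refine ⟨i, m, m, j, i, m, him.isRoot, hmj.isRoot, him.isRoot, ?_, ?_, ?_, ?_, v,
        Ideal.mem_span_singleton_self v, 0, zero_mem _, ?_⟩
      · rintro (⟨h, _⟩ | ⟨_, h, _⟩)
        · exact hmj.1 h.symm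
        · exact d1 h.symm
      · rintro (⟨_, h⟩ | ⟨_, h, _⟩)
        · exact m1 h.symm
        · exact (hmj.sigma_left hn).1 h.symm
      · rintro (⟨h, _⟩ | ⟨_, h, _⟩)
        · exact hmj.1 h.symm
        · exact d1 h.symm
      · rintro (⟨h, _⟩ | ⟨_, h, _⟩)
        · exact hA.1 h
        · exact him.2 h
      · rw [commutator_root_short hk hl him hmj hA, root_zero, mul_one]
  · have hn := hk.even (by simp)
    -- `t` is one half: it compensates for the factor 2 in `commutator_root_short_symplectic`.
    obtain ⟨t, ht⟩ := h2.exists_left_inv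
    obtain ⟨m, hm⟩ := exists_notMem (s := {i, sigma i}) (n := n) (by
        obtain ⟨m, hm, rfl⟩ := hk
        exact Finset.card_le_two.trans_lt (by omega))
    simp only [Finset.mem_insert, Finset.mem_singleton, not_or] at hm
    have hA : Apart i m := Apart.symm hn hm
    have hA' := hA.symm hn
    have hB := hA'.sigma_right hn
    have c1 := sigma_ne hn i
    have d1 := (hA.sigma_left hn).1
    refine ⟨i, m, m, sigma i, i, m, hA.1, hB.1, hA.1, ?_, ?_, ?_, ?_, t * v,
      Ideal.mul_mem_left _ _ (Ideal.mem_span_singleton_self v), 0, zero_mem _, ?_⟩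
    · rintro (⟨h, _⟩ | ⟨_, _, h⟩)
      · exact d1 h
      · exact hA.2 h
    · rintro (⟨_, h⟩ | ⟨_, h, _⟩)
      · exact hA.1 h
      · exact hA.1 ((sigma_inj hn _ _).mp h)
    · rintro (⟨h, _⟩ | ⟨_, _, h⟩)
      · exact d1 h
      · exact hA.2 h
    · rintro (⟨h, _⟩ | ⟨_, h, _⟩)
      · exact c1 h.symm
      · exact hA.2 h
    · rw [commutator_root_short_symplectic hk hA, root_zero, mul_one]
      congr 1
      linear_combination (-(u * v)) * ht

theorem conj_mem_of_commutator_mem {H : Subgroup (GL (Fin n) R)} {g x : GL (Fin n) R}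
    (h : ⁅g, x⁆ ∈ H) (hx : x ∈ H) : g * x * g⁻¹ ∈ H := by
  rw [show g * x * g⁻¹ = ⁅g, x⁆ * x by rw [commutatorElement_def]; group]
  exact mul_mem h hx

theorem elemIdeal_conj_le {k : GroupType} (hk : k.Admissible n) {K : Ideal R}
    {H : Subgroup (GL (Fin n) R)} {g : GL (Fin n) R}
    (h : ∀ i j : Fin n, IsRoot k i j → ∀ z ∈ K, g * root k i j z * g⁻¹ ∈ H)
    {x : GL (Fin n) R} (hx : x ∈ elemIdeal k n K) : g * x * g⁻¹ ∈ H :=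
  elemIdeal_le_of_root (H := H.comap (MulAut.conj g).toMonoidHom) hk h hx

theorem conj_root_mem {k : GroupType} (hk : k.Admissible n) {p q i j : Fin n}
    (hpq : IsRoot k p q) (hij : IsRoot k i j) (ho : ¬ Opposite k p q i j)
    {K : Ideal R} (r : R) {c : R} (h : c ∈ K) :
    root k p q r * root k i j c * (root k p q r)⁻¹ ∈ elemIdeal k n K :=
  conj_mem_of_commutator_mem (commutator_root_mem hk hpq hij ho (K.mul_mem_left _ h))
    (root_mem hk hij h)

/-- Both alternatives of `Opposite` name the same root up to sign of the parameter, so an opposite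
root may be assumed to be `(j, i)`. -/
theorem root_eq_root_of_opposite {k : GroupType} (hk : k.Admissible n) {p q i j : Fin n}
    (hij : IsRoot k i j) (ho : Opposite k p q i j) {K : Ideal R} {x : R} (hx : x ∈ K) :
    ∃ x' ∈ K, root k p q x = root k j i x' := by
  rcases ho with ⟨rfl, rfl⟩ | ⟨hl, rfl, rfl⟩
  · exact ⟨x, hx, rfl⟩
  · have hn := hk.even hl
    by_cases hs : i = sigma j
    · exact ⟨x, hx, by rw [hs, sigma_sigma hn]⟩
    · have := Apart.sigma_sigma hn ⟨hij.ne, hs⟩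
      refine ⟨-(sgn k R (sigma i) * sgn k R (sigma j) * x), K.neg_mem (K.mul_mem_left _ hx), ?_⟩
      rw [root_swap hk hl this.1 this.2, sigma_sigma hn, sigma_sigma hn]

theorem IsRoot.symm {k : GroupType} (hk : k.Admissible n) {i j : Fin n} (h : IsRoot k i j) :
    IsRoot k j i := by
  cases k with
  | linear => exact Ne.symm h
  | symplectic => exact Ne.symm h
  | orthogonal => exact (Apart.symm (hk.even (by simp)) h).isRoot

/-- Conjugation by an elementary generator maps `E(n, K²)` to `E(n, K)`. -/
theorem conj_root_mem_of_mem_mul (h2 : IsUnit (2 : R)) {k : GroupType} (hk : k.Admissible n)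
    {p q : Fin n} (hpq : IsRoot k p q) (r : R) {K : Ideal R} {x : GL (Fin n) R}
    (hx : x ∈ elemIdeal k n (K * K)) :
    root k p q r * x * (root k p q r)⁻¹ ∈ elemIdeal k n K := by
  refine elemIdeal_conj_le hk (fun i j hij z hz => ?_) hx
  by_cases ho : Opposite k p q i j
  -- In the opposite case a product `u * v` of two elements of `K` is split by a commutator formula.
  -- None of the three roots in it is opposite to the conjugating one, so each factor is conjugated
  -- into E(n, K) separately.
  · obtain ⟨r', -, hr'⟩ := root_eq_root_of_opposite hk hij ho (Submodule.mem_top (x := r))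
    rw [hr']
    have hji := hij.symm hk
    induction hz using Submodule.mul_induction_on' with
    | mem_mul_mem u hu v hv =>
      obtain ⟨a, b, c, d, e, f, hab, hcd, hef, o1, o2, o3, -, v', hv', w, hw, heq⟩ :=
        root_eq_commutator h2 hk hij u v
      have hv' : v' ∈ K := (Ideal.span_singleton_le_iff_mem _).mpr hv hv'
      have hw : w ∈ K := (Ideal.span_singleton_le_iff_mem _).mpr (K.mul_mem_left u hv) hw
      have m1 := conj_root_mem hk hji hab o1 r' hu
      have m2 := conj_root_mem hk hji hcd o2 r' hv'
      have m3 := conj_root_mem hk hji hef o3 r' hw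
      rw [heq, commutatorElement_def]
      convert mul_mem (mul_mem (mul_mem (mul_mem m1 m2) (inv_mem m1)) (inv_mem m2)) m3 using 1
      group
    | add u _ v _ hu hv =>
      rw [← root_mul_root hk hij]
      convert mul_mem hu hv using 1
      group
  · exact conj_root_mem hk hpq hij ho r (Ideal.mul_le_right hz)

/-- Conjugation by a generator of `E(n, I)` maps `E(n, y³I)` to `E(n, yI)`. -/
theorem conj_root_mem_of_mem_cube (h2 : IsUnit (2 : R)) {k : GroupType} (hk : k.Admissible n)
    {p q : Fin n} (hpq : IsRoot k p q) {I : Ideal R} {r : R} (hr : r ∈ I) (y : R)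
    {x : GL (Fin n) R} (hx : x ∈ elemIdeal k n (Ideal.span {y ^ 3} * I)) :
    root k p q r * x * (root k p q r)⁻¹ ∈ elemIdeal k n (Ideal.span {y} * I) := by
  have mem {c : R} (hc : c ∈ I) (t : R) : t * (y * c) ∈ Ideal.span {y} * I :=
    Ideal.mul_mem_left _ _ (Ideal.mul_mem_mul (Ideal.mem_span_singleton_self y) hc)
  refine elemIdeal_conj_le hk (fun i j hij z hz => ?_) hx
  obtain ⟨c, hc, rfl⟩ := Ideal.mem_span_singleton_mul.mp hz
  have hz' : y ^ 3 * c ∈ Ideal.span {y} * I := by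
    convert mem hc (y ^ 2) using 1
    ring
  by_cases ho : Opposite k p q i j
  · obtain ⟨r', hr', e'⟩ := root_eq_root_of_opposite hk hij ho hr
    rw [e']
    have hji := hij.symm hk
    -- The splitting `y * (y² c)` leaves one `y` for the first factor, which is not in `I`, and two
    -- for the second.
    obtain ⟨a, b, c', d, e, f, hab, hcd, hef, o1, o2, o3, o4, v, hv, w, hw, heq⟩ :=
      root_eq_commutator h2 hk hij y (y ^ 2 * c)
    rw [show y * (y ^ 2 * c) = y ^ 3 * c by ring] at hw heq
    have hw := (Ideal.span_singleton_le_iff_mem _).mpr hz' hw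
    obtain ⟨t, rfl⟩ := Ideal.mem_span_singleton'.mp hv
    have hv : t * (y ^ 2 * c) ∈ Ideal.span {y} * I := by
      convert mem hc (t * y) using 1
      ring
    set g := root k j i r'
    set A := root k a b y
    set P := root k c' d (t * (y ^ 2 * c))
    have m3 := conj_root_mem hk hji hef o3 r' hw
    have m1 : ⁅g, A⁆ ∈ elemIdeal k n (Ideal.span {y} * I) :=
      commutator_root_mem hk hji hab o1 (by simpa [mul_comm] using mem hr' 1)
    have m2 := conj_root_mem hk hji hcd o2 r' hv
    have m4 : A * P * A⁻¹ ∈ elemIdeal k n (Ideal.span {y} * I) := conj_root_mem hk hab hcd o4 y hv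
    have m5 : ⁅g, P⁆ ∈ elemIdeal k n ((Ideal.span {y} * I) * (Ideal.span {y} * I)) := by
      refine commutator_root_mem hk hji hcd o2 ?_
      convert Ideal.mul_mem_mul (mem hr' 1) (mem hc t) using 1
      ring
    have m6 := conj_root_mem_of_mem_mul h2 hk hab y m5
    rw [heq]
    -- Since `A` need not have level `I`, its conjugate by `g` is replaced by `⁅g, A⁆ * A`, and `⁅g,
    -- A⁆` does have level `yI`. The conjugate of `P` is `⁅g, P⁆ * P`; there `⁅g, P⁆` has level
    -- `(yI)²`, which survives the conjugation by `A`.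
    have : g * (⁅A, P⁆ * root k e f w) * g⁻¹ =
        ⁅g, A⁆ * ((A * ⁅g, P⁆ * A⁻¹) * (A * P * A⁻¹)) * ⁅g, A⁆⁻¹ * (g * P * g⁻¹)⁻¹ *
          (g * root k e f w * g⁻¹) := by
      simp only [commutatorElement_def]
      group
    rw [this]
    exact mul_mem (mul_mem (mul_mem (mul_mem m1 (mul_mem m6 m4)) (inv_mem m1)) (inv_mem m2)) m3
  · exact conj_root_mem hk hpq hij ho r hz'

/-- Conjugation by an element of `E(n, I)` maps `E(n, y ^ N I)` to `E(n, yI)`, for large `N`. -/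
theorem exists_conj_mem (h2 : IsUnit (2 : R)) {k : GroupType} (hk : k.Admissible n)
    {I : Ideal R} {g : GL (Fin n) R} (hg : g ∈ elemIdeal k n I) :
    ∃ N : ℕ, ∀ y : R, ∀ x ∈ elemIdeal k n (Ideal.span {y ^ N} * I),
      g * x * g⁻¹ ∈ elemIdeal k n (Ideal.span {y} * I) := by
  refine elemIdeal_induction hk (P := fun g => ∃ N : ℕ, ∀ y : R,
    ∀ x ∈ elemIdeal k n (Ideal.span {y ^ N} * I),
      g * x * g⁻¹ ∈ elemIdeal k n (Ideal.span {y} * I)) ⟨1, by simp⟩ ?_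
    (fun i j hij z hz => ⟨3, fun y x hx => conj_root_mem_of_mem_cube h2 hk hij hz y hx⟩) hg
  rintro a b ⟨N, hN⟩ ⟨L, hL⟩
  -- The bound for `b` is applied to `y ^ N` and the bound for `a` to `y`, so exponents multiply.
  refine ⟨N * L, fun y x hx => ?_⟩
  rw [pow_mul] at hx
  convert hN y _ (hL _ x hx) using 1
  group

end Relations

/-! ### The forms, the matrices `M(v, w)` and the transvections. -/

section Forms

variable {R : Type*} [CommRing R] {S : Type*} [CommRing S] {n : ℕ}

/-- The matrix of the form. -/
def form (k : GroupType) (n : ℕ) (R : Type*) [CommRing R] : Matrix (Fin n) (Fin n) R :=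
  Matrix.of fun i j => if j = sigma i then sgn k R i else 0

theorem tilde_of_ne {k : GroupType} (hl : k ≠ .linear) (v : Fin n → R) :
    tilde k v = v ᵥ* form k n R := by
  cases k
  · exact absurd rfl hl
  · rfl
  · rfl

theorem pairing_eq (k : GroupType) (v w : Fin n → R) : pairing k v w = tilde k v ⬝ᵥ w := by
  cases k <;> rfl

theorem M_of_ne {k : GroupType} (hl : k ≠ .linear) (v w : Fin n → R) :
    M k v w = vecMulVec v (tilde k w) - kappa k R • vecMulVec w (tilde k v) := by
  cases k
  · exact absurd rfl hl
  · simp [M, kappa]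
  · simp [M, kappa]

theorem M_linear (v w : Fin n → R) : M .linear v w = vecMulVec v w := rfl

theorem form_transpose (hn : Even n) (k : GroupType) :
    (form k n R)ᵀ = kappa k R • form k n R := by
  ext i j
  simp only [form, transpose_apply, of_apply, Matrix.smul_apply, smul_eq_mul]
  by_cases h : j = sigma i
  · subst h
    simp [sigma_sigma hn, sgn_sigma hn]
  · have : i ≠ sigma j := fun e => h ((sigma_eq_iff hn _ _).mp e.symm)
    simp [h, this]

theorem tilde_apply (hn : Even n) {k : GroupType} (hl : k ≠ .linear) (v : Fin n → R)
    (j : Fin n) : tilde k v j = sgn k R (sigma j) * v (sigma j) := by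
  rw [tilde_of_ne hl, vecMul, dotProduct, Finset.sum_eq_single (sigma j)]
  · simp [form, sigma_sigma hn, mul_comm]
  · intro i _ hi
    have : j ≠ sigma i := fun e => hi ((sigma_eq_iff hn _ _).mp e.symm)
    simp [form, this]
  · simp

theorem tilde_add (k : GroupType) (v w : Fin n → R) : tilde k (v + w) = tilde k v + tilde k w := by
  cases k
  · rfl
  · exact add_vecMul _ _ _
  · exact add_vecMul _ _ _

theorem tilde_smul (k : GroupType) (c : R) (v : Fin n → R) : tilde k (c • v) = c • tilde k v := by
  cases k
  · rfl
  · exact smul_vecMul _ _ _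
  · exact smul_vecMul _ _ _

theorem pairing_comm {k : GroupType} (hk : k.Admissible n) (v w : Fin n → R) :
    pairing k w v = kappa k R * pairing k v w := by
  by_cases hl : k = .linear
  · subst hl
    simp [pairing, kappa, dotProduct_comm]
  · rw [pairing_eq, pairing_eq, tilde_of_ne hl, tilde_of_ne hl, ← dotProduct_mulVec,
      ← dotProduct_mulVec, dotProduct_mulVec v, dotProduct_comm, ← vecMul_transpose,
      form_transpose (hk.even hl)]
    rw [vecMul_smul, smul_dotProduct, smul_eq_mul]

theorem pairing_add_right (k : GroupType) (v w w' : Fin n → R) :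
    pairing k v (w + w') = pairing k v w + pairing k v w' := by
  simp only [pairing_eq, dotProduct_add]

theorem pairing_smul_right (k : GroupType) (c : R) (v w : Fin n → R) :
    pairing k v (c • w) = c * pairing k v w := by
  simp only [pairing_eq, dotProduct_smul, smul_eq_mul]

theorem pairing_add_left (k : GroupType) (v v' w : Fin n → R) :
    pairing k (v + v') w = pairing k v w + pairing k v' w := by
  simp only [pairing_eq, tilde_add, add_dotProduct]

theorem pairing_smul_left (k : GroupType) (c : R) (v w : Fin n → R) :
    pairing k (c • v) w = c * pairing k v w := by
  simp only [pairing_eq, tilde_smul, smul_dotProduct, smul_eq_mul]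

theorem M_smul_left (k : GroupType) (c : R) (v w : Fin n → R) :
    M k (c • v) w = c • M k v w := by
  by_cases hl : k = .linear
  · subst hl
    simp [M_linear, smul_vecMulVec]
  · simp only [M_of_ne hl, tilde_smul, smul_vecMulVec, vecMulVec_smul]
    module

theorem M_smul_right (k : GroupType) (c : R) (v w : Fin n → R) :
    M k v (c • w) = c • M k v w := by
  by_cases hl : k = .linear
  · subst hl
    simp [M_linear, vecMulVec_smul]
  · simp only [M_of_ne hl, tilde_smul, smul_vecMulVec, vecMulVec_smul]
    module

theorem M_add_right (k : GroupType) (v w w' : Fin n → R) :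
    M k v (w + w') = M k v w + M k v w' := by
  by_cases hl : k = .linear
  · subst hl
    simp [M_linear, vecMulVec_add]
  · simp only [M_of_ne hl, tilde_add, add_vecMulVec, vecMulVec_add]
    module

theorem M_zero_right (k : GroupType) (v : Fin n → R) : M k v 0 = 0 := by
  have := M_smul_right k 0 v 0
  simpa using this

/-- Antisymmetry gives `2⟨v, v⟩ = 0` in the symplectic case; in the orthogonal case isotropy is the
hypothesis. -/
theorem pairing_self (h2 : IsUnit (2 : R)) {k : GroupType} (hk : k.Admissible n)
    (hl : k ≠ .linear) {v : Fin n → R} (hv : VectorOK k v) : pairing k v v = 0 := by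
  cases k with
  | linear => exact absurd rfl hl
  | symplectic =>
    have := pairing_comm hk v v
    simp only [kappa] at this
    exact h2.mul_right_eq_zero.mp (by linear_combination this)
  | orthogonal => exact hv

theorem VectorOK.smul {k : GroupType} {v : Fin n → R} (hv : VectorOK k v) (c : R) :
    VectorOK k (c • v) := by
  cases k with
  | linear => trivial
  | symplectic => trivial
  | orthogonal =>
    change pairing .orthogonal v v = 0 at hv
    change pairing .orthogonal _ _ = 0
    rw [pairing_smul_left, pairing_smul_right, hv, mul_zero, mul_zero]

/-- The product lies in the centre direction `v ṽ` of a Heisenberg-type group, with coefficient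
given by `⟨w, w'⟩`. For `w' = w` with `⟨w, w⟩ = 0` it shows that `M(v, w)` has square zero. -/
theorem M_mul_M {k : GroupType} (hl : k ≠ .linear) (v w w' : Fin n → R) (h : pairing k v w' = 0)
    (h' : pairing k w v = 0) (hv : pairing k v v = 0) :
    M k v w * M k v w' = -(kappa k R * pairing k w w') • vecMulVec v (tilde k v) := by
  have hv' := hv
  rw [pairing_eq] at h h' hv
  rw [pairing_eq]
  simp only [M_of_ne hl, mul_sub, sub_mul, smul_mul_smul_comm, Matrix.smul_mul, Matrix.mul_smul,
    vecMulVec_mul_vecMulVec, h, h', hv, vecMulVec_smul, zero_smul, smul_zero, vecMulVec_zero]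
  module

theorem M_mul_M_linear (v w w' : Fin n → R) (h : pairing .linear v w = 0) :
    M .linear v w * M .linear v w' = 0 := by
  rw [M_linear, M_linear, vecMulVec_mul_vecMulVec]
  have : w ⬝ᵥ v = 0 := by rw [dotProduct_comm]; exact h
  simp [this]

theorem M_mul_M_of_pairing_eq_zero (h2 : IsUnit (2 : R)) {k : GroupType} (hk : k.Admissible n)
    {v w w' : Fin n → R} (hv : VectorOK k v) (h : pairing k v w = 0)
    (h' : pairing k v w' = 0) (h'' : k = .linear ∨ pairing k w w' = 0) :
    M k v w * M k v w' = 0 := by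
  by_cases hl : k = .linear
  · subst hl
    exact M_mul_M_linear v w w' h
  · rw [M_mul_M hl v w w' h' (by rw [pairing_comm hk, h, mul_zero]) (pairing_self h2 hk hl hv),
      h''.resolve_left hl]
    simp

theorem map_form (f : R →+* S) (k : GroupType) : (form k n R).map f = form k n S := by
  ext i j
  simp only [form, map_apply, of_apply]
  split_ifs
  · cases k <;> simp [sgn]
  · simp

theorem map_kappa (f : R →+* S) (k : GroupType) : f (kappa k R) = kappa k S := by
  cases k <;> simp [kappa]

theorem map_tilde (f : R →+* S) (k : GroupType) (v : Fin n → R) :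
    tilde k (f ∘ v) = f ∘ tilde k v := by
  by_cases hl : k = .linear
  · subst hl; rfl
  · rw [tilde_of_ne hl, tilde_of_ne hl, ← map_form f]
    ext i
    exact (RingHom.map_vecMul f _ _ _).symm

theorem map_M (f : R →+* S) (k : GroupType) (v w : Fin n → R) :
    (M k v w).map f = M k (f ∘ v) (f ∘ w) := by
  by_cases hl : k = .linear
  · subst hl
    ext i j
    simp [M_linear, vecMulVec_apply]
  · simp only [M_of_ne hl, map_tilde]
    ext i j
    simp [vecMulVec_apply, map_kappa f]

theorem map_pairing (f : R →+* S) (k : GroupType) (v w : Fin n → R) :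
    pairing k (f ∘ v) (f ∘ w) = f (pairing k v w) := by
  rw [pairing_eq, pairing_eq, map_tilde]
  exact (RingHom.map_dotProduct f _ _).symm

theorem VectorOK.map (f : R →+* S) {k : GroupType} {v : Fin n → R} (hv : VectorOK k v) :
    VectorOK k (f ∘ v) := by
  cases k with
  | linear => trivial
  | symplectic => trivial
  | orthogonal =>
    change pairing .orthogonal v v = 0 at hv
    change pairing .orthogonal _ _ = 0
    rw [map_pairing, hv, map_zero]

theorem GoodPair.map (f : R →+* S) {k : GroupType} {I : Ideal R} {J : Ideal S}
    (h : ∀ x ∈ I, f x ∈ J) {v w : Fin n → R} (hg : GoodPair k I v w) :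
    GoodPair k J (f ∘ v) (f ∘ w) := by
  refine ⟨fun i => h _ (hg.1 i), ?_, hg.2.2.1.map f, hg.2.2.2.map f⟩
  rw [map_pairing, hg.2.1, map_zero]

theorem GoodPair.smul_right {k : GroupType} {I J : Ideal R} {v w : Fin n → R}
    (hg : GoodPair k I v w) {c : R} (h : ∀ x ∈ I, c * x ∈ J) : GoodPair k J v (c • w) :=
  ⟨fun i => h _ (hg.1 i), by rw [pairing_smul_right, hg.2.1, mul_zero], hg.2.2.1,
    hg.2.2.2.smul c⟩

theorem GoodPair.pairing_self_right (h2 : IsUnit (2 : R)) {k : GroupType} (hk : k.Admissible n)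
    {I : Ideal R} {v w : Fin n → R} (hg : GoodPair k I v w) :
    k = .linear ∨ pairing k w w = 0 := by
  by_cases hl : k = .linear
  · exact Or.inl hl
  · exact Or.inr (pairing_self h2 hk hl hg.2.2.2)

/-- The transvection `1 + M(v, w)`, as an invertible matrix. -/
noncomputable def transv (k : GroupType) (v w : Fin n → R) : GL (Fin n) R :=
  open Classical in
  -- Square zero makes `1 - M(v, w)` the inverse. The condition holds for every `GoodPair` when 2 is
  -- invertible; elsewhere the value is a default.
  if h : M k v w * M k v w = 0 then
    ⟨1 + M k v w, 1 - M k v w, by simp [mul_sub, add_mul, h], by simp [mul_add, sub_mul, h]⟩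
  else 1

theorem coe_transv (h2 : IsUnit (2 : R)) {k : GroupType} (hk : k.Admissible n) {I : Ideal R}
    {v w : Fin n → R} (hg : GoodPair k I v w) :
    (transv k v w : Matrix (Fin n) (Fin n) R) = 1 + M k v w := by
  have h := M_mul_M_of_pairing_eq_zero h2 hk hg.2.2.1 hg.2.1 hg.2.1 (hg.pairing_self_right h2 hk)
  simp [transv, h]

theorem map_transv (h2 : IsUnit (2 : R)) {k : GroupType} (hk : k.Admissible n) {I : Ideal R}
    {v w : Fin n → R} (hg : GoodPair k I v w) (f : R →+* S) :
    Matrix.GeneralLinearGroup.map f (transv k v w) = transv k (f ∘ v) (f ∘ w) := by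
  have h2' : IsUnit (2 : S) := map_ofNat f 2 ▸ h2.map f
  apply Units.ext
  rw [coe_map, coe_transv h2 hk hg, coe_transv h2' hk (hg.map f (J := ⊤) (by simp)),
    Matrix.map_add f (map_add f), map_M]
  simp

theorem transv_smul_add (h2 : IsUnit (2 : R)) {k : GroupType} (hk : k.Admissible n)
    {I : Ideal R} {v w : Fin n → R} (hg : GoodPair k I v w) (a b : R) :
    transv k v ((a + b) • w) = transv k v (a • w) * transv k v (b • w) := by
  have hI (c : R) : ∀ x ∈ I, c * x ∈ I := fun x hx => I.mul_mem_left c hx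
  have h : M k v w * M k v w = 0 :=
    M_mul_M_of_pairing_eq_zero h2 hk hg.2.2.1 hg.2.1 hg.2.1 (hg.pairing_self_right h2 hk)
  apply Units.ext
  rw [Units.val_mul, coe_transv h2 hk (hg.smul_right (hI _)), coe_transv h2 hk
    (hg.smul_right (hI _)), coe_transv h2 hk (hg.smul_right (hI _)), M_smul_right, M_smul_right,
    M_smul_right]
  simp only [mul_add, add_mul, one_mul, mul_one, smul_mul_smul_comm, h, smul_zero]
  module

end Forms

/-! ### Conjugation of transvections by the classical group. -/

section Action

variable {R : Type*} [CommRing R] {n : ℕ}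

theorem mem_G_iff {k : GroupType} (hl : k ≠ .linear) (g : GL (Fin n) R) :
    g ∈ G k n R ↔ (g : Matrix (Fin n) (Fin n) R)ᵀ * form k n R * g = form k n R := by
  cases k
  · exact absurd rfl hl
  · exact Iff.rfl
  · exact Iff.rfl

theorem eu_mul_form (k : GroupType) (i j : Fin n) :
    eu i j * form k n R = sgn k R j • eu i (sigma j) := by
  ext a b
  by_cases ha : i = a
  · subst ha
    by_cases hb : sigma j = b
    · subst hb; simp [eu, form]
    · simp [eu, form, hb, Ne.symm hb]
  · simp [eu, ha, Matrix.single_mul_apply_of_ne _ _ _ _ _ (Ne.symm ha)]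

theorem form_mul_eu (hn : Even n) (k : GroupType) (i j : Fin n) :
    form k n R * eu i j = sgn k R (sigma i) • eu (sigma i) j := by
  ext a b
  by_cases hb : j = b
  · subst hb
    by_cases ha : sigma i = a
    · subst ha; simp [eu, form, sigma_sigma hn]
    · have : i ≠ sigma a := fun e => ha ((sigma_eq_iff hn _ _).mpr e)
      simp [eu, form, ha, this]
  · simp [eu, hb, Matrix.mul_single_apply_of_ne _ _ _ _ _ (Ne.symm hb)]

theorem root_mem_G {k : GroupType} (hk : k.Admissible n) {i j : Fin n} (h : IsRoot k i j)
    (z : R) : root k i j z ∈ G k n R := by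
  have ht (i j : Fin n) : (eu i j : Matrix (Fin n) (Fin n) R)ᵀ = eu j i := by simp [eu]
  rcases h.cases hk with rfl | ⟨hl, hs⟩ | ⟨rfl, rfl⟩
  · exact Subgroup.mem_top _
  · have hn := hk.even hl
    have c1 := sigma_ne hn j
    have c2 := sigma_ne hn i
    have hA : Apart i j := ⟨h.ne, hs⟩
    rw [mem_G_iff hl, coe_root hk h, ge_short hl hs]
    simp only [transpose_sub, transpose_add, transpose_one, transpose_smul, ht, add_mul, sub_mul,
      mul_add, mul_sub, Matrix.smul_mul, Matrix.mul_smul, one_mul, mul_one, eu_mul_form,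
      form_mul_eu hn, eu_mul_eu, sigma_sigma hn, sgn_sigma hn, c2, hA.1.symm, c1.symm,
      (hA.sigma_sigma hn).1, if_false, smul_zero]
    have e3 := sgn_mul_self (R := R) k j
    linear_combination (norm := module) (-(z * sgn k R i) * e3) •
      (eu j (sigma i) : Matrix (Fin n) (Fin n) R) + (-(z * kappa k R * sgn k R i) * e3) •
      (eu (sigma i) j : Matrix (Fin n) (Fin n) R)
  · have hl : GroupType.symplectic ≠ .linear := by simp
    have hn := hk.even hl
    have c2 := sigma_ne hn i
    rw [mem_G_iff hl, coe_root hk h, ge_long hn]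
    simp only [transpose_add, transpose_one, transpose_smul, ht, add_mul,
      mul_add, Matrix.smul_mul, Matrix.mul_smul, one_mul, mul_one, eu_mul_form,
      form_mul_eu hn, eu_mul_eu, sgn_sigma hn, c2, if_false, smul_zero]
    simp only [kappa]
    module

theorem elem_le_G {k : GroupType} (hk : k.Admissible n) : elem k n R ≤ G k n R :=
  elemIdeal_le_of_root hk fun _ _ h z _ => root_mem_G hk h z

/-- The action of `g ∈ G(n, R)` on the second argument of `M(v, w)`. -/
noncomputable def dualAct (k : GroupType) (g : GL (Fin n) R) (w : Fin n → R) : Fin n → R :=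
  match k with
  | .linear => w ᵥ* ((g⁻¹ : GL (Fin n) R) : Matrix (Fin n) (Fin n) R)
  | _ => (g : Matrix (Fin n) (Fin n) R) *ᵥ w

theorem dualAct_of_ne {k : GroupType} (hl : k ≠ .linear) (g : GL (Fin n) R) (w : Fin n → R) :
    dualAct k g w = (g : Matrix (Fin n) (Fin n) R) *ᵥ w := by
  cases k
  · exact absurd rfl hl
  · rfl
  · rfl

/-- Invariance of the form, rewritten as `gᵗ ψ = ψ g⁻¹`, turns the left action on `v` into the right
action of the inverse on `ṽ`. -/
theorem tilde_mulVec {k : GroupType} (hl : k ≠ .linear) {g : GL (Fin n) R} (hg : g ∈ G k n R)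
    (v : Fin n → R) : tilde k ((g : Matrix (Fin n) (Fin n) R) *ᵥ v) =
      tilde k v ᵥ* ((g⁻¹ : GL (Fin n) R) : Matrix (Fin n) (Fin n) R) := by
  rw [mem_G_iff hl] at hg
  have h1 : (g : Matrix (Fin n) (Fin n) R) * ((g⁻¹ : GL (Fin n) R) : Matrix (Fin n) (Fin n) R) = 1 :=
    by simp
  have h3 : (g : Matrix (Fin n) (Fin n) R)ᵀ * form k n R =
      form k n R * ((g⁻¹ : GL (Fin n) R) : Matrix (Fin n) (Fin n) R) := by
    rw [← Matrix.mul_one ((g : Matrix (Fin n) (Fin n) R)ᵀ * form k n R), ← h1, ← Matrix.mul_assoc, hg]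
  rw [tilde_of_ne hl, tilde_of_ne hl, vecMul_vecMul, ← h3, ← vecMul_vecMul, vecMul_transpose]

theorem conj_M {k : GroupType} {g : GL (Fin n) R} (hg : g ∈ G k n R) (v w : Fin n → R) :
    (g : Matrix (Fin n) (Fin n) R) * M k v w * ((g⁻¹ : GL (Fin n) R) : Matrix (Fin n) (Fin n) R) =
      M k ((g : Matrix (Fin n) (Fin n) R) *ᵥ v) (dualAct k g w) := by
  by_cases hl : k = .linear
  · subst hl
    rw [M_linear, M_linear, mul_vecMulVec, vecMulVec_mul]
    rfl
  · rw [dualAct_of_ne hl, M_of_ne hl, M_of_ne hl, tilde_mulVec hl hg, tilde_mulVec hl hg]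
    simp only [mul_sub, sub_mul, Matrix.mul_smul, Matrix.smul_mul, mul_vecMulVec, vecMulVec_mul]

theorem pairing_act {k : GroupType} {g : GL (Fin n) R} (hg : g ∈ G k n R) (v w : Fin n → R) :
    pairing k ((g : Matrix (Fin n) (Fin n) R) *ᵥ v) (dualAct k g w) = pairing k v w := by
  have h1 : ((g⁻¹ : GL (Fin n) R) : Matrix (Fin n) (Fin n) R) * (g : Matrix (Fin n) (Fin n) R) = 1 :=
    by simp
  by_cases hl : k = .linear
  · subst hl
    change (g : Matrix (Fin n) (Fin n) R) *ᵥ v ⬝ᵥ (w ᵥ* _) = v ⬝ᵥ w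
    rw [dotProduct_comm, ← dotProduct_mulVec, mulVec_mulVec, h1, one_mulVec, dotProduct_comm]
  · rw [dualAct_of_ne hl, pairing_eq, tilde_mulVec hl hg, ← dotProduct_mulVec, mulVec_mulVec, h1,
      one_mulVec, pairing_eq]

theorem VectorOK.act {k : GroupType} {g : GL (Fin n) R} (hg : g ∈ G k n R) {v : Fin n → R}
    (hv : VectorOK k v) : VectorOK k ((g : Matrix (Fin n) (Fin n) R) *ᵥ v) := by
  cases k with
  | linear => trivial
  | symplectic => trivial
  | orthogonal => exact (pairing_act hg v v).trans hv

theorem VectorOK.dualAct {k : GroupType} {g : GL (Fin n) R} (hg : g ∈ G k n R) {v : Fin n → R}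
    (hv : VectorOK k v) : VectorOK k (dualAct k g v) := by
  cases k with
  | linear => trivial
  | symplectic => trivial
  | orthogonal => exact VectorOK.act hg hv

theorem dualAct_mem (k : GroupType) (g : GL (Fin n) R) {I : Ideal R} {w : Fin n → R}
    (hw : ∀ i, w i ∈ I) (i : Fin n) : dualAct k g w i ∈ I := by
  by_cases hl : k = .linear
  · subst hl
    change ∑ j, w j * (g⁻¹).val j i ∈ I
    exact I.sum_mem fun j _ => I.mul_mem_right _ (hw j)
  · rw [dualAct_of_ne hl]
    change ∑ j, g.val i j * w j ∈ I
    exact I.sum_mem fun j _ => I.mul_mem_left _ (hw j)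

theorem GoodPair.act {k : GroupType} {g : GL (Fin n) R} (hg : g ∈ G k n R) {I : Ideal R}
    {v w : Fin n → R} (h : GoodPair k I v w) :
    GoodPair k I ((g : Matrix (Fin n) (Fin n) R) *ᵥ v) (ClassicalRel.dualAct k g w) :=
  ⟨dualAct_mem k g h.1, (pairing_act hg v w).trans h.2.1, h.2.2.1.act hg, h.2.2.2.dualAct hg⟩

theorem conj_transv (h2 : IsUnit (2 : R)) {k : GroupType} (hk : k.Admissible n)
    {g : GL (Fin n) R} (hg : g ∈ G k n R) {I : Ideal R} {v w : Fin n → R}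
    (h : GoodPair k I v w) :
    g * transv k v w * g⁻¹ = transv k ((g : Matrix (Fin n) (Fin n) R) *ᵥ v) (dualAct k g w) := by
  apply Units.ext
  rw [Units.val_mul, Units.val_mul, coe_transv h2 hk h, coe_transv h2 hk (h.act hg), ← conj_M hg]
  simp [mul_add, add_mul]

end Action

/-! ### Transvections along basis vectors, and orbits of basis vectors. -/

section BasisVector

variable {R : Type*} [CommRing R] {n : ℕ}

/-- The basis vector. -/
abbrev bv (i : Fin n) : Fin n → R := Pi.single i 1

theorem bv_apply (i j : Fin n) : (bv i : Fin n → R) j = if j = i then 1 else 0 :=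
  Pi.single_apply _ _ _

theorem vecMulVec_bv (i j : Fin n) :
    vecMulVec (bv i) (bv j) = (eu i j : Matrix (Fin n) (Fin n) R) :=
  (Matrix.single_eq_single_vecMulVec_single i j).symm

theorem tilde_bv (hn : Even n) {k : GroupType} (hl : k ≠ .linear) (i : Fin n) :
    tilde k (bv i) = sgn k R i • (bv (sigma i) : Fin n → R) := by
  ext j
  rw [tilde_apply hn hl]
  by_cases h : sigma i = j
  · subst h
    simp [sigma_sigma hn]
  · have : sigma j ≠ i := fun e => h ((sigma_eq_iff hn _ _).mp e).symm
    simp [this, Ne.symm h]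

theorem pairing_bv_left (hn : Even n) {k : GroupType} (hl : k ≠ .linear) (i : Fin n)
    (w : Fin n → R) : pairing k (bv i) w = sgn k R i * w (sigma i) := by
  rw [pairing_eq, tilde_bv hn hl, smul_dotProduct, single_one_dotProduct, smul_eq_mul]

theorem pairing_linear_bv (i : Fin n) (w : Fin n → R) : pairing .linear (bv i) w = w i :=
  single_one_dotProduct _ _

theorem M_bv_bv (hn : Even n) {k : GroupType} (hl : k ≠ .linear) (i j : Fin n) :
    M k (bv i) (bv j : Fin n → R) =
      sgn k R j • eu i (sigma j) - (kappa k R * sgn k R i) • eu j (sigma i) := by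
  rw [M_of_ne hl, tilde_bv hn hl, tilde_bv hn hl, vecMulVec_smul, vecMulVec_smul, vecMulVec_bv,
    vecMulVec_bv, smul_smul]

/-- `1 + M(e_i, e_j)` is a root element. -/
theorem coe_root_eq_M {k : GroupType} (hk : k.Admissible n) (hl : k ≠ .linear) {i j : Fin n}
    (h : Apart i j) (z : R) :
    (root k i (sigma j) (sgn k R j * z) : Matrix (Fin n) (Fin n) R) =
      1 + z • M k (bv i) (bv j) := by
  have hn := hk.even hl
  have h' := h.sigma_right hn
  rw [coe_root hk h'.isRoot, ge_short hl h'.2, M_bv_bv hn hl, sigma_sigma hn, sgn_sigma hn]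
  linear_combination (norm := module) (-(z * kappa k R * sgn k R i) * sgn_mul_self (R := R) k j) •
    (eu j (sigma i) : Matrix (Fin n) (Fin n) R)

/-- `1 + M(e_i, e_i)` is a long root element. -/
theorem coe_root_long_eq (hk : GroupType.symplectic.Admissible n) (i : Fin n) (z : R) :
    (root .symplectic i (sigma i) (sgn .symplectic R i * z) : Matrix (Fin n) (Fin n) R) =
      1 + z • vecMulVec (bv i) (tilde .symplectic (bv i)) := by
  have hn := hk.even (by simp)
  rw [coe_root hk (sigma_ne hn i).symm, ge_long hn, tilde_bv hn (by simp), vecMulVec_smul,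
    vecMulVec_bv, smul_smul, mul_comm]

theorem row_mem (hk : GroupType.linear.Admissible n) {I : Ideal R} (i : Fin n) (s : Finset (Fin n))
    (w : Fin n → R) (hw : ∀ j, w j ∈ I) (hi : w i = 0) :
    MatMem (1 + vecMulVec (bv i) (∑ j ∈ s, w j • bv j)) (elemIdeal .linear n I) := by
  induction s using Finset.induction_on with
  | empty => exact ⟨1, one_mem _, by simp⟩
  | insert j s hj ih =>
    obtain ⟨g, hg, e⟩ := ih
    by_cases hij : i = j
    · subst hij
      refine ⟨g, hg, ?_⟩
      rw [e, Finset.sum_insert hj, hi, zero_smul, zero_add]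
    · refine ⟨g * root .linear i j (w j), mul_mem hg (root_mem hk hij (hw j)), ?_⟩
      have h0 : (∑ j ∈ s, w j • bv j) ⬝ᵥ bv i = (0 : R) := by
        rw [sum_dotProduct]
        refine Finset.sum_eq_zero fun l _ => ?_
        by_cases hl : l = i
        · subst hl; simp [hi]
        · simp [hl]
      rw [Units.val_mul, e, coe_root hk hij, ge_linear, Finset.sum_insert hj, vecMulVec_add,
        vecMulVec_smul, ← vecMulVec_bv, mul_add, add_mul, Matrix.mul_smul, add_mul, vecMulVec_mul_vecMulVec, h0]
      simp only [zero_smul, vecMulVec_zero, one_mul, mul_one]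
      module

theorem column_mem (hk : GroupType.linear.Admissible n) {I : Ideal R} (i : Fin n)
    (s : Finset (Fin n)) (w : Fin n → R) (hw : ∀ j, w j ∈ I) (hi : w i = 0) :
    MatMem (1 + vecMulVec (∑ j ∈ s, w j • bv j) (bv i)) (elemIdeal .linear n I) := by
  induction s using Finset.induction_on with
  | empty => exact ⟨1, one_mem _, by simp⟩
  | insert j s hj ih =>
    obtain ⟨g, hg, e⟩ := ih
    by_cases hij : j = i
    · subst hij
      refine ⟨g, hg, ?_⟩
      rw [e, Finset.sum_insert hj, hi, zero_smul, zero_add]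
    · refine ⟨g * root .linear j i (w j), mul_mem hg (root_mem hk hij (hw j)), ?_⟩
      have h0 : bv i ⬝ᵥ bv j = (0 : R) := by simp [hij]
      rw [Units.val_mul, e, coe_root hk hij, ge_linear, Finset.sum_insert hj, add_vecMulVec,
        smul_vecMulVec, ← vecMulVec_bv, mul_add, add_mul, Matrix.mul_smul, add_mul, vecMulVec_mul_vecMulVec, h0]
      simp only [zero_smul, vecMulVec_zero, one_mul, mul_one]
      module

theorem sum_smul_bv (w : Fin n → R) : ∑ j, w j • bv j = w := by
  ext i
  simp [Finset.sum_apply, Pi.single_apply]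

theorem heisenberg_mul {k : GroupType} (hl : k ≠ .linear) {e w w' : Fin n → R} (c c' : R)
    (he : pairing k e e = 0) (hw : pairing k w e = 0) (hw' : pairing k e w' = 0) :
    (1 + M k e w + c • vecMulVec e (tilde k e)) * (1 + M k e w' + c' • vecMulVec e (tilde k e)) =
      1 + M k e (w + w') + (c + c' - kappa k R * pairing k w w') • vecMulVec e (tilde k e) := by
  have h1 := M_mul_M hl e w w' hw' hw he
  rw [pairing_eq] at he hw hw'
  have h2 : M k e w * vecMulVec e (tilde k e) = 0 := by
    rw [M_of_ne hl, sub_mul, Matrix.smul_mul, vecMulVec_mul_vecMulVec, vecMulVec_mul_vecMulVec, he, hw]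
    simp
  have h3 : vecMulVec e (tilde k e) * M k e w' = 0 := by
    rw [M_of_ne hl, mul_sub, Matrix.mul_smul, vecMulVec_mul_vecMulVec, vecMulVec_mul_vecMulVec, he, hw']
    simp
  have h4 : vecMulVec e (tilde k e) * vecMulVec e (tilde k e) = 0 := by
    rw [vecMulVec_mul_vecMulVec, he]
    simp
  rw [M_add_right]
  simp only [mul_add, add_mul, one_mul, mul_one, Matrix.mul_smul, Matrix.smul_mul, h1, h2, h3, h4,
    smul_zero]
  module

/-- The vector is built up one coordinate at a time. Partial sums of an isotropic vector need not be
isotropic, so a central term `c` is carried along: long root elements absorb it in the symplectic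
group, while in the orthogonal group it is forced to be `-⟨w, w⟩ / 2`. -/
theorem heisenberg_mem (hl2 : IsUnit (2 : R)) {k : GroupType} (hk : k.Admissible n)
    (hl : k ≠ .linear) {I : Ideal R} (i : Fin n) (w : Fin n → R) (hw : ∀ j, w j ∈ I)
    (hi : w (sigma i) = 0) (s : Finset (Fin n)) (c : R) (hc : c ∈ I)
    (ho : k = .orthogonal →
      2 * c = - pairing k (∑ j ∈ s, w j • bv j) (∑ j ∈ s, w j • bv j)) :
    MatMem (1 + M k (bv i) (∑ j ∈ s, w j • bv j) + c • vecMulVec (bv i) (tilde k (bv i)))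
      (elemIdeal k n I) := by
  have hn := hk.even hl
  have hp (j l : Fin n) : pairing k (bv j) (bv l : Fin n → R) =
      if sigma j = l then sgn k R j else 0 := by
    rw [pairing_bv_left hn hl, bv_apply]
    simp
  have hpj (j : Fin n) : pairing k (bv j) (bv j : Fin n → R) = 0 := by
    rw [hp, if_neg (sigma_ne hn j)]
  have hps (s : Finset (Fin n)) : pairing k (bv i) (∑ j ∈ s, w j • (bv j : Fin n → R)) = 0 := by
    rw [pairing_bv_left hn hl, Finset.sum_apply]
    simp only [Pi.smul_apply, bv_apply, smul_eq_mul, mul_ite, mul_one, mul_zero]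
    simp [hi]
  have long (c : R) (hc : c ∈ I) (ho : k = .orthogonal → c = 0) :
      MatMem (1 + c • vecMulVec (bv i) (tilde k (bv i))) (elemIdeal k n I) := by
    cases k with
    | linear => exact absurd rfl hl
    | symplectic =>
      exact ⟨_, root_mem hk (sigma_ne hn i).symm (I.mul_mem_left _ hc), coe_root_long_eq hk i c⟩
    | orthogonal => exact ⟨1, one_mem _, by simp [ho rfl]⟩
  induction s using Finset.induction_on generalizing c with
  | empty =>
    simp only [Finset.sum_empty, M_zero_right, add_zero]
    refine long c hc fun h => ?_
    have := ho h
    rw [Finset.sum_empty, show pairing k (0 : Fin n → R) 0 = 0 by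
      simpa using pairing_smul_left k (0 : R) 0 0] at this
    exact hl2.mul_right_eq_zero.mp (by simpa using this)
  | insert j s hj ih =>
    set u := ∑ l ∈ s, w l • (bv l : Fin n → R) with hu
    set t := pairing k u (w j • bv j) with ht
    rw [Finset.sum_insert hj, add_comm (w j • bv j) u] at ho ⊢
    have htI : t ∈ I := by
      rw [ht, pairing_smul_right]
      exact I.mul_mem_right _ (hw j)
    -- The shift by `κ t` is the cocycle term of `heisenberg_mul`, which the multiplication by the
    -- new factor removes again.
    obtain ⟨g, hg, e⟩ := ih (c + kappa k R * t) (I.add_mem hc (I.mul_mem_left _ htI)) (by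
      intro h
      have h' := ho h
      simp only [pairing_add_left, pairing_add_right] at h'
      rw [pairing_comm hk u (w j • bv j), ← ht, pairing_smul_left, pairing_smul_right, hpj] at h'
      have hκ : kappa k R = 1 := by rw [h]; rfl
      rw [hκ] at h' ⊢
      linear_combination h')
    have single : MatMem (1 + M k (bv i) (w j • bv j)) (elemIdeal k n I) := by
      rw [M_smul_right]
      by_cases h1 : i = j
      · subst h1
        rw [M_of_ne hl]
        -- `M(e_i, e_i)` is `1 - κ` times the long direction, hence zero in the orthogonal case.
        convert long (w i - w i * kappa k R) (I.sub_mem (hw i) (I.mul_mem_right _ (hw i)))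
          (by rintro rfl; simp [kappa]) using 1
        module
      by_cases h2 : i = sigma j
      · have : w j = 0 := by rw [← hi, h2, sigma_sigma hn]
        exact ⟨1, one_mem _, by simp [this]⟩
      · exact ⟨_, root_mem hk (Apart.sigma_right hn ⟨h1, h2⟩).isRoot (I.mul_mem_left _ (hw j)),
          coe_root_eq_M hk hl ⟨h1, h2⟩ _⟩
    obtain ⟨g', hg', e'⟩ := single
    refine ⟨g * g', mul_mem hg hg', ?_⟩
    have hpw : pairing k (bv i) (w j • (bv j : Fin n → R)) = 0 := by
      rw [pairing_bv_left hn hl, Pi.smul_apply, bv_apply]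
      split_ifs with h
      · rw [← h, hi]; simp
      · simp
    have := heisenberg_mul hl (c + kappa k R * t) 0 (hpj i)
      (by rw [pairing_comm hk, hps s, mul_zero] : pairing k u (bv i) = 0) hpw
    rw [zero_smul, add_zero, add_zero, ← ht, add_sub_cancel_right] at this
    rw [Units.val_mul, e, e', this]

/-- `1 + M(e_i, w)` lies in `E(n, I)` for `w ∈ Iⁿ` orthogonal to `e_i`. -/
theorem transv_bv_mem (h2 : IsUnit (2 : R)) {k : GroupType} (hk : k.Admissible n) {I : Ideal R}
    {i : Fin n} {w : Fin n → R} (hg : GoodPair k I (bv i) w) :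
    transv k (bv i) w ∈ elemIdeal k n I := by
  have key : MatMem (1 + M k (bv i) w) (elemIdeal k n I) := by
    by_cases hl : k = .linear
    · subst hl
      have := row_mem hk i Finset.univ w hg.1 (by simpa [pairing_linear_bv] using hg.2.1)
      rwa [sum_smul_bv] at this
    · have hn := hk.even hl
      have hi : w (sigma i) = 0 := by
        have := hg.2.1
        rw [pairing_bv_left hn hl] at this
        linear_combination sgn k R i * this - w (sigma i) * sgn_mul_self (R := R) k i
      have := heisenberg_mem h2 hk hl i w hg.1 hi Finset.univ 0 (zero_mem _) (by
        rw [sum_smul_bv]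
        rintro rfl
        have := hg.2.2.2
        change pairing .orthogonal w w = 0 at this
        simp [this])
      rwa [sum_smul_bv, zero_smul, add_zero] at this
  obtain ⟨g, hgm, e⟩ := key
  have : g = transv k (bv i) w := Units.ext (e.trans (coe_transv h2 hk hg).symm)
  exact this ▸ hgm

theorem M_mulVec {k : GroupType} (hl : k ≠ .linear) (v w x : Fin n → R) :
    M k v w *ᵥ x = pairing k w x • v - (kappa k R * pairing k v x) • w := by
  rw [M_of_ne hl, sub_mulVec, smul_mulVec, vecMulVec_mulVec, vecMulVec_mulVec, pairing_eq,
    pairing_eq, op_smul_eq_smul, op_smul_eq_smul, smul_smul]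

/-- A vector congruent to `e_i` modulo `I` with `i`-th entry `1` lies in `E(n, I) e_i`. -/
theorem exists_mem_mulVec (h2 : IsUnit (2 : R)) {k : GroupType} (hk : k.Admissible n)
    {I : Ideal R} {i : Fin n} {v : Fin n → R} (hv : VectorOK k v) (hi : v i = 1)
    (hI : ∀ j, j ≠ i → v j ∈ I) :
    ∃ g ∈ elemIdeal k n I, (g : Matrix (Fin n) (Fin n) R) *ᵥ bv i = v := by
  by_cases hl : k = .linear
  · subst hl
    obtain ⟨g, hg, e⟩ := column_mem hk i Finset.univ (Function.update v i 0) (I := I) (by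
      intro j
      by_cases hj : j = i
      · subst hj; simp
      · simpa [hj] using hI j hj) (by simp)
    refine ⟨g, hg, ?_⟩
    rw [e, sum_smul_bv, add_mulVec, one_mulVec, vecMulVec_mulVec, op_smul_eq_smul,
      single_one_dotProduct]
    ext j
    by_cases hj : j = i
    · subst hj; simp [hi]
    · simp [hj]
  · have hn := hk.even hl
    have c1 := sigma_ne hn i
    set u : Fin n → R := fun j => if j = i ∨ j = sigma i then 0 else v j with hu
    set a : R := sgn k R (sigma i) with ha
    have haa : a * a = 1 := sgn_mul_self k _
    have hκ : kappa k R * kappa k R = 1 := kappa_mul_self k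
    have huI (j : Fin n) : u j ∈ I := by
      simp only [hu]
      split_ifs with h
      · exact zero_mem _
      · exact hI j (fun e => h (Or.inl e))
    have hui : u i = 0 := by simp [hu]
    have hus : u (sigma i) = 0 := by simp [hu]
    have hveq : v = bv i + u + v (sigma i) • bv (sigma i) := by
      ext j
      simp only [Pi.add_apply, bv_apply, Pi.smul_apply, smul_eq_mul, hu]
      by_cases hj : j = i
      · subst hj; simp [hi, c1.symm]
      · by_cases hj' : j = sigma i
        · subst hj'; simp [c1]
        · simp [hj, hj']
    -- A Heisenberg element based at `e_{σ i}` sends `e_i` to `e_i - κ a w + a c e_{σ i}`. Matching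
    -- this with `v` dictates `w` and `c`, and isotropy of `v` is exactly the orthogonal condition
    -- on `c`.
    obtain ⟨g, hg, e⟩ := heisenberg_mem h2 hk hl (I := I) (sigma i) ((-(kappa k R * a)) • u)
      (fun j => I.mul_mem_left _ (huI j)) (by simp [sigma_sigma hn, hui]) Finset.univ
      (a * v (sigma i)) (I.mul_mem_left _ (hI _ c1)) (by
        rintro rfl
        rw [sum_smul_bv, pairing_smul_left, pairing_smul_right]
        have h0 : pairing .orthogonal v v = 0 := hv
        have hl' : GroupType.orthogonal ≠ .linear := by simp
        have p1 : pairing .orthogonal u (bv i) = 0 := by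
          rw [pairing_comm hk (bv i), pairing_bv_left hn hl', hus]; simp
        have p2 : pairing .orthogonal u (bv (sigma i)) = 0 := by
          rw [pairing_comm hk (bv (sigma i)), pairing_bv_left hn hl', sigma_sigma hn, hui]; simp
        rw [hveq] at h0
        simp only [pairing_add_left, pairing_add_right, pairing_smul_left, pairing_smul_right,
          p1, p2] at h0
        simp only [pairing_bv_left hn hl', bv_apply, sigma_sigma hn, hui, hus, c1, c1.symm,
          if_false, if_true] at h0
        simp only [ha, sgn, kappa] at h0 ⊢
        linear_combination h0)
    refine ⟨g, hg, ?_⟩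
    have p1 : pairing k u (bv i) = 0 := by
      rw [pairing_comm hk (bv i), pairing_bv_left hn hl, hus]; simp
    have p3 : pairing k (bv (sigma i)) (bv i : Fin n → R) = a := by
      rw [pairing_bv_left hn hl, sigma_sigma hn, bv_apply]; simp [ha]
    rw [e, sum_smul_bv, add_mulVec, add_mulVec, one_mulVec, M_mulVec hl, smul_mulVec,
      vecMulVec_mulVec, op_smul_eq_smul, ← pairing_eq, p3, pairing_smul_left, p1]
    conv_rhs => rw [hveq]
    linear_combination (norm := module) (a * a * hκ + haa) • u +
      (v (sigma i) * haa) • (bv (sigma i) : Fin n → R)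

end BasisVector

/-! ### Clearing denominators by dilation of the variable. -/

section Localization

variable {A : Type*} [CommRing A] {B : Type*} [CommRing B] {n : ℕ}

theorem map_map {C : Type*} [CommRing C] (f : A →+* B) (g : B →+* C) (α : GL (Fin n) A) :
    Matrix.GeneralLinearGroup.map g (Matrix.GeneralLinearGroup.map f α) =
      Matrix.GeneralLinearGroup.map (g.comp f) α := rfl

theorem map_apply_eq {f g : A →+* B} {α β : GL (Fin n) A}
    (h : Matrix.GeneralLinearGroup.map f α = Matrix.GeneralLinearGroup.map g β) (i j : Fin n) :
    f (α.val i j) = g (β.val i j) :=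
  congrArg (fun γ : GL (Fin n) B => γ.val i j) h

theorem map_poly_congr {f g : A[X] →+* B} (hC : ∀ a, f (C a) = g (C a)) (hX : f X = g X)
    (α : GL (Fin n) A[X]) :
    Matrix.GeneralLinearGroup.map f α = Matrix.GeneralLinearGroup.map g α := by
  rw [Polynomial.ringHom_ext hC hX]

theorem map_id (α : GL (Fin n) A) :
    Matrix.GeneralLinearGroup.map (RingHom.id A) α = α := rfl

theorem map_mem_of_mem_polyIdeal {I : Ideal A} {J : Ideal B} (f : A[X] →+* B)
    (h : ∀ a ∈ I, f (C a) ∈ J) {p : A[X]} (hp : p ∈ polyIdeal I) : f p ∈ J := by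
  have : polyIdeal I ≤ J.comap f := Ideal.map_le_iff_le_comap.mpr h
  exact this hp

theorem C_mem_polyIdeal {I : Ideal A} {a : A} (h : a ∈ I) : C a ∈ polyIdeal I :=
  Ideal.mem_map_of_mem _ h

theorem mem_polyIdeal {I : Ideal A} {p : A[X]} : p ∈ polyIdeal I ↔ ∀ i, p.coeff i ∈ I :=
  Ideal.mem_map_C_iff

theorem polyIdeal_top : polyIdeal (⊤ : Ideal A) = ⊤ := Ideal.map_top _

/-- The homomorphism `φ` has the elementary properties of a localization at `S`, and maps `I` to
the localization `J` of `I`. -/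
structure LocLike (φ : A →+* B) (S : Submonoid A) (I : Ideal A) (J : Ideal B) : Prop where
  clear : ∀ z ∈ J, ∃ s ∈ S, ∃ a ∈ I, φ a = φ s * z
  ker : ∀ a, φ a = 0 → ∃ s ∈ S, s * a = 0

theorem LocLike.poly {φ : A →+* B} {S : Submonoid A} {I : Ideal A} {J : Ideal B}
    (h : LocLike φ S I J) :
    LocLike (mapRingHom φ) (S.map (C : A →+* A[X])) (polyIdeal I) (polyIdeal J) where
  clear z hz := by
    have hz' := mem_polyIdeal.mp hz
    rw [z.as_sum_support]
    refine Finset.sum_induction _ (fun z : B[X] => ∃ s ∈ S.map (C : A →+* A[X]),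
      ∃ a ∈ polyIdeal I, mapRingHom φ a = mapRingHom φ s * z) ?_ ?_ ?_
    · rintro x y ⟨_, ⟨s, hs, rfl⟩, a, ha, e⟩ ⟨_, ⟨t, ht, rfl⟩, b, hb, e'⟩
      refine ⟨_, ⟨s * t, S.mul_mem hs ht, rfl⟩, C t * a + C s * b,
        add_mem (Ideal.mul_mem_left _ _ ha) (Ideal.mul_mem_left _ _ hb), ?_⟩
      simp only [map_add, map_mul, e, e']
      ring
    · exact ⟨1, one_mem _, 0, zero_mem _, by simp⟩
    · intro i _
      obtain ⟨s, hs, a, ha, e⟩ := h.clear _ (hz' i)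
      refine ⟨_, ⟨s, hs, rfl⟩, monomial i a, ?_, ?_⟩
      · rw [mem_polyIdeal]
        intro j
        rw [coeff_monomial]
        split_ifs
        · exact ha
        · exact zero_mem _
      · simp [e, C_mul_monomial]
  ker a ha := by
    have ha' (i : ℕ) : φ (a.coeff i) = 0 := by
      have := congrArg (fun p => coeff p i) ha
      simpa using this
    rw [a.as_sum_support]
    refine Finset.sum_induction _ (fun z : A[X] => ∃ s ∈ S.map (C : A →+* A[X]), s * z = 0) ?_ ?_ ?_
    · rintro x y ⟨s, hs, e⟩ ⟨t, ht, e'⟩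
      exact ⟨s * t, mul_mem hs ht, by linear_combination t * e + s * e'⟩
    · exact ⟨1, one_mem _, mul_zero _⟩
    · intro i _
      obtain ⟨s, hs, e⟩ := h.ker _ (ha' i)
      exact ⟨_, ⟨s, hs, rfl⟩, by simp [C_mul_monomial, e]⟩

theorem LocLike.of_isLocalization [Algebra A B] (S : Submonoid A) [IsLocalization S B]
    (I : Ideal A) : LocLike (algebraMap A B) S I (I.map (algebraMap A B)) where
  clear z hz := by
    obtain ⟨⟨a, s⟩, e⟩ := (IsLocalization.mem_map_algebraMap_iff S B).mp hz
    exact ⟨s, s.2, a, a.2, by rw [← e, mul_comm]⟩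
  ker a ha := by
    obtain ⟨s, e⟩ := (IsLocalization.map_eq_zero_iff S B a).mp ha
    exact ⟨s, s.2, e⟩

theorem dilate_def (b : A) (α : GL (Fin n) A[X]) :
    dilate b α = Matrix.GeneralLinearGroup.map (compRingHom (C b * X)) α := rfl

theorem dilate_mul (b : A) (α β : GL (Fin n) A[X]) :
    dilate b (α * β) = dilate b α * dilate b β := map_mul _ _ _

theorem dilate_dilate (a b : A) (α : GL (Fin n) A[X]) :
    dilate a (dilate b α) = dilate (a * b) α := by
  rw [dilate_def, dilate_def, dilate_def, map_map]
  refine map_poly_congr (fun a => by simp) ?_ α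
  simp only [RingHom.coe_comp, Function.comp_apply, coe_compRingHom_apply, X_comp, mul_comp, C_comp,
    C_mul]
  ring

theorem map_dilate (φ : A →+* B) (b : A) (α : GL (Fin n) A[X]) :
    Matrix.GeneralLinearGroup.map (mapRingHom φ) (dilate b α) =
      dilate (φ b) (Matrix.GeneralLinearGroup.map (mapRingHom φ) α) := by
  rw [dilate_def, dilate_def, map_map, map_map]
  exact map_poly_congr (fun a => by simp) (by simp) α

theorem dilate_mem {k : GroupType} {I : Ideal A} (b : A) {α : GL (Fin n) A[X]}
    (h : α ∈ elemIdeal k n (Ideal.span {X} * polyIdeal I)) :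
    dilate b α ∈ elemIdeal k n (Ideal.span {X} * polyIdeal I) := by
  refine map_mem_elemIdeal _ (fun x hx => ?_) h
  obtain ⟨p, hp, rfl⟩ := Ideal.mem_span_singleton_mul.mp hx
  rw [map_mul]
  have : compRingHom (C b * X) p ∈ polyIdeal I :=
    map_mem_of_mem_polyIdeal _ (fun a ha => by simpa using C_mem_polyIdeal ha) hp
  rw [coe_compRingHom_apply, X_comp, mul_assoc]
  exact Ideal.mul_mem_left _ _ (Ideal.mul_mem_mul (Ideal.mem_span_singleton_self _) this)

/-- Dilation by `s` turns an entry `X p(X)` into `X · s p(sX)`. The factor `s` that comes from the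
leading `X` clears the denominators of `p`; for this the entries must be divisible by `X`. -/
theorem exists_lift {k : GroupType} (hk : k.Admissible n) {φ : A →+* B} {S : Submonoid A}
    {I : Ideal A} {J : Ideal B} (h : LocLike φ S I J) {g : GL (Fin n) B[X]}
    (hg : g ∈ elemIdeal k n (Ideal.span {X} * polyIdeal J)) :
    ∃ s ∈ S, ∃ θ ∈ elemIdeal k n (Ideal.span {X} * polyIdeal I),
      Matrix.GeneralLinearGroup.map (mapRingHom φ) θ = dilate (φ s) g := by
  refine elemIdeal_induction hk (P := fun g => ∃ s ∈ S,
    ∃ θ ∈ elemIdeal k n (Ideal.span {X} * polyIdeal I),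
      Matrix.GeneralLinearGroup.map (mapRingHom φ) θ = dilate (φ s) g) ?_ ?_ ?_ hg
  · exact ⟨1, one_mem _, 1, one_mem _, by simp [dilate_def]⟩
  · rintro a b ⟨s, hs, θ, hθ, e⟩ ⟨t, ht, η, hη, e'⟩
    refine ⟨t * s, S.mul_mem ht hs, dilate t θ * dilate s η,
      mul_mem (dilate_mem t hθ) (dilate_mem s hη), ?_⟩
    rw [map_mul, map_dilate, map_dilate, e, e', dilate_dilate, dilate_dilate, dilate_mul, map_mul,
      mul_comm (φ s)]
  · intro i j hij z hz
    obtain ⟨p, hp, rfl⟩ := Ideal.mem_span_singleton_mul.mp hz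
    obtain ⟨_, ⟨s, hs, rfl⟩, q, hq, e⟩ := h.poly.clear p hp
    refine ⟨s, hs, root k i j (X * compRingHom (C s * X) q), root_mem hk hij
      (Ideal.mul_mem_mul (Ideal.mem_span_singleton_self _) (map_mem_of_mem_polyIdeal _
        (fun a ha => by simpa using C_mem_polyIdeal ha) hq)), ?_⟩
    rw [map_root hk hij, dilate_def, map_root hk hij]
    congr 1
    have e1 : mapRingHom φ (compRingHom (C s * X) q) =
        compRingHom (C (φ s) * X) (mapRingHom φ q) := by
      simp [Polynomial.map_comp]
    rw [map_mul, e1, e, map_mul, map_mul]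
    simp only [coe_mapRingHom, coe_compRingHom_apply, map_X, map_C, X_comp, C_comp]
    ring

theorem evalZero_eq_one {k : GroupType} (hk : k.Admissible n) {I : Ideal A} {θ : GL (Fin n) A[X]}
    (h : θ ∈ elemIdeal k n (Ideal.span {X} * polyIdeal I)) : evalZero θ = 1 := by
  refine eq_one_of_mem_elemIdeal_bot hk (map_mem_elemIdeal _ (fun x hx => ?_) h)
  obtain ⟨p, hp, rfl⟩ := Ideal.mem_span_singleton_mul.mp hx
  simp

/-- Constant terms agree by `h0`. In degree `m ≥ 1` dilation multiplies the difference of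
coefficients by the `m`-th power of a common annihilator of the finitely many entries. -/
theorem exists_dilate_eq {φ : A →+* B} {S : Submonoid A}
    {I : Ideal A} {J : Ideal B} (h : LocLike φ S I J) {α β : GL (Fin n) A[X]}
    (h0 : evalZero α = evalZero β) (he : Matrix.GeneralLinearGroup.map (mapRingHom φ) α =
      Matrix.GeneralLinearGroup.map (mapRingHom φ) β) :
    ∃ s ∈ S, dilate s α = dilate s β := by
  have hd (i j : Fin n) : ∃ s ∈ S, C s * (α.val i j - β.val i j) = 0 := by
    have : mapRingHom φ (α.val i j - β.val i j) = 0 := by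
      rw [map_sub, sub_eq_zero]
      exact map_apply_eq he i j
    obtain ⟨_, ⟨s, hs, rfl⟩, e⟩ := h.poly.ker _ this
    exact ⟨s, hs, e⟩
  choose s hs hs' using hd
  refine ⟨∏ i, ∏ j, s i j, prod_mem fun i _ => prod_mem fun j _ => hs i j, ?_⟩
  set t := ∏ i, ∏ j, s i j with ht
  have hdvd (i j : Fin n) : s i j ∣ t :=
    (Finset.dvd_prod_of_mem _ (Finset.mem_univ j)).trans
      (Finset.dvd_prod_of_mem (fun i => ∏ j, s i j) (Finset.mem_univ i))
  apply Units.ext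
  ext i j m
  change (compRingHom (C t * X) (α.val i j)).coeff m = (compRingHom (C t * X) (β.val i j)).coeff m
  rw [← sub_eq_zero, ← coeff_sub, ← map_sub, coe_compRingHom_apply, comp_C_mul_X_coeff]
  rcases Nat.eq_zero_or_pos m with rfl | hm
  · have : (evalRingHom 0) (α.val i j) = (evalRingHom 0) (β.val i j) :=
      map_apply_eq h0 i j
    simp only [coe_evalRingHom] at this
    rw [coeff_zero_eq_eval_zero, eval_sub, this, sub_self, zero_mul]
  · obtain ⟨c, hc⟩ := hdvd i j
    have := congrArg (fun p => coeff p m) (hs' i j)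
    simp only [coeff_C_mul, coeff_zero] at this
    obtain ⟨l, rfl⟩ := Nat.exists_eq_succ_of_ne_zero hm.ne'
    rw [pow_succ]
    nth_rewrite 2 [hc]
    linear_combination t ^ l * c * this

/-- If `α(0) = 1` and the localization of `α(X)` is a product of elementary matrices which are
trivial at `X = 0`, then so is `α(sX)` for some denominator `s`. -/
theorem exists_dilate_mem {k : GroupType} (hk : k.Admissible n) {φ : A →+* B} {S : Submonoid A}
    {I : Ideal A} {J : Ideal B} (h : LocLike φ S I J) {α : GL (Fin n) A[X]}
    (h0 : evalZero α = 1) (hα : Matrix.GeneralLinearGroup.map (mapRingHom φ) α ∈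
      elemIdeal k n (Ideal.span {X} * polyIdeal J)) :
    ∃ s ∈ S, dilate s α ∈ elemIdeal k n (Ideal.span {X} * polyIdeal I) := by
  obtain ⟨s, hs, θ, hθ, e⟩ := exists_lift hk h hα
  rw [← map_dilate] at e
  have h1 : evalZero (dilate s α) = 1 := by
    have : evalZero (dilate s α) = evalZero α := by
      unfold evalZero
      rw [dilate_def, map_map]
      exact map_poly_congr (fun a => by simp) (by simp) α
    rw [this, h0]
  obtain ⟨t, ht, e'⟩ := exists_dilate_eq h (h1.trans (evalZero_eq_one hk hθ).symm) e.symm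
  refine ⟨t * s, S.mul_mem ht hs, ?_⟩
  rw [← dilate_dilate, e']
  exact dilate_mem t hθ

end Localization

/-! ### Unimodular vectors over a local ring. -/

section LocalRing

variable {R : Type*} [CommRing R] {n : ℕ}

theorem root_mulVec_apply {k : GroupType} (hk : k.Admissible n) {i j : Fin n} (h : IsRoot k i j)
    (z : R) (v : Fin n → R) :
    ((root k i j z : Matrix (Fin n) (Fin n) R) *ᵥ v) i = v i + z * v j := by
  have hE (a b : Fin n) : ((eu a b : Matrix (Fin n) (Fin n) R) *ᵥ v) i = if i = a then v b else 0 := by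
    rw [← vecMulVec_bv, vecMulVec_mulVec, op_smul_eq_smul, single_one_dotProduct, Pi.smul_apply,
      bv_apply]
    simp
  rw [coe_root hk h]
  rcases h.cases hk with rfl | ⟨hl, hs⟩ | ⟨rfl, rfl⟩
  · rw [ge_linear, add_mulVec, one_mulVec, smul_mulVec, Pi.add_apply, Pi.smul_apply, hE]
    simp
  · rw [ge_short hl hs, sub_mulVec, add_mulVec, one_mulVec, smul_mulVec, smul_mulVec, Pi.sub_apply,
      Pi.add_apply, Pi.smul_apply, Pi.smul_apply, hE, hE]
    simp [hs]
  · rw [ge_long (hk.even (by simp)), add_mulVec, one_mulVec, smul_mulVec, Pi.add_apply,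
      Pi.smul_apply, hE]
    simp

theorem exists_isUnit_of_isRoot [IsLocalRing R] {k : GroupType} (hk : k.Admissible n)
    {i j : Fin n} (h : IsRoot k i j) {v : Fin n → R} (hj : IsUnit (v j)) :
    ∃ g ∈ elem k n R, IsUnit (((g : Matrix (Fin n) (Fin n) R) *ᵥ v) i) := by
  by_cases hi : IsUnit (v i)
  · exact ⟨1, one_mem _, by simpa using hi⟩
  · refine ⟨root k i j 1, root_mem hk h Submodule.mem_top, ?_⟩
    rw [root_mulVec_apply hk h, one_mul]
    by_contra hn
    have := (IsLocalRing.maximalIdeal R).sub_mem ((IsLocalRing.mem_maximalIdeal _).mpr hn)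
      ((IsLocalRing.mem_maximalIdeal _).mpr hi)
    rw [add_sub_cancel_left] at this
    exact (IsLocalRing.mem_maximalIdeal _).mp this hj

theorem exists_isUnit_apply [IsLocalRing R] {k : GroupType} (hk : k.Admissible n) (i : Fin n)
    {v u : Fin n → R} (huv : u ⬝ᵥ v = 1) :
    ∃ g ∈ elem k n R, IsUnit (((g : Matrix (Fin n) (Fin n) R) *ᵥ v) i) := by
  obtain ⟨j, hj⟩ : ∃ j, IsUnit (v j) := by
    by_contra! hc
    have : u ⬝ᵥ v ∈ IsLocalRing.maximalIdeal R :=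
      Ideal.sum_mem _ fun j _ => Ideal.mul_mem_left _ _ ((IsLocalRing.mem_maximalIdeal _).mpr (hc j))
    rw [huv] at this
    exact (IsLocalRing.mem_maximalIdeal _).mp this isUnit_one
  by_cases hij : i = j
  · subst hij
    exact ⟨1, one_mem _, by simpa using hj⟩
  by_cases hr : IsRoot k i j
  · exact exists_isUnit_of_isRoot hk hr hj
  · cases k with
    | linear => exact absurd hij hr
    | symplectic => exact absurd hij hr
    | orthogonal =>
      have hn := hk.even (by simp)
      have hs : i = sigma j := by
        by_contra hs
        exact hr ⟨hij, hs⟩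
      -- There is no orthogonal root from `j` to `σ j`, so the unit is moved in two steps through
      -- another pair.
      obtain ⟨m, hm⟩ := exists_notMem (s := {j, sigma j}) (n := n) (by
        obtain ⟨m, hm, rfl⟩ := hk
        exact Finset.card_le_two.trans_lt (by omega))
      simp only [Finset.mem_insert, Finset.mem_singleton, not_or] at hm
      have hA : Apart m j := hm
      have hB : Apart i m := by
        rw [hs]
        exact (hA.symm hn).sigma_left hn
      obtain ⟨g, hg, hu⟩ := exists_isUnit_of_isRoot hk hA.isRoot hj
      obtain ⟨g', hg', hu'⟩ := exists_isUnit_of_isRoot hk hB.isRoot hu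
      refine ⟨g' * g, mul_mem hg' hg, ?_⟩
      rwa [Units.val_mul, ← mulVec_mulVec]

theorem GroupType.Admissible.pos {k : GroupType} (hk : k.Admissible n) : 0 < n := by
  cases k with
  | linear => exact lt_of_lt_of_le (by norm_num) hk
  | symplectic => obtain ⟨m, hm, rfl⟩ := hk; omega
  | orthogonal => obtain ⟨m, hm, rfl⟩ := hk; omega

theorem e1_eq_bv (h : 0 < n) : e1 n R = bv ⟨0, h⟩ := by
  ext i
  simp [e1, bv_apply, Fin.ext_iff]

theorem VectorOK.bv (hn : k = .linear ∨ Even n) (i : Fin n) :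
    VectorOK k (bv i : Fin n → R) := by
  cases k with
  | linear => trivial
  | symplectic => trivial
  | orthogonal =>
    have hn : Even n := hn.resolve_left (by simp)
    change pairing .orthogonal _ _ = 0
    rw [pairing_bv_left hn (by simp), bv_apply, if_neg (sigma_ne hn i), mul_zero]

theorem exists_mulVec_eq_of_isUnit (h2 : IsUnit (2 : R)) {k : GroupType} (hk : k.Admissible n)
    {I : Ideal R} {i : Fin n} {v : Fin n → R} (hv : VectorOK k v) (hi : IsUnit (v i))
    (hI : ∀ j, j ≠ i → v j ∈ I) :
    ∃ g ∈ elemIdeal k n I, ∃ u : R, v = (g : Matrix (Fin n) (Fin n) R) *ᵥ (u • bv i) := by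
  obtain ⟨t, ht⟩ := hi.exists_left_inv
  obtain ⟨g, hg, e⟩ := exists_mem_mulVec h2 hk (hv.smul t) (i := i) (by simpa using ht)
    (fun j hj => I.mul_mem_left t (hI j hj))
  refine ⟨g, hg, v i, ?_⟩
  rw [mulVec_smul, e, smul_smul, mul_comm, ht, one_smul]

/-- Over a local ring, isotropic vectors in `Um_n(R, I)` lie in `E(n, I) u e₁` for some `u`. -/
theorem exists_mulVec_eq_of_mem_Um [IsLocalRing R] (h2 : IsUnit (2 : R)) {k : GroupType}
    (hk : k.Admissible n) {I : Ideal R} {v : Fin n → R} (hv : VectorOK k v) (hU : v ∈ Um n I) :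
    ∃ g ∈ elemIdeal k n I, ∃ u : R,
      v = (g : Matrix (Fin n) (Fin n) R) *ᵥ (u • bv ⟨0, hk.pos⟩) := by
  obtain ⟨⟨u, hu⟩, hI⟩ := hU
  -- A proper ideal can become the unit ideal in a localization. Then the congruence to `e₁` says
  -- nothing, and a unit first entry has to be created; otherwise that entry is a unit because it is
  -- 1 modulo the maximal ideal.
  by_cases ht : I = ⊤
  · subst ht
    obtain ⟨g, hg, hunit⟩ := exists_isUnit_apply hk ⟨0, hk.pos⟩ hu
    obtain ⟨g', hg', c, e⟩ := exists_mulVec_eq_of_isUnit h2 hk (I := ⊤)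
      (hv.act (elem_le_G hk hg)) hunit (fun _ _ => Submodule.mem_top)
    refine ⟨g⁻¹ * g', mul_mem (inv_mem hg) hg', c, ?_⟩
    have h1 : ((g⁻¹ : GL (Fin n) R) : Matrix (Fin n) (Fin n) R) * g.val = 1 := by simp
    rw [Units.val_mul, ← mulVec_mulVec, ← e, mulVec_mulVec, h1, one_mulVec]
  · refine exists_mulVec_eq_of_isUnit h2 hk hv ?_ ?_
    · have h0 := hI ⟨0, hk.pos⟩
      rw [e1_eq_bv hk.pos, bv_apply, if_pos rfl] at h0
      by_contra hn
      have := (IsLocalRing.maximalIdeal R).sub_mem ((IsLocalRing.mem_maximalIdeal _).mpr hn)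
        (IsLocalRing.le_maximalIdeal ht h0)
      rw [sub_sub_cancel] at this
      exact (IsLocalRing.mem_maximalIdeal _).mp this isUnit_one
    · intro j hj
      have h0 := hI j
      rwa [e1_eq_bv hk.pos, bv_apply, if_neg hj, sub_zero] at h0

/-- The scalar `u` in `v = g (u e₁)` is moved from the first argument of `M` to the second. -/
theorem exists_conj_M [IsLocalRing R] (h2 : IsUnit (2 : R)) {k : GroupType}
    (hk : k.Admissible n) {I : Ideal R} {v w : Fin n → R} (hU : v ∈ Um n I)
    (hg : GoodPair k I v w) :
    ∃ g ∈ elemIdeal k n I, ∃ w', GoodPair k I (bv ⟨0, hk.pos⟩) w' ∧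
      M k v w = (g : Matrix (Fin n) (Fin n) R) * M k (bv ⟨0, hk.pos⟩) w' *
        ((g⁻¹ : GL (Fin n) R) : Matrix (Fin n) (Fin n) R) := by
  obtain ⟨g, hgI, u, e⟩ := exists_mulVec_eq_of_mem_Um h2 hk hg.2.2.1 hU
  have hgG : g⁻¹ ∈ G k n R := inv_mem (elem_le_G hk (elemIdeal_le_elem k I hgI))
  have h1 : ((g⁻¹ : GL (Fin n) R) : Matrix (Fin n) (Fin n) R) * g.val = 1 := by simp
  have h1' : g.val * ((g⁻¹ : GL (Fin n) R) : Matrix (Fin n) (Fin n) R) = 1 := by simp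
  have hgood := hg.act hgG
  have hM := conj_M hgG v w
  have ev : ((g⁻¹ : GL (Fin n) R) : Matrix (Fin n) (Fin n) R) *ᵥ v = u • bv ⟨0, hk.pos⟩ := by
    rw [e, mulVec_mulVec, h1, one_mulVec]
  rw [ev] at hgood hM
  refine ⟨g, hgI, u • dualAct k g⁻¹ w, ⟨fun i => I.mul_mem_left _ (hgood.1 i), ?_, ?_,
    hgood.2.2.2.smul u⟩, ?_⟩
  · rw [pairing_smul_right, ← pairing_smul_left, hgood.2.1]
  · refine VectorOK.bv ?_ _
    by_cases hl : k = .linear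
    · exact Or.inl hl
    · exact Or.inr (hk.even hl)
  · rw [M_smul_right, ← M_smul_left, ← hM, inv_inv]
    calc M k v w = (g.val * (g⁻¹).val) * M k v w * (g.val * (g⁻¹).val) := by simp
      _ = _ := by simp only [Matrix.mul_assoc]

end LocalRing

/-! ### Patching of transvections. -/

section Transvections

variable {R : Type*} [CommRing R] {n : ℕ}

/-- The constants in the polynomial ring in two variables. -/
noncomputable abbrev cc : R →+* R[X][X] := (C : R[X] →+* R[X][X]).comp (C : R →+* R[X])

/-- The transvection `1 + a X ^ d Y M(v, w)` in two variables; `X` is the outer one. -/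
noncomputable def polyTransv (k : GroupType) (v w : Fin n → R) (a : R) (d : ℕ) :
    GL (Fin n) R[X][X] :=
  transv k (cc ∘ v) ((cc a * X ^ d * C X) • (cc ∘ w))

theorem cc_mem {I : Ideal R} {a : R} (h : a ∈ I) : cc a ∈ polyIdeal (polyIdeal I) :=
  C_mem_polyIdeal (C_mem_polyIdeal h)

theorem isUnit_two_map {S : Type*} [CommRing S] (h2 : IsUnit (2 : R)) (f : R →+* S) :
    IsUnit (2 : S) := map_ofNat f 2 ▸ h2.map f

theorem GoodPair.map_smul {S : Type*} [CommRing S] {k : GroupType} {I : Ideal R} {v w : Fin n → R}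
    (hg : GoodPair k I v w) (f : R →+* S) (c : S) : GoodPair k (⊤ : Ideal S) (f ∘ v) (c • (f ∘ w)) :=
  (hg.map f (J := ⊤) (by simp)).smul_right (by simp)

theorem map_transv_smul {S T : Type*} [CommRing S] [CommRing T] (h2 : IsUnit (2 : R))
    {k : GroupType} (hk : k.Admissible n) {I : Ideal R} {v w : Fin n → R} (hg : GoodPair k I v w)
    (f : R →+* S) (c : S) (p : S →+* T) :
    Matrix.GeneralLinearGroup.map p (transv k (f ∘ v) (c • (f ∘ w))) =
      transv k ((p.comp f) ∘ v) (p c • ((p.comp f) ∘ w)) := by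
  rw [map_transv (isUnit_two_map h2 f) hk (hg.map_smul f c)]
  congr 1
  ext i
  simp

/-- Specialization of the variables in `polyTransv`. -/
theorem polyTransv_specialize {T : Type*} [CommRing T] (h2 : IsUnit (2 : R)) {k : GroupType}
    (hk : k.Admissible n) {I : Ideal R} {v w : Fin n → R} (hg : GoodPair k I v w) {a : R} {d : ℕ}
    (h : polyTransv k v w a d ∈ elemIdeal k n (Ideal.span {X} * polyIdeal (polyIdeal I)))
    (f : R →+* T) {K : Ideal T} (hK : ∀ r ∈ I, f r ∈ K) (x t : T) :
    transv k (f ∘ v) ((f a * x ^ d * t) • (f ∘ w)) ∈ elemIdeal k n (Ideal.span {x} * K) := by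
  set p : R[X][X] →+* T := eval₂RingHom (eval₂RingHom f t) x with hp
  have hpc : p.comp cc = f := by
    ext r
    simp [hp]
  have hpx : p X = x := by simp [hp]
  have hpt : p (C X) = t := by simp [hp]
  have := map_mem_elemIdeal p (K' := Ideal.span {x} * K) (fun z hz => by
    obtain ⟨q, hq, rfl⟩ := Ideal.mem_span_singleton_mul.mp hz
    rw [map_mul, hpx]
    refine Ideal.mul_mem_mul (Ideal.mem_span_singleton_self _) ?_
    refine map_mem_of_mem_polyIdeal p (fun r hr => ?_) hq
    refine map_mem_of_mem_polyIdeal (p.comp C) (fun s hs => ?_) hr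
    have : p (C (C s)) = f s := RingHom.congr_fun hpc s
    simpa [this] using hK s hs) h
  rw [polyTransv, map_transv_smul h2 hk hg, hpc] at this
  have e : p (cc a * X ^ d * C X) = f a * x ^ d * t := by
    rw [map_mul, map_mul, map_pow, hpx, hpt, ← hpc]
    rfl
  rwa [e] at this

/-- After conjugation to `e₁` the transvection is elementary of level `X ^ N I`, where `N` is chosen
so that conjugating back still leaves level `X I`. One further `X` keeps the exponent positive, as
the later dilation needs a matrix that is trivial at `X = 0`. -/
theorem exists_polyTransv_mem [IsLocalRing R] (h2 : IsUnit (2 : R)) {k : GroupType}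
    (hk : k.Admissible n) {I : Ideal R} {v w : Fin n → R} (hU : v ∈ Um n I)
    (hg : GoodPair k I v w) :
    ∃ d : ℕ, polyTransv k v w 1 (d + 1) ∈
      elemIdeal k n (Ideal.span {X} * polyIdeal (polyIdeal I)) := by
  obtain ⟨g, hgI, w', hgood, e⟩ := exists_conj_M h2 hk hU hg
  have h2' := isUnit_two_map h2 (cc : R →+* R[X][X])
  have hg' : Matrix.GeneralLinearGroup.map cc g ∈ elemIdeal k n (polyIdeal (polyIdeal I)) :=
    map_mem_elemIdeal _ (fun x hx => cc_mem hx) hgI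
  obtain ⟨N, hN⟩ := exists_conj_mem h2' hk hg'
  refine ⟨N, ?_⟩
  have hbv : (cc : R →+* R[X][X]) ∘ (bv ⟨0, hk.pos⟩ : Fin n → R) = bv ⟨0, hk.pos⟩ := by
    ext1 j
    simp only [Function.comp_apply, bv_apply]
    split_ifs <;> simp
  set c : R[X][X] := cc 1 * X ^ (N + 1) * C X with hc
  have hgood' : GoodPair k (Ideal.span {X ^ N} * polyIdeal (polyIdeal I)) (bv ⟨0, hk.pos⟩)
      (c • ((cc : R →+* R[X][X]) ∘ w')) := by
    have := (hgood.map cc (J := polyIdeal (polyIdeal I)) (fun x hx => cc_mem hx)).smul_right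
      (J := Ideal.span {X ^ N} * polyIdeal (polyIdeal I)) (c := c) (fun x hx => by
        rw [hc, show (cc 1 * X ^ (N + 1) * C X : R[X][X]) * x = (X * C X) * (X ^ N * x) by
          simp; ring]
        exact Ideal.mul_mem_left _ _ (Ideal.mul_mem_mul (Ideal.mem_span_singleton_self _) hx))
    rwa [hbv] at this
  have key := hN X _ (transv_bv_mem h2' hk hgood')
  convert key using 1
  apply Units.ext
  rw [polyTransv, coe_transv h2' hk (hg.map_smul cc c), Units.val_mul, Units.val_mul,
    coe_transv h2' hk hgood', M_smul_right, M_smul_right, ← map_M, e, ← hbv, ← map_M, ← map_inv,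
    coe_map, coe_map]
  have h1 : g.val * ((g⁻¹ : GL (Fin n) R) : Matrix (Fin n) (Fin n) R) = 1 := by simp
  rw [mul_add, add_mul, mul_one, ← Matrix.map_mul, h1, Matrix.mul_smul, Matrix.smul_mul,
    Matrix.map_mul, Matrix.map_mul]
  simp

theorem Um_map {S : Type*} [CommRing S] (f : R →+* S) {I : Ideal R} {J : Ideal S}
    (h : ∀ x ∈ I, f x ∈ J) {v : Fin n → R} (hv : v ∈ Um n I) : f ∘ v ∈ Um n J := by
  obtain ⟨⟨u, hu⟩, hI⟩ := hv
  refine ⟨⟨f ∘ u, ?_⟩, fun i => ?_⟩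
  · rw [← RingHom.map_dotProduct, hu, map_one]
  · have : f (e1 n R i) = e1 n S i := by simp [e1, apply_ite f]
    rw [Function.comp_apply, ← this, ← map_sub]
    exact h _ (hI i)

/-- This is what the second variable is for: substituting `r X ^ e Y` for it multiplies the
coefficient and raises the exponent. -/
theorem polyTransv_raise (h2 : IsUnit (2 : R)) {k : GroupType}
    (hk : k.Admissible n) {I : Ideal R} {v w : Fin n → R} (hg : GoodPair k I v w) {a : R} {d : ℕ}
    (h : polyTransv k v w a d ∈ elemIdeal k n (Ideal.span {X} * polyIdeal (polyIdeal I)))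
    (r : R) (e : ℕ) : polyTransv k v w (r * a) (d + e) ∈
      elemIdeal k n (Ideal.span {X} * polyIdeal (polyIdeal I)) := by
  have := polyTransv_specialize h2 hk hg h cc (fun _ hr => cc_mem hr) X (cc r * X ^ e * C X)
  have hc : cc a * X ^ d * (cc r * X ^ e * C X) =
      (cc (r * a) * X ^ (d + e) * C X : R[X][X]) := by
    rw [map_mul]
    ring
  rwa [hc] at this

theorem polyTransv_add (h2 : IsUnit (2 : R)) {k : GroupType}
    (hk : k.Admissible n) {I : Ideal R} {v w : Fin n → R} (hg : GoodPair k I v w) (a b : R) (d : ℕ) :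
    polyTransv k v w (a + b) d = polyTransv k v w a d * polyTransv k v w b d := by
  rw [polyTransv, polyTransv, polyTransv, ← transv_smul_add (isUnit_two_map h2 cc) hk
    (hg.map cc (J := ⊤) (by simp)), map_add, add_mul, add_mul]

theorem map_polyTransv {S : Type*} [CommRing S] (h2 : IsUnit (2 : R)) {k : GroupType}
    (hk : k.Admissible n) {I : Ideal R} {v w : Fin n → R} (hg : GoodPair k I v w) (f : R →+* S)
    (d : ℕ) :
    Matrix.GeneralLinearGroup.map (mapRingHom (mapRingHom f)) (polyTransv k v w 1 d) =
      polyTransv k (f ∘ v) (f ∘ w) 1 d := by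
  rw [polyTransv, map_transv_smul h2 hk hg, polyTransv]
  have e : (mapRingHom (mapRingHom f)).comp cc = cc.comp f := by
    ext a
    simp
  have e' : mapRingHom (mapRingHom f) (cc 1 * X ^ d * C X) = cc 1 * X ^ d * C X := by
    simp
  rw [e, e']
  rfl

theorem evalZero_polyTransv (h2 : IsUnit (2 : R)) {k : GroupType}
    (hk : k.Admissible n) {I : Ideal R} {v w : Fin n → R} (hg : GoodPair k I v w) (d : ℕ) :
    evalZero (polyTransv k v w 1 (d + 1)) = 1 := by
  rw [evalZero, polyTransv, map_transv_smul h2 hk hg]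
  apply Units.ext
  rw [coe_transv (isUnit_two_map h2 C) hk (hg.map_smul _ _), M_smul_right]
  simp

theorem dilate_polyTransv (h2 : IsUnit (2 : R)) {k : GroupType}
    (hk : k.Admissible n) {I : Ideal R} {v w : Fin n → R} (hg : GoodPair k I v w) (s : R) (d : ℕ) :
    dilate (C s) (polyTransv k v w 1 d) = polyTransv k v w (s ^ d) d := by
  rw [dilate_def, polyTransv, map_transv_smul h2 hk hg, polyTransv]
  have e : (compRingHom (C (C s) * X)).comp cc = (cc : R →+* R[X][X]) := by
    ext a
    simp
  have e' : compRingHom (C (C s) * X) (cc 1 * X ^ d * C X) = (cc (s ^ d) * X ^ d * C X : R[X][X]) := by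
    simp [mul_pow]
    ring
  rw [e, e']

/-- Dilation by a denominator `s` of the local factorization changes the coefficient to `s ^ (d +
1)`, which is still outside the prime. -/
theorem exists_notMem_polyTransv_mem (h2 : IsUnit (2 : R)) {k : GroupType}
    (hk : k.Admissible n) {I : Ideal R} {v w : Fin n → R} (hU : v ∈ Um n I)
    (hg : GoodPair k I v w) (m : Ideal R) [m.IsPrime] :
    ∃ s ∉ m, ∃ d, polyTransv k v w s d ∈
      elemIdeal k n (Ideal.span {X} * polyIdeal (polyIdeal I)) := by
  have hloc := (LocLike.of_isLocalization (B := Localization.AtPrime m) m.primeCompl I).poly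
  have hmap : ∀ x ∈ I, algebraMap R (Localization.AtPrime m) x ∈
      I.map (algebraMap R (Localization.AtPrime m)) :=
    fun x hx => Ideal.mem_map_of_mem _ hx
  obtain ⟨d, hd⟩ := exists_polyTransv_mem (isUnit_two_map h2 (algebraMap R _)) hk
    (Um_map (algebraMap R _) hmap hU) (hg.map (algebraMap R _) hmap)
  rw [← map_polyTransv h2 hk hg] at hd
  obtain ⟨_, ⟨s, hs, rfl⟩, hmem⟩ := exists_dilate_mem hk hloc (evalZero_polyTransv h2 hk hg d) hd
  refine ⟨s ^ (d + 1), fun h => hs (Ideal.IsPrime.mem_of_pow_mem ‹_› _ h), d + 1, ?_⟩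
  rwa [← dilate_polyTransv h2 hk hg]

/-- For `v ∈ Um_n(R, I)` the transvection `1 + X ^ d M(v, w)` is a product of elementary matrices
with entries in `X I[X]`, for all large `d`. -/
theorem exists_transv_mem (h2 : IsUnit (2 : R)) {k : GroupType}
    (hk : k.Admissible n) {I : Ideal R} {v w : Fin n → R} (hU : v ∈ Um n I)
    (hg : GoodPair k I v w) :
    ∃ d₀ : ℕ, ∀ d ≥ d₀, transv k ((C : R →+* R[X]) ∘ v) ((X : R[X]) ^ d • (C ∘ w)) ∈
      elemIdeal k n (Ideal.span {X} * polyIdeal I) := by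
  -- The Quillen ideal of coefficients `a` that are admissible for some exponent; it is contained in
  -- no maximal ideal.
  let J : Ideal R :=
    { carrier := {a | ∃ d, polyTransv k v w a d ∈
        elemIdeal k n (Ideal.span {X} * polyIdeal (polyIdeal I))}
      zero_mem' := by
        refine ⟨0, ?_⟩
        have := polyTransv_add h2 hk hg 0 0 0
        rw [add_zero, left_eq_mul] at this
        rw [this]
        exact one_mem _
      add_mem' := by
        rintro a b ⟨d, hd⟩ ⟨e, he⟩
        refine ⟨d + e, ?_⟩
        rw [polyTransv_add h2 hk hg]
        refine mul_mem ?_ ?_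
        · simpa using polyTransv_raise h2 hk hg hd 1 e
        · rw [add_comm]
          simpa using polyTransv_raise h2 hk hg he 1 d
      smul_mem' := by
        rintro r a ⟨d, hd⟩
        exact ⟨d, polyTransv_raise h2 hk hg hd r 0⟩ }
  have hJ : J = ⊤ := by
    by_contra hne
    obtain ⟨m, hm, hle⟩ := Ideal.exists_le_maximal J hne
    have := hm.isPrime
    obtain ⟨s, hs, hmem⟩ := exists_notMem_polyTransv_mem h2 hk hU hg m
    exact hs (hle hmem)
  obtain ⟨d₀, hd₀⟩ : (1 : R) ∈ J := hJ ▸ Submodule.mem_top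
  refine ⟨d₀, fun d hd => ?_⟩
  have := polyTransv_specialize h2 hk hg hd₀ C (fun _ hr => C_mem_polyIdeal hr) X (X ^ (d - d₀))
  rwa [map_one, one_mul, ← pow_add, Nat.add_sub_cancel' hd] at this

theorem transv_mem_elemIdeal (h2 : IsUnit (2 : R)) {k : GroupType}
    (hk : k.Admissible n) {I : Ideal R} {v w : Fin n → R} (hU : v ∈ Um n I)
    (hg : GoodPair k I v w) : transv k v w ∈ elemIdeal k n I := by
  obtain ⟨d, hd⟩ := exists_transv_mem h2 hk hU hg
  have := map_mem_elemIdeal (evalRingHom (1 : R)) (K' := I) (fun x hx => by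
    obtain ⟨p, hp, rfl⟩ := Ideal.mem_span_singleton_mul.mp hx
    rw [map_mul]
    exact Ideal.mul_mem_left _ _ (map_mem_of_mem_polyIdeal _ (fun a ha => by simpa using ha) hp))
    (hd d le_rfl)
  rw [map_transv_smul h2 hk hg] at this
  convert this using 2
  · ext1 i
    simp
  · ext1 i
    simp

end Transvections

/-! ### The double of a ring along an ideal: from absolute to relative groups. -/

section Excision

variable {A : Type*} [CommRing A] {B : Type*} [CommRing B] {D : Type*} [CommRing D] {n : ℕ}

/-- On a root element the quotient has parameter `f₂ d - f₁ d ∈ I`. On a product it is a conjugate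
of one quotient times the other, and E(n, A, I) is stable under conjugation by elementary matrices.
-/
theorem map_mul_inv_mem_relE {k : GroupType} (hk : k.Admissible n) {I : Ideal A} (f₁ f₂ : D →+* A)
    (h : ∀ d, f₂ d - f₁ d ∈ I) {g : GL (Fin n) D} (hg : g ∈ elem k n D) :
    Matrix.GeneralLinearGroup.map f₂ g * (Matrix.GeneralLinearGroup.map f₁ g)⁻¹ ∈ relE k n I := by
  suffices g ∈ elem k n D ∧
      Matrix.GeneralLinearGroup.map f₂ g * (Matrix.GeneralLinearGroup.map f₁ g)⁻¹ ∈ relE k n I from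
    this.2
  refine elemIdeal_induction hk (P := fun g => g ∈ elem k n D ∧
    Matrix.GeneralLinearGroup.map f₂ g * (Matrix.GeneralLinearGroup.map f₁ g)⁻¹ ∈ relE k n I)
    ?_ ?_ ?_ hg
  · exact ⟨one_mem _, by simp⟩
  · rintro a b ⟨ha, ha'⟩ ⟨hb, hb'⟩
    refine ⟨mul_mem ha hb, ?_⟩
    rw [map_mul, map_mul]
    convert mul_mem (conj_mem_relE (map_mem_elem f₂ ha) hb') ha' using 1
    group
  · intro i j hij z hz
    refine ⟨root_mem hk hij hz, ?_⟩
    rw [map_root hk hij, map_root hk hij, root_inv hk hij, root_mul_root hk hij, ← sub_eq_add_neg]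
    exact elemIdeal_le_relE k I (root_mem hk hij (h z))

/-- Conjugating elementary matrices lift along the diagonal, and generators of E(n, I) lift through
pairs `(0, x)`. A conjugate of the latter is still trivial under `f₁`. -/
theorem exists_elem_of_mem_relE {k : GroupType} (hk : k.Admissible n) {I : Ideal A}
    (f₁ f₂ : D →+* A) (hδ : ∀ a, ∃ d, f₁ d = a ∧ f₂ d = a) (hι : ∀ x ∈ I, ∃ d, f₁ d = 0 ∧ f₂ d = x)
    {h : GL (Fin n) A} (hh : h ∈ relE k n I) :
    ∃ g ∈ elem k n D, Matrix.GeneralLinearGroup.map f₁ g = 1 ∧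
      Matrix.GeneralLinearGroup.map f₂ g = h := by
  have h1 {c : GL (Fin n) A} (hc : c ∈ elem k n A) : ∃ g ∈ elem k n D,
      Matrix.GeneralLinearGroup.map f₁ g = c ∧ Matrix.GeneralLinearGroup.map f₂ g = c := by
    refine elemIdeal_induction hk (P := fun c => ∃ g ∈ elem k n D,
      Matrix.GeneralLinearGroup.map f₁ g = c ∧ Matrix.GeneralLinearGroup.map f₂ g = c) ?_ ?_ ?_ hc
    · exact ⟨1, one_mem _, by simp, by simp⟩
    · rintro a b ⟨x, hx, rfl, hx'⟩ ⟨y, hy, rfl, hy'⟩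
      exact ⟨x * y, mul_mem hx hy, map_mul _ _ _, by rw [map_mul, hx', hy']⟩
    · intro i j hij z _
      obtain ⟨d, rfl, hd⟩ := hδ z
      exact ⟨root k i j d, root_mem hk hij Submodule.mem_top, map_root hk hij _ _,
        by rw [map_root hk hij, hd]⟩
  have h2 {c : GL (Fin n) A} (hc : c ∈ elemIdeal k n I) : ∃ g ∈ elem k n D,
      Matrix.GeneralLinearGroup.map f₁ g = 1 ∧ Matrix.GeneralLinearGroup.map f₂ g = c := by
    refine elemIdeal_induction hk (P := fun c => ∃ g ∈ elem k n D,
      Matrix.GeneralLinearGroup.map f₁ g = 1 ∧ Matrix.GeneralLinearGroup.map f₂ g = c) ?_ ?_ ?_ hc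
    · exact ⟨1, one_mem _, by simp, by simp⟩
    · rintro a b ⟨x, hx, ex, rfl⟩ ⟨y, hy, ey, rfl⟩
      exact ⟨x * y, mul_mem hx hy, by rw [map_mul, ex, ey, one_mul], map_mul _ _ _⟩
    · intro i j hij z hz
      obtain ⟨d, hd, rfl⟩ := hι z hz
      exact ⟨root k i j d, root_mem hk hij Submodule.mem_top,
        by rw [map_root hk hij, hd, root_zero], map_root hk hij _ _⟩
  have hle : relE k n I ≤ (elem k n D ⊓ (Matrix.GeneralLinearGroup.map f₁).ker).map
      (Matrix.GeneralLinearGroup.map f₂) := by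
    refine relE_le fun c hc x hx => ?_
    obtain ⟨c', hc', e1, e2⟩ := h1 hc
    obtain ⟨x', hx', e1', e2'⟩ := h2 hx
    refine ⟨c' * x' * c'⁻¹, Subgroup.mem_inf.mpr ⟨mul_mem (mul_mem hc' hx') (inv_mem hc'), ?_⟩, ?_⟩
    · rw [MonoidHom.mem_ker, map_mul, map_mul, e1', mul_one, ← map_mul,
        mul_inv_cancel, map_one]
    · rw [map_mul, map_mul, map_inv, e2, e2']
  obtain ⟨g, ⟨hg, hg'⟩, e⟩ := hle hh
  exact ⟨g, hg, hg', e⟩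

/-- The double of `A` along `I`: the pairs of elements of `A` which are congruent modulo `I`. -/
def Double (I : Ideal A) : Subring (A × A) :=
  ((Ideal.Quotient.mk I).comp (RingHom.fst A A)).eqLocus
    ((Ideal.Quotient.mk I).comp (RingHom.snd A A))

namespace Double

variable (I : Ideal A)

theorem mem_iff (x : A × A) : x ∈ Double I ↔ x.2 - x.1 ∈ I := by
  rw [← Ideal.Quotient.eq]
  exact eq_comm

/-- The first projection. -/
def p₁ : Double I →+* A := (RingHom.fst A A).comp (Double I).subtype

/-- The second projection. -/
def p₂ : Double I →+* A := (RingHom.snd A A).comp (Double I).subtype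

/-- The diagonal. -/
def diag : A →+* Double I :=
  ((RingHom.id A).prod (RingHom.id A)).codRestrict (Double I) fun x => by
    rw [mem_iff]
    simp

@[simp] theorem p₁_diag (a : A) : p₁ I (diag I a) = a := rfl

@[simp] theorem p₂_diag (a : A) : p₂ I (diag I a) = a := rfl

theorem p₂_sub_p₁ (d : Double I) : p₂ I d - p₁ I d ∈ I := (mem_iff I _).mp d.2

variable {I}

theorem ext {d d' : Double I} (h₁ : p₁ I d = p₁ I d') (h₂ : p₂ I d = p₂ I d') : d = d' :=
  Subtype.ext (Prod.ext h₁ h₂)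

/-- The element `(0, x)`. -/
def inr (x : A) (hx : x ∈ I) : Double I := ⟨(0, x), by rw [mem_iff]; simpa using hx⟩

@[simp] theorem p₁_inr (x : A) (hx : x ∈ I) : p₁ I (inr x hx) = 0 := rfl

@[simp] theorem p₂_inr (x : A) (hx : x ∈ I) : p₂ I (inr x hx) = x := rfl

theorem poly_ext {p q : (Double I)[X]} (h₁ : mapRingHom (p₁ I) p = mapRingHom (p₁ I) q)
    (h₂ : mapRingHom (p₂ I) p = mapRingHom (p₂ I) q) : p = q := by
  ext1 i
  refine ext ?_ ?_
  · simpa using congrArg (fun r => coeff r i) h₁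
  · simpa using congrArg (fun r => coeff r i) h₂

theorem exists_poly {h : A[X]} (hh : h ∈ polyIdeal I) :
    ∃ q : (Double I)[X], mapRingHom (p₁ I) q = 0 ∧ mapRingHom (p₂ I) q = h := by
  have hs : Function.Surjective (mapRingHom (p₂ I)) :=
    Polynomial.map_surjective _ fun a => ⟨diag I a, rfl⟩
  have hle : polyIdeal I ≤ (RingHom.ker (mapRingHom (p₁ I))).map (mapRingHom (p₂ I)) := by
    refine Ideal.map_le_iff_le_comap.mpr fun a ha => ?_
    have : C a = mapRingHom (p₂ I) (C (inr a ha)) := by simp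
    rw [Ideal.mem_comap, this]
    exact Ideal.mem_map_of_mem _ (by simp [RingHom.mem_ker])
  obtain ⟨q, hq, e⟩ := (Ideal.mem_map_iff_of_surjective _ hs).mp (hle hh)
  exact ⟨q, hq, e⟩

theorem exists_poly' (p : A[X]) :
    ∃ q : (Double I)[X], mapRingHom (p₁ I) q = p ∧ mapRingHom (p₂ I) q = p := by
  refine ⟨mapRingHom (diag I) p, ?_, ?_⟩
  · have : (mapRingHom (p₁ I)).comp (mapRingHom (diag I)) = RingHom.id _ := by
      ext <;> simp
    exact RingHom.congr_fun this p
  · have : (mapRingHom (p₂ I)).comp (mapRingHom (diag I)) = RingHom.id _ := by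
      ext <;> simp
    exact RingHom.congr_fun this p

end Double

theorem mem_ker_map_mk_iff {I : Ideal A} {α : GL (Fin n) A} :
    α ∈ (Matrix.GeneralLinearGroup.map (n := Fin n) (Ideal.Quotient.mk I)).ker ↔
      ∀ i j, α.val i j - (1 : Matrix (Fin n) (Fin n) A) i j ∈ I := by
  rw [MonoidHom.mem_ker, ← map_one (Matrix.GeneralLinearGroup.map (Ideal.Quotient.mk I))]
  constructor
  · intro h i j
    exact Ideal.Quotient.eq.mp (map_apply_eq h i j)
  · intro h
    apply Units.ext
    ext i j
    exact Ideal.Quotient.eq.mpr (h i j)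

theorem map_one_apply (f : A →+* B) (i j : Fin n) :
    f ((1 : Matrix (Fin n) (Fin n) A) i j) = (1 : Matrix (Fin n) (Fin n) B) i j := by
  simp [Matrix.one_apply, apply_ite f]

theorem map_mem_ker {I : Ideal A} {J : Ideal B} (f : A →+* B) (h : ∀ x ∈ I, f x ∈ J)
    {α : GL (Fin n) A}
    (hα : α ∈ (Matrix.GeneralLinearGroup.map (n := Fin n) (Ideal.Quotient.mk I)).ker) :
    Matrix.GeneralLinearGroup.map f α ∈
      (Matrix.GeneralLinearGroup.map (n := Fin n) (Ideal.Quotient.mk J)).ker := by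
  rw [mem_ker_map_mk_iff] at hα ⊢
  intro i j
  have := h _ (hα i j)
  rwa [map_sub, map_one_apply] at this

theorem Double.exists_lift {I : Ideal A} {α : GL (Fin n) A[X]}
    (hα : α ∈ (Matrix.GeneralLinearGroup.map (n := Fin n) (Ideal.Quotient.mk (polyIdeal I))).ker) :
    ∃ β : GL (Fin n) (Double I)[X],
      Matrix.GeneralLinearGroup.map (mapRingHom (Double.p₁ I)) β = 1 ∧
      Matrix.GeneralLinearGroup.map (mapRingHom (Double.p₂ I)) β = α := by
  have key {γ : GL (Fin n) A[X]} (hγ : γ ∈ (Matrix.GeneralLinearGroup.map (n := Fin n)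
      (Ideal.Quotient.mk (polyIdeal I))).ker) : ∃ N : Matrix (Fin n) (Fin n) (Double I)[X],
      N.map (mapRingHom (Double.p₁ I)) = 1 ∧ N.map (mapRingHom (Double.p₂ I)) = γ.val := by
    have := mem_ker_map_mk_iff.mp hγ
    choose q hq hq' using fun i j => Double.exists_poly (this i j)
    refine ⟨1 + Matrix.of q, ?_, ?_⟩
    · rw [Matrix.map_add _ (map_add _)]
      ext1 i j
      simp only [Matrix.add_apply, Matrix.map_apply, of_apply, hq]
      simp [Matrix.one_apply]
    · rw [Matrix.map_add _ (map_add _)]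
      ext1 i j
      simp only [Matrix.add_apply, Matrix.map_apply, of_apply, hq']
      have : (mapRingHom (Double.p₂ I)) ((1 : Matrix (Fin n) (Fin n) (Double I)[X]) i j) =
          (1 : Matrix (Fin n) (Fin n) A[X]) i j := by
        simp [Matrix.one_apply]
      rw [this, add_sub_cancel]
  obtain ⟨N, hN, hN'⟩ := key hα
  obtain ⟨N', hM, hM'⟩ := key (inv_mem hα)
  have hmul : N * N' = 1 := by
    have e1 : (N * N').map (mapRingHom (Double.p₁ I)) = 1 := by
      rw [Matrix.map_mul, hN, hM, mul_one]
    have e2 : (N * N').map (mapRingHom (Double.p₂ I)) = 1 := by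
      rw [Matrix.map_mul, hN', hM', ← Units.val_mul, mul_inv_cancel, Units.val_one]
    ext1 i j
    refine Double.poly_ext ?_ ?_
    · have := congrFun (congrFun e1 i) j
      rw [Matrix.map_apply] at this
      rw [this]
      simp [Matrix.one_apply]
    · have := congrFun (congrFun e2 i) j
      rw [Matrix.map_apply] at this
      rw [this]
      simp [Matrix.one_apply]
  exact ⟨⟨N, N', hmul, mul_eq_one_comm.mp hmul⟩, Units.ext hN, Units.ext hN'⟩

/-- Over the double, the pair of `(v, v)` and `(0, w)` falls under the absolute case, where
congruence to `e₁` is vacuous. The first projection of the resulting elementary matrix is 1 and the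
second is the given transvection. -/
theorem transv_mem_relE (h2 : IsUnit (2 : A)) {k : GroupType} (hk : k.Admissible n) {I : Ideal A}
    {v u w : Fin n → A} (hu : u ⬝ᵥ v = 1) (hg : GoodPair k I v w) :
    transv k v w ∈ relE k n I := by
  set v' : Fin n → Double I := Double.diag I ∘ v
  set w' : Fin n → Double I := fun i => Double.inr (w i) (hg.1 i)
  have e1 : Double.p₁ I ∘ w' = 0 := rfl
  have e2 : Double.p₂ I ∘ w' = w := rfl
  have e3 : Double.p₁ I ∘ v' = v := rfl
  have e4 : Double.p₂ I ∘ v' = v := rfl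
  have h0 : pairing k v 0 = 0 := by simp [pairing_eq]
  have h0' : VectorOK k (0 : Fin n → A) := by
    cases k with
    | linear => trivial
    | symplectic => trivial
    | orthogonal =>
      change pairing .orthogonal _ _ = 0
      simp [pairing_eq]
  have hg' : GoodPair k ⊤ v' w' := by
    refine ⟨fun _ => Submodule.mem_top, ?_, hg.2.2.1.map _, ?_⟩
    · refine Double.ext ?_ ?_
      · rw [← map_pairing, e1, e3, h0, map_zero]
      · rw [← map_pairing, e2, e4, hg.2.1, map_zero]
    · have hw := hg.2.2.2
      cases k with
      | linear => trivial
      | symplectic => trivial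
      | orthogonal =>
        change pairing .orthogonal _ _ = 0
        refine Double.ext ?_ ?_
        · rw [← map_pairing, e1, map_zero]
          exact h0'
        · rw [← map_pairing, e2, map_zero]
          exact hw
  have hU : v' ∈ Um n (⊤ : Ideal (Double I)) :=
    ⟨⟨Double.diag I ∘ u, by rw [← RingHom.map_dotProduct, hu, map_one]⟩,
      fun _ => Submodule.mem_top⟩
  have h2' := isUnit_two_map h2 (Double.diag I)
  have := map_mul_inv_mem_relE hk (Double.p₁ I) (Double.p₂ I) (Double.p₂_sub_p₁ I)
    (transv_mem_elemIdeal h2' hk hU hg')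
  rw [map_transv h2' hk hg', map_transv h2' hk hg', e1, e2, e3, e4] at this
  have e0 : transv k v 0 = 1 := by
    apply Units.ext
    rw [coe_transv h2 hk (I := ⊤) ⟨fun _ => Submodule.mem_top, h0, hg.2.2.1, h0'⟩, M_zero_right,
      add_zero, Units.val_one]
  rwa [e0, inv_one, mul_one] at this

end Excision

/-! ### Normality of the relative elementary group. -/

section Normality

variable {R : Type*} [CommRing R] {n : ℕ}

theorem root_eq_transv (h2 : IsUnit (2 : R)) {k : GroupType} (hk : k.Admissible n) {I : Ideal R}
    {i j : Fin n} (h : IsRoot k i j) {z : R} (hz : z ∈ I) :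
    ∃ w, GoodPair k I (bv i) w ∧ root k i j z = transv k (bv i) w := by
  have hmem (l : Fin n) {c : R} (hc : c ∈ I) (m : Fin n) : (c • (bv l : Fin n → R)) m ∈ I :=
    I.mul_mem_right _ hc
  rcases h.cases hk with rfl | ⟨hl, hs⟩ | ⟨rfl, rfl⟩
  · have hg : GoodPair .linear I (bv i) (z • bv j) := by
      refine ⟨hmem j hz, ?_, trivial, trivial⟩
      rw [pairing_linear_bv, Pi.smul_apply, bv_apply, if_neg h.ne, smul_zero]
    refine ⟨_, hg, Units.ext ?_⟩
    rw [coe_transv h2 hk hg, coe_root hk h, ge_linear, M_linear, vecMulVec_smul, vecMulVec_bv]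
  · have hn := hk.even hl
    have hA : Apart i (sigma j) := Apart.sigma_right hn ⟨h.ne, hs⟩
    have hz' : sgn k R (sigma j) * z ∈ I := I.mul_mem_left _ hz
    have hg : GoodPair k I (bv i) ((sgn k R (sigma j) * z) • bv (sigma j)) := by
      refine ⟨hmem _ hz', ?_, VectorOK.bv (Or.inr hn) i, (VectorOK.bv (Or.inr hn) _).smul _⟩
      rw [pairing_smul_right, pairing_bv_left hn hl, bv_apply, if_neg, mul_zero, mul_zero]
      rw [sigma_inj hn]
      exact h.ne
    refine ⟨_, hg, Units.ext ?_⟩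
    rw [coe_transv h2 hk hg, M_smul_right, ← coe_root_eq_M hk hl hA, sigma_sigma hn, ← mul_assoc,
      sgn_mul_self, one_mul]
  · have hl : GroupType.symplectic ≠ .linear := by simp
    have hn := hk.even hl
    -- `M(e_i, e_i)` is twice the long root matrix, hence the factor one half in the second vector.
    obtain ⟨t, ht⟩ := h2.exists_left_inv
    have hz' : t * (sgn .symplectic R i * z) ∈ I := I.mul_mem_left _ (I.mul_mem_left _ hz)
    have hg : GoodPair .symplectic I (bv i) ((t * (sgn .symplectic R i * z)) • bv i) := by
      refine ⟨hmem _ hz', ?_, trivial, trivial⟩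
      rw [pairing_smul_right, pairing_bv_left hn hl, bv_apply, if_neg (sigma_ne hn i), mul_zero,
        mul_zero]
    refine ⟨_, hg, Units.ext ?_⟩
    have e : z = sgn .symplectic R i * (sgn .symplectic R i * z) := by
      rw [← mul_assoc, sgn_mul_self, one_mul]
    rw [coe_transv h2 hk hg, M_smul_right]
    conv_lhs => rw [e]
    rw [coe_root_long_eq hk, M_of_ne hl]
    simp only [kappa]
    linear_combination (norm := module) (-(sgn .symplectic R i * z) * ht) •
      vecMulVec (bv i) (tilde .symplectic (bv i : Fin n → R))

theorem conj_mem_relE_of_mem_G (h2 : IsUnit (2 : R)) {k : GroupType} (hk : k.Admissible n)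
    {I : Ideal R} {g x : GL (Fin n) R} (hg : g ∈ G k n R) (hx : x ∈ relE k n I) :
    g * x * g⁻¹ ∈ relE k n I := by
  have key {g x : GL (Fin n) R} (hg : g ∈ G k n R) (hx : x ∈ elemIdeal k n I) :
      g * x * g⁻¹ ∈ relE k n I := by
    refine elemIdeal_conj_le hk (fun i j hij z hz => ?_) hx
    obtain ⟨w, hgood, e⟩ := root_eq_transv h2 hk hij hz
    rw [e, conj_transv h2 hk hg hgood]
    refine transv_mem_relE h2 hk (u := bv i ᵥ* (g⁻¹).val) ?_ (hgood.act hg)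
    have h1 : ((g⁻¹ : GL (Fin n) R) : Matrix (Fin n) (Fin n) R) * g.val = 1 := by simp
    rw [← dotProduct_mulVec, mulVec_mulVec, h1, one_mulVec]
    simp
  -- The conjugator coming from the normal closure is itself in `G(n, R)` and is absorbed into `g`.
  have hle : relE k n I ≤ (relE k n I).comap (MulAut.conj g).toMonoidHom := by
    refine relE_le fun c hc y hy => ?_
    have := key (mul_mem hg (elem_le_G hk hc)) hy
    rw [Subgroup.mem_comap]
    convert this using 1
    simp [mul_assoc]
  exact hle hx

theorem relE_le_G {k : GroupType} (hk : k.Admissible n) (I : Ideal R) : relE k n I ≤ G k n R :=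
  (Subgroup.map_subtype_le _).trans (elem_le_G hk)

theorem normality (h2 : IsUnit (2 : R)) {k : GroupType} (hk : k.Admissible n) (I : Ideal R) :
    Normality k n I :=
  ⟨relE_le_G hk I, ⟨fun _ hx g => conj_mem_relE_of_mem_G h2 hk g.2 hx⟩⟩

end Normality

/-! ### The dilation principle, absolute and relative. -/

section Dilation

variable {A : Type*} [CommRing A] {B : Type*} [CommRing B] {n : ℕ}

theorem map_map_poly_congr {B' D : Type*} [CommRing B'] [CommRing D] {f : A[X] →+* B}
    {g : B →+* D} {f' : A[X] →+* B'} {g' : B' →+* D} (hC : ∀ a, g (f (C a)) = g' (f' (C a)))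
    (hX : g (f X) = g' (f' X)) (α : GL (Fin n) A[X]) :
    Matrix.GeneralLinearGroup.map g (Matrix.GeneralLinearGroup.map f α) =
      Matrix.GeneralLinearGroup.map g' (Matrix.GeneralLinearGroup.map f' α) := by
  rw [map_map, map_map]
  exact map_poly_congr hC hX α

theorem evalZero_map (φ : A →+* B) (α : GL (Fin n) A[X]) :
    evalZero (Matrix.GeneralLinearGroup.map (mapRingHom φ) α) =
      Matrix.GeneralLinearGroup.map φ (evalZero α) :=
  map_map_poly_congr (fun a => by simp) (by simp) α

/-- The substitution `X ↦ Z ^ N X`, where `Z` is the new, outer variable. -/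
noncomputable def powSubst (A : Type*) [CommRing A] (N : ℕ) : A[X] →+* A[X][X] :=
  eval₂RingHom cc (X ^ N * C X)

@[simp] theorem powSubst_C (N : ℕ) (a : A) : powSubst A N (C a) = C (C a) := by
  simp [powSubst]

@[simp] theorem powSubst_X (N : ℕ) : powSubst A N X = X ^ N * C X := by
  simp [powSubst]

/-- The nonconstant part of every entry becomes divisible by a high power of `Z`. On a product, the
second quotient is conjugated by the constant matrix `a(0)`, which `exists_conj_mem` permits at the
cost of a larger power. -/
theorem powSubst_mem (h2 : IsUnit (2 : A)) {k : GroupType} (hk : k.Admissible n)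
    {g : GL (Fin n) A[X]} (hg : g ∈ elem k n A[X]) (m : ℕ) :
    ∃ N₀, ∀ N ≥ N₀, Matrix.GeneralLinearGroup.map (powSubst A N) g *
      (Matrix.GeneralLinearGroup.map cc (evalZero g))⁻¹ ∈
        elemIdeal k n (Ideal.span {X ^ m} * ⊤) := by
  suffices g ∈ elem k n A[X] ∧ ∀ m, ∃ N₀, ∀ N ≥ N₀, Matrix.GeneralLinearGroup.map (powSubst A N) g *
      (Matrix.GeneralLinearGroup.map cc (evalZero g))⁻¹ ∈
        elemIdeal k n (Ideal.span {X ^ m} * ⊤) from this.2 m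
  refine elemIdeal_induction hk (P := fun g => g ∈ elem k n A[X] ∧ ∀ m, ∃ N₀, ∀ N ≥ N₀,
    Matrix.GeneralLinearGroup.map (powSubst A N) g *
      (Matrix.GeneralLinearGroup.map cc (evalZero g))⁻¹ ∈
        elemIdeal k n (Ideal.span {X ^ m} * ⊤)) ?_ ?_ ?_ hg
  · refine ⟨one_mem _, fun m => ⟨0, fun N _ => ?_⟩⟩
    simp [evalZero]
  · rintro a b ⟨ha, ha'⟩ ⟨hb, hb'⟩
    refine ⟨mul_mem ha hb, fun m => ?_⟩
    have h0 : Matrix.GeneralLinearGroup.map (cc : A →+* A[X][X]) (evalZero a) ∈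
        elemIdeal k n (⊤ : Ideal A[X][X]) := map_mem_elem cc (map_mem_elem _ ha)
    obtain ⟨L, hL⟩ := exists_conj_mem (isUnit_two_map h2 cc) hk h0
    obtain ⟨N₁, h₁⟩ := ha' m
    obtain ⟨N₂, h₂⟩ := hb' (m * L)
    refine ⟨max N₁ N₂, fun N hN => ?_⟩
    have q₁ := h₁ N ((le_max_left _ _).trans hN)
    have q₂ := h₂ N ((le_max_right _ _).trans hN)
    rw [pow_mul] at q₂
    convert mul_mem q₁ (hL _ _ q₂) using 1
    simp only [evalZero, map_mul]
    group
  · intro i j hij z _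
    refine ⟨root_mem hk hij Submodule.mem_top, fun m => ⟨m, fun N hN => ?_⟩⟩
    rw [evalZero, map_root hk hij, map_root hk hij, map_root hk hij, root_inv hk hij,
      root_mul_root hk hij]
    refine root_mem hk hij ?_
    have e : powSubst A N z + -cc (evalRingHom 0 z) =
        X ^ m * (X ^ (N - m) * C X * powSubst A N (divX z)) := by
      conv_lhs => rw [← divX_mul_X_add z]
      obtain ⟨l, rfl⟩ := Nat.exists_eq_add_of_le hN
      simp only [map_add, map_mul, powSubst_X, powSubst_C, Nat.add_sub_cancel_left]
      simp
      ring
    rw [e]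
    exact Ideal.mul_mem_mul (Ideal.mem_span_singleton_self _) Submodule.mem_top

/-- The dilation principle for the full elementary group. -/
theorem exists_dilate_mem_elem (h2 : IsUnit (2 : A)) {k : GroupType} (hk : k.Admissible n)
    {φ : A →+* B} {S : Submonoid A} (h : LocLike φ S ⊤ ⊤) {α : GL (Fin n) A[X]}
    (h0 : evalZero α = 1)
    (hα : Matrix.GeneralLinearGroup.map (mapRingHom φ) α ∈ elem k n B[X]) :
    ∃ s ∈ S, ∀ r, dilate (r * s) α ∈ elem k n A[X] := by
  obtain ⟨N₀, hN₀⟩ := powSubst_mem (isUnit_two_map h2 φ) hk hα 1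
  -- A positive exponent makes `Z = 0` specialize `α(Z ^ N X)` to `α(0) = 1`.
  have hN := hN₀ (N₀ + 1) (Nat.le_succ _)
  set N := N₀ + 1 with hNdef
  set β := Matrix.GeneralLinearGroup.map (powSubst A N) α with hβ
  have e1 : evalZero (Matrix.GeneralLinearGroup.map (mapRingHom φ) α) = 1 := by
    rw [evalZero_map, h0, map_one]
  have e2 : Matrix.GeneralLinearGroup.map (powSubst B N)
      (Matrix.GeneralLinearGroup.map (mapRingHom φ) α) =
      Matrix.GeneralLinearGroup.map (mapRingHom (mapRingHom φ)) β :=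
    map_map_poly_congr (fun a => by simp) (by simp) α
  rw [e1, map_one, inv_one, mul_one, e2, pow_one] at hN
  have e3 : evalZero β = 1 := by
    have : evalZero β = Matrix.GeneralLinearGroup.map C (evalZero α) :=
      map_map_poly_congr (fun a => by simp) (by simp [hNdef]) α
    rw [this, h0, map_one]
  obtain ⟨_, ⟨s, hs, rfl⟩, hmem⟩ := exists_dilate_mem hk h.poly e3
    (by rwa [polyIdeal_top, polyIdeal_top])
  refine ⟨s ^ N, S.pow_mem hs N, fun r => ?_⟩
  -- Setting `Z = 1` after the dilation `Z ↦ sZ` turns `α(Z ^ N X)` into `α(s ^ N X)`; then `X` is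
  -- replaced by `rX`.
  have := map_mem_elem (compRingHom (C r * X)) (map_mem_elem (evalRingHom (1 : A[X]))
    (elemIdeal_le_elem _ _ hmem))
  convert this using 1
  rw [dilate_def, dilate_def, hβ, map_map, map_map, map_map]
  refine map_poly_congr (fun a => by simp) ?_ α
  simp [mul_pow]
  ring

theorem LocLike.double {φ : A →+* B} {S : Submonoid A} {I : Ideal A} {J : Ideal B}
    (h : LocLike φ S I J) (ht : LocLike φ S ⊤ ⊤) {Φ : Double I →+* Double J}
    (h₁ : ∀ d, Double.p₁ J (Φ d) = φ (Double.p₁ I d))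
    (h₂ : ∀ d, Double.p₂ J (Φ d) = φ (Double.p₂ I d)) :
    LocLike Φ (S.map (Double.diag I)) ⊤ ⊤ where
  clear z _ := by
    obtain ⟨s, hs, a, -, ea⟩ := ht.clear (Double.p₁ J z) Submodule.mem_top
    obtain ⟨t, ht, x, hx, ex⟩ := h.clear _ (Double.p₂_sub_p₁ J z)
    refine ⟨_, ⟨t * s, S.mul_mem ht hs, rfl⟩,
      Double.diag I (t * a) + Double.inr (s * x) (I.mul_mem_left _ hx), Submodule.mem_top,
      Double.ext ?_ ?_⟩
    · simp only [map_mul, map_add, h₁, Double.p₁_diag, Double.p₁_inr, ea, map_zero]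
      ring
    · simp only [map_mul, map_add, h₂, Double.p₂_diag, Double.p₂_inr, ea, ex]
      ring
  ker d hd := by
    obtain ⟨s, hs, es⟩ := h.ker (Double.p₁ I d) (by rw [← h₁, hd, map_zero])
    obtain ⟨t, ht, et⟩ := h.ker (Double.p₂ I d) (by rw [← h₂, hd, map_zero])
    refine ⟨_, ⟨s * t, S.mul_mem hs ht, rfl⟩, Double.ext ?_ ?_⟩
    · rw [map_mul, Double.p₁_diag, map_zero]
      linear_combination t * es
    · rw [map_mul, Double.p₂_diag, map_zero]
      linear_combination s * et

/-- The homomorphism of doubles induced by a homomorphism. -/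
def Double.map {I : Ideal A} {J : Ideal B} (φ : A →+* B) (h : ∀ x ∈ I, φ x ∈ J) :
    Double I →+* Double J :=
  ((φ.comp (Double.p₁ I)).prod (φ.comp (Double.p₂ I))).codRestrict (Double J) fun d => by
    rw [Double.mem_iff]
    have := h _ (Double.p₂_sub_p₁ I d)
    rwa [map_sub] at this

theorem Double.map_poly_eq_of {I : Ideal A} {α β : GL (Fin n) (Double I)[X]}
    (h₁ : Matrix.GeneralLinearGroup.map (mapRingHom (Double.p₁ I)) α =
      Matrix.GeneralLinearGroup.map (mapRingHom (Double.p₁ I)) β)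
    (h₂ : Matrix.GeneralLinearGroup.map (mapRingHom (Double.p₂ I)) α =
      Matrix.GeneralLinearGroup.map (mapRingHom (Double.p₂ I)) β) : α = β := by
  apply Units.ext
  ext1 i j
  exact Double.poly_ext (map_apply_eq h₁ i j) (map_apply_eq h₂ i j)

/-- The dilation principle for the relative elementary group. -/
theorem exists_dilate_mem_relE (h2 : IsUnit (2 : A)) {k : GroupType} (hk : k.Admissible n)
    {φ : A →+* B} {S : Submonoid A} {I : Ideal A} {J : Ideal B} (h : LocLike φ S I J)
    (ht : LocLike φ S ⊤ ⊤) (hIJ : ∀ x ∈ I, φ x ∈ J) {α : GL (Fin n) A[X]}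
    (hαI : α ∈ (Matrix.GeneralLinearGroup.map (n := Fin n)
      (Ideal.Quotient.mk (polyIdeal I))).ker)
    (h0 : evalZero α = 1)
    (hα : Matrix.GeneralLinearGroup.map (mapRingHom φ) α ∈ relE k n (polyIdeal J)) :
    ∃ s ∈ S, ∀ r, dilate (r * s) α ∈ relE k n (polyIdeal I) := by
  obtain ⟨β, hβ₁, hβ₂⟩ := Double.exists_lift hαI
  set Φ := Double.map φ hIJ
  have hΦ := h.double ht (Φ := Φ) (fun _ => rfl) (fun _ => rfl)
  have hβ0 : evalZero β = 1 := by
    apply Units.ext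
    ext1 i j
    refine Double.ext ?_ ?_
    · have : Matrix.GeneralLinearGroup.map (Double.p₁ I) (evalZero β) =
          Matrix.GeneralLinearGroup.map (Double.p₁ I) 1 := by
        rw [← evalZero_map, hβ₁, evalZero, map_one, map_one]
      exact map_apply_eq this i j
    · have : Matrix.GeneralLinearGroup.map (Double.p₂ I) (evalZero β) =
          Matrix.GeneralLinearGroup.map (Double.p₂ I) 1 := by
        rw [← evalZero_map, hβ₂, h0, map_one]
      exact map_apply_eq this i j
  obtain ⟨g, hg, hg₁, hg₂⟩ := exists_elem_of_mem_relE hk (mapRingHom (Double.p₁ J))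
    (mapRingHom (Double.p₂ J)) Double.exists_poly' (fun _ hx => Double.exists_poly hx) hα
  -- The two projections of the double are jointly injective, so the elementary lift of the
  -- localized matrix is the localization of the lift `β`.
  have hgβ : g = Matrix.GeneralLinearGroup.map (mapRingHom Φ) β := by
    refine Double.map_poly_eq_of ?_ ?_
    · have e : Matrix.GeneralLinearGroup.map (mapRingHom (Double.p₁ J))
          (Matrix.GeneralLinearGroup.map (mapRingHom Φ) β) =
          Matrix.GeneralLinearGroup.map (mapRingHom φ)
            (Matrix.GeneralLinearGroup.map (mapRingHom (Double.p₁ I)) β) :=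
        map_map_poly_congr (fun a => by simp; rfl) (by simp) β
      rw [e, hβ₁, hg₁, map_one]
    · have e : Matrix.GeneralLinearGroup.map (mapRingHom (Double.p₂ J))
          (Matrix.GeneralLinearGroup.map (mapRingHom Φ) β) =
          Matrix.GeneralLinearGroup.map (mapRingHom φ)
            (Matrix.GeneralLinearGroup.map (mapRingHom (Double.p₂ I)) β) :=
        map_map_poly_congr (fun a => by simp; rfl) (by simp) β
      rw [e, hβ₂, hg₂]
  obtain ⟨_, ⟨s, hs, rfl⟩, hmem⟩ := exists_dilate_mem_elem (isUnit_two_map h2 (Double.diag I)) hk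
    hΦ hβ0 (hgβ ▸ hg)
  refine ⟨s, hs, fun r => ?_⟩
  have := map_mul_inv_mem_relE hk (mapRingHom (Double.p₁ I)) (mapRingHom (Double.p₂ I))
    (I := polyIdeal I) (fun d => by
      rw [mem_polyIdeal]
      intro i
      simpa using Double.p₂_sub_p₁ I (d.coeff i)) (hmem (Double.diag I r))
  rw [map_dilate, map_dilate, hβ₁, hβ₂, dilate_def _ 1, map_one, inv_one, mul_one, map_mul,
    Double.p₂_diag, Double.p₂_diag] at this
  exact this

theorem polyIdealExt_eq {R : Type*} [CommRing R] (I : Ideal R) (S : Type*) [CommRing S]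
    [Algebra R S] : polyIdealExt I S = polyIdeal (I.map (algebraMap R S)) := by
  rw [polyIdealExt, polyIdeal, polyIdeal, Ideal.map_map, Ideal.map_map]
  congr 1
  ext a
  simp

theorem locLike_top_of_isLocalization {R S : Type*} [CommRing R] [CommRing S] [Algebra R S]
    (T : Submonoid R) [IsLocalization T S] : LocLike (algebraMap R S) T ⊤ ⊤ := by
  have := LocLike.of_isLocalization (B := S) T ⊤
  rwa [Ideal.map_top] at this

theorem dilation {R : Type*} [CommRing R] (h2 : IsUnit (2 : R)) {k : GroupType}
    (hk : k.Admissible n) (I : Ideal R) : Dilation k n I := by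
  intro α hα h0 s _ hs
  rw [polyIdealExt_eq] at hs
  obtain ⟨_, ⟨l₀, rfl⟩, h⟩ := exists_dilate_mem_relE h2 hk
    (LocLike.of_isLocalization (B := Localization.Away s) (Submonoid.powers s) I)
    (locLike_top_of_isLocalization (Submonoid.powers s))
    (fun _ hx => Ideal.mem_map_of_mem _ hx) hα.2 h0 hs
  refine ⟨l₀, fun l hl b hb => ?_⟩
  obtain ⟨r, rfl⟩ := Ideal.mem_span_singleton'.mp hb
  have := h (r * s ^ (l - l₀))
  simp only at this
  rwa [mul_assoc, ← pow_add, Nat.sub_add_cancel hl] at this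

end Dilation

/-! ### The local-global principle. -/

section LocalGlobal

variable {R : Type*} [CommRing R] {n : ℕ}

/-- The substitution `X ↦ X + T`, where `T` is the inner variable. -/
noncomputable def shiftSubst (R : Type*) [CommRing R] : R[X] →+* R[X][X] :=
  eval₂RingHom cc (X + C X)

/-- The substitution `X ↦ T`, where `T` is the inner variable. -/
noncomputable def innerSubst (R : Type*) [CommRing R] : R[X] →+* R[X][X] :=
  eval₂RingHom cc (C X)

theorem substitution_mem {I : Ideal R} (x : R[X][X]) {p : R[X]} (hp : p ∈ polyIdeal I) :
    eval₂RingHom cc x p ∈ polyIdeal (polyIdeal I) :=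
  map_mem_of_mem_polyIdeal _ (fun a ha => by simpa using cc_mem ha) hp

/-- The matrix `α(X + T) α(T)⁻¹`. -/
noncomputable def shiftQuot (α : GL (Fin n) R[X]) : GL (Fin n) R[X][X] :=
  Matrix.GeneralLinearGroup.map (shiftSubst R) α *
    (Matrix.GeneralLinearGroup.map (innerSubst R) α)⁻¹

/-- `shiftQuot α` is trivial at `X = 0`, so dilation applies to it over `R[T]`, with denominators
from R. The specialization `T = cX` then gives the quotient of two dilations of `α`. -/
theorem exists_notMem_dilate_mem (h2 : IsUnit (2 : R)) {k : GroupType} (hk : k.Admissible n)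
    {I : Ideal R} {α : GL (Fin n) R[X]}
    (hα : α ∈ (Matrix.GeneralLinearGroup.map (n := Fin n)
      (Ideal.Quotient.mk (polyIdeal I))).ker) (m : Ideal R) [m.IsPrime]
    (hm : baseChange (Localization.AtPrime m) α ∈
      relE k n (polyIdealExt I (Localization.AtPrime m))) :
    ∃ s ∉ m, ∀ r c, dilate (c + r * s) α * (dilate c α)⁻¹ ∈ relE k n (polyIdeal I) := by
  set L := Localization.AtPrime m
  set ψ := algebraMap R L
  rw [polyIdealExt_eq] at hm
  have hloc := (LocLike.of_isLocalization (B := L) m.primeCompl I).poly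
  have hloc' := (locLike_top_of_isLocalization (S := L) m.primeCompl).poly
  rw [polyIdeal_top, polyIdeal_top] at hloc'
  have hγ : shiftQuot α ∈ (Matrix.GeneralLinearGroup.map (n := Fin n)
      (Ideal.Quotient.mk (polyIdeal (polyIdeal I)))).ker :=
    mul_mem (map_mem_ker _ (fun _ hp => substitution_mem _ hp) hα)
      (inv_mem (map_mem_ker _ (fun _ hp => substitution_mem _ hp) hα))
  have hγ0 : evalZero (shiftQuot α) = 1 := by
    rw [shiftQuot, evalZero, map_mul, map_inv, mul_inv_eq_one]
    exact map_map_poly_congr (fun a => by simp [shiftSubst, innerSubst])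
      (by simp [shiftSubst, innerSubst]) α
  have hγm : Matrix.GeneralLinearGroup.map (mapRingHom (mapRingHom ψ)) (shiftQuot α) ∈
      relE k n (polyIdeal (polyIdeal (I.map ψ))) := by
    have e : Matrix.GeneralLinearGroup.map (mapRingHom (mapRingHom ψ)) (shiftQuot α) =
        shiftQuot (baseChange L α) := by
      rw [shiftQuot, shiftQuot, map_mul, map_inv]
      congr 1
      · exact map_map_poly_congr (fun a => by simp [shiftSubst, ψ]) (by simp [shiftSubst]) α
      · congr 1
        exact map_map_poly_congr (fun a => by simp [innerSubst, ψ]) (by simp [innerSubst]) α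
    rw [e]
    exact mul_mem (map_mem_relE _ (fun _ hp => substitution_mem _ hp) hm)
      (inv_mem (map_mem_relE _ (fun _ hp => substitution_mem _ hp) hm))
  obtain ⟨_, ⟨s, hs, rfl⟩, h⟩ := exists_dilate_mem_relE (isUnit_two_map h2 C) hk hloc hloc'
    (fun _ hp => map_mem_of_mem_polyIdeal _ (fun a ha => by
      simpa using C_mem_polyIdeal (Ideal.mem_map_of_mem ψ ha)) hp) hγ hγ0 hγm
  refine ⟨s, hs, fun r c => ?_⟩
  set p : R[X][X] →+* R[X] := eval₂RingHom (eval₂RingHom C (C c * X)) X with hp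
  have hpI : ∀ q ∈ polyIdeal (polyIdeal I), p q ∈ polyIdeal I := by
    intro q hq
    refine map_mem_of_mem_polyIdeal p (fun f hf => ?_) hq
    refine map_mem_of_mem_polyIdeal (p.comp C) (fun a ha => ?_) hf
    simpa [hp] using C_mem_polyIdeal ha
  have := map_mem_relE p hpI (h (C r))
  convert this using 1
  rw [shiftQuot, dilate_mul, map_mul]
  congr 1
  · rw [dilate_def, dilate_def, map_map, map_map]
    refine map_poly_congr (fun a => by simp [hp, shiftSubst]) ?_ α
    simp [hp, shiftSubst]
    ring
  · have e : dilate (C r * C s) (Matrix.GeneralLinearGroup.map (innerSubst R) α)⁻¹ =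
        (dilate (C r * C s) (Matrix.GeneralLinearGroup.map (innerSubst R) α))⁻¹ := map_inv _ _
    rw [e, map_inv, dilate_def, dilate_def, map_map, map_map]
    congr 1
    exact map_poly_congr (fun a => by simp [hp, innerSubst]) (by simp [hp, innerSubst]) α

theorem localGlobal (h2 : IsUnit (2 : R)) {k : GroupType} (hk : k.Admissible n) (I : Ideal R) :
    LocalGlobal k n I := by
  intro α hα h0 hm
  -- Quantifying over all base points `c` makes the quotients telescope, which gives closure under
  -- addition. The element `1 ∈ J` is then used with `c = 0`.
  let J : Ideal R :=
    { carrier := {b | ∀ r c, dilate (c + r * b) α * (dilate c α)⁻¹ ∈ relE k n (polyIdeal I)}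
      zero_mem' := fun r c => by simp
      add_mem' := by
        intro a b ha hb r c
        convert mul_mem (hb r (c + r * a)) (ha r c) using 1
        rw [mul_add, add_assoc]
        group
      smul_mem' := by
        intro t b hb r c
        have := hb (r * t) c
        rwa [mul_assoc] at this }
  have hJ : J = ⊤ := by
    by_contra hne
    obtain ⟨m, hmax, hle⟩ := Ideal.exists_le_maximal J hne
    have := hmax.isPrime
    obtain ⟨s, hs, h⟩ := exists_notMem_dilate_mem h2 hk hα.2 m (hm m)
    exact hs (hle h)
  have h1 : (1 : R) ∈ J := hJ ▸ Submodule.mem_top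
  have := h1 1 0
  have e1 : dilate (0 + 1 * 1) α = α := by
    have : dilate (0 + 1 * 1) α = Matrix.GeneralLinearGroup.map (RingHom.id _) α := by
      rw [dilate_def]
      exact map_poly_congr (fun a => by simp) (by simp) α
    rw [this, map_id]
  have e2 : dilate 0 α = 1 := by
    have : dilate 0 α = Matrix.GeneralLinearGroup.map C (evalZero α) := by
      rw [dilate_def, evalZero, map_map]
      exact map_poly_congr (fun a => by simp) (by simp) α
    rw [this, h0, map_one]
  rwa [e1, e2, inv_one, mul_one] at this

end LocalGlobal

/-! ### Orbits of the first basis vector and explicit factorizations. -/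

section Orbits

variable {R : Type*} [CommRing R] {n : ℕ}

theorem elemIdeal_le_ker {k : GroupType} (hk : k.Admissible n) (I : Ideal R) :
    elemIdeal k n I ≤ (Matrix.GeneralLinearGroup.map (n := Fin n) (Ideal.Quotient.mk I)).ker := by
  refine elemIdeal_le_of_root hk fun i j hij z hz => ?_
  rw [MonoidHom.mem_ker, map_root hk hij, Ideal.Quotient.eq_zero_iff_mem.mpr hz, root_zero]

theorem relE_le_relG {k : GroupType} (hk : k.Admissible n) (I : Ideal R) :
    relE k n I ≤ relG k n I :=
  le_inf (relE_le_G hk I) (relE_le fun c _ _ hx =>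
    (MonoidHom.normal_ker _).conj_mem _ (elemIdeal_le_ker hk I hx) c)

/-- The first row of `g⁻¹` witnesses unimodularity of the first column of `g`. Statements 5, 6 and 7
thereby reduce to vectors in `Um n I`. -/
theorem orbitE1_subset_Um {k : GroupType} (hk : k.Admissible n) {I : Ideal R}
    {H : Subgroup (GL (Fin n) R)} (hH : H ≤ relG k n I) : orbitE1 H ⊆ Um n I := by
  rintro _ ⟨g, hg, rfl⟩
  have hcol : (g : Matrix (Fin n) (Fin n) R) *ᵥ bv ⟨0, hk.pos⟩ = fun i => g.val i ⟨0, hk.pos⟩ :=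
    mulVec_single_one _ _
  rw [e1_eq_bv hk.pos]
  refine ⟨⟨bv ⟨0, hk.pos⟩ ᵥ* (g⁻¹).val, ?_⟩, fun i => ?_⟩
  · have h1 : ((g⁻¹ : GL (Fin n) R) : Matrix (Fin n) (Fin n) R) * g.val = 1 := by simp
    rw [← dotProduct_mulVec, mulVec_mulVec, h1, one_mulVec]
    simp
  · have := mem_ker_map_mk_iff.mp (hH hg).2 i ⟨0, hk.pos⟩
    rw [hcol, e1_eq_bv hk.pos, bv_apply]
    rwa [Matrix.one_apply] at this

theorem transvectionsElementary (h2 : IsUnit (2 : R)) {k : GroupType} (hk : k.Admissible n)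
    {I : Ideal R} {V : Set (Fin n → R)} (hV : V ⊆ Um n I) : TransvectionsElementary k n I V :=
  fun _ _ hv hg => ⟨_, elemIdeal_le_relE k I (transv_mem_elemIdeal h2 hk (hV hv) hg),
    coe_transv h2 hk hg⟩

theorem exists_list_of_mem {k : GroupType} (hk : k.Admissible n) {I : Ideal R}
    {g : GL (Fin n) R[X]} (hg : g ∈ elemIdeal k n (Ideal.span {X} * polyIdeal I)) :
    ∃ L : List (Fin n × Fin n × R[X]),
      (∀ t ∈ L, IsGenIndex k t.1 t.2.1 ∧ t.2.2 ∈ polyIdeal I) ∧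
      (g : Matrix (Fin n) (Fin n) R[X]) = (L.map fun t => ge k t.1 t.2.1 (X * t.2.2)).prod := by
  refine elemIdeal_induction_gen hk (P := fun g => ∃ L : List (Fin n × Fin n × R[X]),
      (∀ t ∈ L, IsGenIndex k t.1 t.2.1 ∧ t.2.2 ∈ polyIdeal I) ∧
      (g : Matrix (Fin n) (Fin n) R[X]) = (L.map fun t => ge k t.1 t.2.1 (X * t.2.2)).prod)
    ⟨[], by simp, by simp⟩ ?_ ?_ hg
  · rintro a b ⟨L, hL, e⟩ ⟨L', hL', e'⟩
    refine ⟨L ++ L', fun t ht => ?_, by simp [e, e']⟩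
    exact (List.mem_append.mp ht).elim (hL t) (hL' t)
  · intro i j hij z hz
    obtain ⟨p, hp, rfl⟩ := Ideal.mem_span_singleton_mul.mp hz
    exact ⟨[(i, j, p)], by simpa using ⟨hij, hp⟩, by simp [coe_root hk hij.isRoot]⟩

theorem coe_transv_C (h2 : IsUnit (2 : R)) {k : GroupType} (hk : k.Admissible n) {I : Ideal R}
    {v w : Fin n → R} (hg : GoodPair k I v w) (p : R[X]) :
    (transv k ((C : R →+* R[X]) ∘ v) (p • (C ∘ w)) : Matrix (Fin n) (Fin n) R[X]) =
      1 + p • (M k v w).map C := by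
  rw [coe_transv (isUnit_two_map h2 C) hk (hg.map_smul C _), M_smul_right, map_M]

theorem polynomialDecomposition (h2 : IsUnit (2 : R)) {k : GroupType} (hk : k.Admissible n)
    (I : Ideal R) : PolynomialDecomposition k n I := by
  intro v w hv hg
  obtain ⟨d₀, h⟩ := exists_transv_mem h2 hk (orbitE1_subset_Um hk (relE_le_relG hk I) hv) hg
  refine ⟨d₀, fun d hd => ?_⟩
  obtain ⟨g, hgm, e⟩ : ∃ g ∈ elemIdeal k n (Ideal.span {X} * polyIdeal I),
      (g : Matrix (Fin n) (Fin n) R[X]) = 1 + (X : R[X]) ^ d • (M k v w).map C :=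
    ⟨_, h d hd, coe_transv_C h2 hk hg _⟩
  refine ⟨⟨g, elemIdeal_le_relE _ _ (elemIdeal_mono k Ideal.mul_le_right hgm), e⟩, ?_⟩
  rw [← e]
  exact exists_list_of_mem hk hgm

end Orbits

end ClassicalRel

theorem theorem3p1 {R : Type*} [CommRing R] (h2 : IsUnit (2 : R)) (I : Ideal R) (hI : I ≠ ⊤)
    (k : ClassicalRel.GroupType) (n : ℕ) (hn : k.Admissible n) :
    List.TFAE
      [ClassicalRel.Normality k n I,
       ClassicalRel.TransvectionsElementary k n I (ClassicalRel.Um n I),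
       ClassicalRel.LocalGlobal k n I,
       ClassicalRel.Dilation k n I,
       ClassicalRel.PolynomialDecomposition k n I,
       ClassicalRel.TransvectionsElementary k n I
         (ClassicalRel.orbitE1 (ClassicalRel.relE k n I)),
       ClassicalRel.TransvectionsElementary k n I
         (ClassicalRel.orbitE1 (ClassicalRel.relG k n I))] ∧
    (ClassicalRel.Normality k n I ∧
      ClassicalRel.TransvectionsElementary k n I (ClassicalRel.Um n I) ∧
      ClassicalRel.LocalGlobal k n I ∧
      ClassicalRel.Dilation k n I ∧
      ClassicalRel.PolynomialDecomposition k n I ∧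
      ClassicalRel.TransvectionsElementary k n I
        (ClassicalRel.orbitE1 (ClassicalRel.relE k n I)) ∧
      ClassicalRel.TransvectionsElementary k n I
        (ClassicalRel.orbitE1 (ClassicalRel.relG k n I))) := by
  have t1 := ClassicalRel.normality h2 hn I
  have t2 := ClassicalRel.transvectionsElementary h2 hn (Set.Subset.refl (ClassicalRel.Um n I))
  have t3 := ClassicalRel.localGlobal h2 hn I
  have t4 := ClassicalRel.dilation h2 hn I
  have t5 := ClassicalRel.polynomialDecomposition h2 hn I
  have t6 := ClassicalRel.transvectionsElementary h2 hn
    (ClassicalRel.orbitE1_subset_Um hn (ClassicalRel.relE_le_relG hn I))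
  have t7 := ClassicalRel.transvectionsElementary h2 hn
    (ClassicalRel.orbitE1_subset_Um hn (le_refl (ClassicalRel.relG k n I)))
  -- All seven statements hold, so each is equivalent to `True`.
  refine ⟨List.tfae_of_forall True _ ?_, t1, t2, t3, t4, t5, t6, t7⟩
  simp only [List.forall_mem_cons, List.not_mem_nil, iff_true]
  exact ⟨t1, t2, t3, t4, t5, t6, t7, fun _ h => h.elim⟩
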